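/- **Notation.** $\mathbb N=\{1,2,\dots\}$; $c_{00}$ is the space of finitely supported real sequences on $\mathbb N$, with unit vectors $e_i$ (also read as coordinate functionals $e_i^*$), and $f(x)=\sum_i f_ix_i$ for $f,x\in c_{00}$. The range of $x$ is the smallest interval containing $\mathrm{supp}\,x$. A block sequence is a finite sequence of non-zero vectors with successive supports. A subconvex combination is $\sum c_rf_r$ with $c_r\ge0$, $\sum c_r\le1$. A sequence $(u_s)$ $C$-dominates $(v_s)$ if $u_s\mapsto v_s$ extends to a linear operator of norm at most $C$ on $\mathrm{span}\{u_s\}$. **Parameters.** Fix $m_j,n_j\in\{2^k\}$ with $m_1=2$, $n_1\ge4$, $m_{j+1}\ge m_j^{m_j}$, $n_{j+1}\ge(10n_j)^{m_{j+1}^2}$, and such that for every $k\in\mathbb N$ some $n_{2j}$ is of the form $2^{kp}$, $p\in\mathbb N$. Fix a partition $\mathbb N=\bigcup_{s\ge0}L_s$ in which each $L_s$ contains infinitely many even and infinitely many odd numbers, and a partition $\mathbb N=\bigcup_{s\ge1}J_s$ into infinite sets. Put $\mathrm{supp}_h(x)=\{s:\mathrm{supp}(x)\cap J_s\ne\emptyset\}$;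 $x$ is simple if $\mathrm{supp}_h(x)$ is a singleton; a block sequence is h-block if the sets $\mathrm{supp}_h$ of its terms are also successive. Fix * for $s\ge1$ an injection $\sigma_s$ from the non-empty block sequences of rational vectors supported in $J_s$ into $L_s\cap2\mathbb N$ with $\sigma_s(f_1,\dots,f_d)>\max\mathrm{supp}(f_d)\,\|f_1+\dots+f_d\|_\infty^{-1}$; * a map $\sigma$ from the non-empty h-block sequences of rational vectors to infinite subsets of $L_0\cap2\mathbb N$, with disjoint values at distinct sequences; * a map $\tau$ from the non-empty block sequences of simple rational vectors to subsets of $\mathbb N$, with disjoint values at distinct sequences, each value meeting $L_s\cap2\mathbb N$ for every $s\ge1$. **The space $Y$.** $K_Y\subset c_{00}$ is the smallest set containing all $\pm e_i^*$, closed under restriction to intervals and under rational subconvex combinations, and containing $m_j^{-1}(f_1+\dots+f_d)$ for every even $j\in L_0$ and every block sequence $f_1<\dots<f_d$ in $K_Y$ with $d\le n_j$. $Y$ is the completion of $c_{00}$ under $\|x\|_Y=\sup\{|f(x)|:f\in K_Y\}$. **The space $X$.** $K\subset c_{00}$ is the smallest set that contains all $\pm e_i^*$, is symmetric, closed under restriction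 to intervals and under rational subconvex combinations, and contains * $m_j^{-1}(f_1+\dots+f_d)$ for $s\ge1$, $j\in L_s$ even, $d\le n_j$ and $f_1<\dots<f_d$ block in $K\cap c_{00}(J_s)$; * $m_q^{-1}(f_1+\dots+f_d)$ for $s\ge1$, $q\in L_s$ odd and every block sequence in $K\cap c_{00}(J_s)$ with $1<d\le n_q$, $w(f_1)<n_q^{-2}$ and $w(f_{i+1})=m^{-1}_{\sigma_s(f_1,\dots,f_i)}$ for $1\le i<d$; * $m_j^{-1}(f_1+\dots+f_d)$ for $j\in L_0$ even, $d\le n_j$ and $(f_i)$ h-block in $K$; * $m_q^{-1}(f_1+\dots+f_d)$ for $q\in L_0$ odd and every h-block sequence in $K$ with $1<d\le n_q$, $w_h(f_1)<n_q^{-2}$ and $w_h(f_{i+1})=m_k^{-1}$ for some $k\in\sigma(f_1,\dots,f_i)$, $1\le i<d$; * $\sum_{i=1}^N\varepsilon_i(f_{2i-1}+f_{2i})$ for $N\ge1$, $\varepsilon_i\in\{-1,0,1\}$ and every $N$-g-special sequence $(f_1,\dots,f_{2N})$ in $K$: a block sequence with $\mathrm{supp}_h(f_{2i-1})=\{i\}$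 and $\mathrm{supp}_h(f_{2i})=\{N+i\}$ for $i\le N$, $w(f_1)<N^{-1}$ and $w(f_{i+1})=m_k^{-1}$ for some $k\in\tau(f_1,\dots,f_i)$, $1\le i<2N$. Here the functionals obtained by the first two rules, and their restrictions to intervals, are called weighted with weight $w(f)=m_j^{-1}$ (resp. $m_q^{-1}$), and those obtained by the third and fourth rules, and their restrictions to intervals, have h-weight $w_h(f)=m_j^{-1}$ (resp. $m_q^{-1}$); a functional may have several weights. $X$ is the completion of $c_{00}$ under $\|x\|=\sup\{|f(x)|:f\in K\}$, and $I_s:X\to X$, $s\ge1$, is the continuous extension of $x\mapsto x|_{J_s}$. **g-special pairs.** Vectors $x_1,\dots,x_{2N}\in c_{00}\subset X$ and functionals $f_1,\dots,f_{2N}\in K$ form an $N$-g-special pair ($N\ge1$) if $(f_i)$ is $N$-g-special and, for each $i\le 2N$, $\mathrm{supp}_h(x_i)=\mathrm{supp}_h(f_i)=\{r_i\}$ for some $r_i$, and $(f_i,x_i)$ is a $k_i$-exact pair in $X_{r_i}$ for some even $k_i$, where $m_{k_i}^{-1}=w(f_i)$ is the weight used in the definition of the g-special sequence. Here $(f,x)$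 is $k$-exact in $X_r$ if $f\in K$ and $x$ are supported in $J_r$, $f$ is weighted with $w(f)=m_k^{-1}$, $f(x)=1$, $\|x\|\le3$, $f$ and $x$ have the same range, and $|g(x)|\le5\max\{m_k^{-1},w(g)\}$ for every weighted $g\in K$ supported in $J_r$ with weight $w(g)\ne m_k^{-1}$. **Proposition.** 1. For every $N$-g-special pair $((x_1,\dots,x_{2N}),(f_1,\dots,f_{2N}))$, the sequence $(x_{2s-1})_{s=1}^N$ $1$-dominates the unit vector basis $(e_s)_{s=1}^N$ of $\ell_1^N$ and is $3$-dominated by it. Moreover, there are numbers $M_N\in\mathbb N$, $N\in\mathbb N$, such that for every $N$-g-special pair with $\min\mathrm{supp}(x_1)>M_N$: 2. the sequence $(x_{2s-1}-x_{2s})_{s=1}^N$ $1$-dominates $(e_s)_{s=1}^N\subset Y$ and is $20$-dominated by $(e_s)_{s=1}^N\subset Y$; 3. for every $R\le N$ and all real scalars $(a_s)_{s=1}^R$ there are real scalars $(b_s)_{s=1}^R$ such that $x=\sum_{s=1}^Rb_s(x_{2s-1}-x_{2s})$ satisfies $\|x\|\le1$ and $\bigl\|\sum_{s=1}^Ra_sI_s\bigr\|\le40\,\bigl\|\sum_{s=1}^Ra_sI_sx\bigr\|$.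 -/

import Mathlib

namespace HorizontalGM

/-! ### Finitely supported sequences -/

/-- `c₀₀`: finitely supported real sequences indexed by the positive integers. Its elements are used
both as vectors and as functionals. -/
abbrev c00 : Type := ℕ+ →₀ ℝ

/-- The unit vector `e_i`, which is also the coordinate functional `e_i^*`. -/
noncomputable def unit (i : ℕ+) : c00 := Finsupp.single i 1

/-- The value `f(x) = ∑ i, f_i x_i` of the functional `f` at the vector `x`. -/
noncomputable def act (f : c00) : c00 →ₗ[ℝ] ℝ := Finsupp.linearCombination ℝ (f : ℕ+ → ℝ)

open Classical in
/-- The restriction `E x` of `x` to a set `E` of coordinates. -/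
noncomputable def res (E : Set ℕ+) : c00 →ₗ[ℝ] c00 where
  toFun x := x.filter (· ∈ E)
  map_add' _ _ := Finsupp.filter_add
  map_smul' _ _ := Finsupp.filter_smul

/-- All coordinates are rational. -/
def IsRational (f : c00) : Prop := ∀ i, ∃ q : ℚ, f i = (q : ℝ)

/-- `x ∈ c₀₀(J)`. -/
def SuppIn (J : Set ℕ+) (x : c00) : Prop := ∀ i ∈ x.support, i ∈ J

/-- The range: the smallest interval containing the support. -/
def rng (x : c00) : Set ℕ+ := {k | ∃ i ∈ x.support, ∃ j ∈ x.support, i ≤ k ∧ k ≤ j}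

/-- The supremum norm on `c₀₀`. -/
noncomputable def supNorm (x : c00) : ℝ := ⨆ i, |x i|

/-- A finite block sequence: non-zero vectors with successive supports. -/
def Block (l : List c00) : Prop :=
  (∀ f ∈ l, f ≠ 0) ∧ l.Pairwise fun f g => ∀ i ∈ f.support, ∀ j ∈ g.support, i < j

/-- The list of the first `d` terms `f 0, …, f (d - 1)`. Finite sequences `(f_1, …, f_d)` are
represented by functions on `ℕ`, whose values `f 0, …, f (d - 1)` are the terms `f_1, …, f_d`. -/
def pre (f : ℕ → c00) (d : ℕ) : List c00 := (List.range d).map f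

/-! ### Mixed Tsirelson norming sets -/

/-- The canonical norming set of the mixed Tsirelson space `T[(𝒜_{n_j}, m_j⁻¹)_{j ∈ S}]`. -/
inductive MixedTsirelson (m n : ℕ → ℕ) (S : Set ℕ) : c00 → Prop
  | pos (i : ℕ+) : MixedTsirelson m n S (unit i)
  | neg (i : ℕ+) : MixedTsirelson m n S (-unit i)
  | avg (j : ℕ) (hj : j ∈ S) (d : ℕ) (hd : d ≤ n j) (f : ℕ → c00)
      (hf : ∀ i < d, MixedTsirelson m n S (f i)) (hb : Block (pre f d)) :
      MixedTsirelson m n S ((m j : ℝ)⁻¹ • ∑ i ∈ Finset.range d, f i)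
  | restrict (E : Set ℕ+) (hE : E.OrdConnected) (f : c00) (hf : MixedTsirelson m n S f) :
      MixedTsirelson m n S (res E f)
  | convex (d : ℕ) (c : ℕ → ℚ) (f : ℕ → c00) (hc : ∀ i < d, 0 ≤ c i)
      (hc1 : ∑ i ∈ Finset.range d, c i ≤ 1) (hf : ∀ i < d, MixedTsirelson m n S (f i)) :
      MixedTsirelson m n S (∑ i ∈ Finset.range d, (c i : ℝ) • f i)

/-! ### The parameters of the construction -/

/-- The set `supp_h x` with respect to the partition `J`. -/
def hsupp (J : ℕ+ → Set ℕ+) (x : c00) : Set ℕ+ := {s | ∃ i ∈ x.support, i ∈ J s}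

/-- A finite h-block sequence. -/
def HBlock (J : ℕ+ → Set ℕ+) (l : List c00) : Prop :=
  Block l ∧ l.Pairwise fun f g => ∀ s ∈ hsupp J f, ∀ t ∈ hsupp J g, s < t

/-- A vector is simple if its h-support is a singleton. -/
def Simple (J : ℕ+ → Set ℕ+) (x : c00) : Prop := ∃ s, hsupp J x = {s}

/-- The domain of `σ_s`: non-empty block sequences of rational vectors in `c₀₀(J_s)`. -/
def sigmaDom (J : Set ℕ+) : Set (List c00) :=
  {l | l ≠ [] ∧ Block l ∧ ∀ f ∈ l, IsRational f ∧ SuppIn J f}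

/-- The domain of `σ`: non-empty h-block sequences of rational vectors. -/
def hsigmaDom (J : ℕ+ → Set ℕ+) : Set (List c00) :=
  {l | l ≠ [] ∧ HBlock J l ∧ ∀ f ∈ l, IsRational f}

/-- The domain of `τ`: non-empty block sequences of simple rational vectors. -/
def tauDom (J : ℕ+ → Set ℕ+) : Set (List c00) :=
  {l | l ≠ [] ∧ Block l ∧ ∀ f ∈ l, IsRational f ∧ Simple J f}

/-- The data fixed in the construction of the space. The sequences `m`, `n` are indexed by the
positive integers (their values at `0` play no role), and `L s`, `s = 0, 1, …`, partition the
positive integers. -/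
structure Params where
  m : ℕ → ℕ
  n : ℕ → ℕ
  m_one : m 1 = 2
  n_one : 4 ≤ n 1
  m_succ : ∀ j, 1 ≤ j → m j ^ m j ≤ m (j + 1)
  n_succ : ∀ j, 1 ≤ j → (10 * n j) ^ (m (j + 1) ^ 2) ≤ n (j + 1)
  m_pow : ∀ j, 1 ≤ j → ∃ k, m j = 2 ^ k
  n_pow : ∀ j, 1 ≤ j → ∃ k, n j = 2 ^ k
  n_even : ∀ k, 1 ≤ k → ∃ j, 1 ≤ j ∧ ∃ p, 1 ≤ p ∧ n (2 * j) = 2 ^ (k * p)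
  /-- The partition of the positive integers that distributes the weights. -/
  L : ℕ → Set ℕ
  L_union : ⋃ s, L s = {j | 1 ≤ j}
  L_disj : Pairwise fun s t => Disjoint (L s) (L t)
  L_even : ∀ s, (L s ∩ {j | Even j}).Infinite
  L_odd : ∀ s, (L s ∩ {j | Odd j}).Infinite
  /-- The partition of the coordinates. -/
  J : ℕ+ → Set ℕ+
  J_union : ⋃ s, J s = Set.univ
  J_disj : Pairwise fun s t => Disjoint (J s) (J t)
  J_inf : ∀ s, (J s).Infinite
  /-- The coding functions `σ_s`, `s = 1, 2, …`. -/
  sigma : ℕ+ → List c00 → ℕ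
  sigma_mem : ∀ s, ∀ l ∈ sigmaDom (J s), sigma s l ∈ L s ∩ {j | Even j}
  sigma_inj : ∀ s, Set.InjOn (sigma s) (sigmaDom (J s))
  sigma_lt : ∀ s, ∀ l ∈ sigmaDom (J s), ∀ f ∈ l.getLast?, ∀ i ∈ f.support,
    ((i : ℕ) : ℝ) * (supNorm l.sum)⁻¹ < (sigma s l : ℝ)
  /-- The coding function `σ`. -/
  hsigma : List c00 → Set ℕ
  hsigma_sub : ∀ l ∈ hsigmaDom J, hsigma l ⊆ L 0 ∩ {j | Even j}
  hsigma_inf : ∀ l ∈ hsigmaDom J, (hsigma l).Infinite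
  hsigma_disj : (hsigmaDom J).Pairwise fun l l' => Disjoint (hsigma l) (hsigma l')
  /-- The coding function `τ`. -/
  tau : List c00 → Set ℕ
  tau_meet : ∀ l ∈ tauDom J, ∀ s : ℕ+, (tau l ∩ (L s ∩ {j | Even j})).Nonempty
  tau_disj : (tauDom J).Pairwise fun l l' => Disjoint (tau l) (tau l')

/-! ### The norming set of `X` -/

/-- `(f_1, …, f_d)`, with `f_i` of weight `m_{k_i}⁻¹`, is coded as a special sequence for the odd
index `q = 2j - 1` with respect to `σ_s`. -/
def SpecialCode (P : Params) (s : ℕ+) (q d : ℕ) (f : ℕ → c00) (k : ℕ → ℕ) : Prop :=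
  1 < d ∧ d ≤ P.n q ∧ Block (pre f d) ∧ (∀ i < d, SuppIn (P.J s) (f i)) ∧
    P.n q ^ 2 < P.m (k 0) ∧ ∀ i, i + 1 < d → k (i + 1) = P.sigma s (pre f (i + 1))

/-- `(f_1, …, f_d)`, with `f_i` of h-weight `m_{k_i}⁻¹`, is coded as an h-special sequence for the
odd index `q = 2j - 1`. -/
def HSpecialCode (P : Params) (q d : ℕ) (f : ℕ → c00) (k : ℕ → ℕ) : Prop :=
  1 < d ∧ d ≤ P.n q ∧ HBlock P.J (pre f d) ∧
    P.n q ^ 2 < P.m (k 0) ∧ ∀ i, i + 1 < d → k (i + 1) ∈ P.hsigma (pre f (i + 1))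

/-- `(f_1, …, f_{2N})`, with `f_i` of weight `m_{k_i}⁻¹`, is coded as an `N`-g-special sequence:
a block sequence with `supp_h f_{2i-1} = {i}` and `supp_h f_{2i} = {N + i}` for `i = 1, …, N`
(`Nat.succPNat i` is the positive integer `i + 1`). -/
def GSpecialCode (P : Params) (N : ℕ) (f : ℕ → c00) (k : ℕ → ℕ) : Prop :=
  1 ≤ N ∧ Block (pre f (2 * N)) ∧
    (∀ i < N, hsupp P.J (f (2 * i)) = {i.succPNat} ∧
      hsupp P.J (f (2 * i + 1)) = {(N + i).succPNat}) ∧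
    N < P.m (k 0) ∧ ∀ i, i + 1 < 2 * N → k (i + 1) ∈ P.tau (pre f (i + 1))

/-- Tags recording how a functional has been obtained. -/
inductive Tag
  /-- an element of the norming set -/
  | any
  /-- a weighted functional of weight `m_k⁻¹` -/
  | wt (k : ℕ)
  /-- an h-weighted functional of h-weight `m_k⁻¹` -/
  | hwt (k : ℕ)

/-- Simultaneous definition of the norming set `K` (tag `any`), of the weighted functionals of
weight `m_k⁻¹` (tag `wt k`) and of the h-weighted functionals of h-weight `m_k⁻¹` (tag `hwt k`). -/
inductive Norming (P : Params) : Tag → c00 → Prop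
  | pos (i : ℕ+) : Norming P .any (unit i)
  | neg (f : c00) (hf : Norming P .any f) : Norming P .any (-f)
  | reg (s : ℕ+) (j : ℕ) (hj : j ∈ P.L s) (hje : Even j) (d : ℕ) (hd : d ≤ P.n j) (f : ℕ → c00)
      (hf : ∀ i < d, Norming P .any (f i)) (hs : ∀ i < d, SuppIn (P.J s) (f i))
      (hb : Block (pre f d)) :
      Norming P (.wt j) ((P.m j : ℝ)⁻¹ • ∑ i ∈ Finset.range d, f i)
  | special (s : ℕ+) (q : ℕ) (hq : q ∈ P.L s) (hqo : Odd q) (d : ℕ) (f : ℕ → c00) (k : ℕ → ℕ)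
      (hf : ∀ i < d, Norming P (.wt (k i)) (f i)) (hc : SpecialCode P s q d f k) :
      Norming P (.wt q) ((P.m q : ℝ)⁻¹ • ∑ i ∈ Finset.range d, f i)
  | hreg (j : ℕ) (hj : j ∈ P.L 0) (hje : Even j) (d : ℕ) (hd : d ≤ P.n j) (f : ℕ → c00)
      (hf : ∀ i < d, Norming P .any (f i)) (hb : HBlock P.J (pre f d)) :
      Norming P (.hwt j) ((P.m j : ℝ)⁻¹ • ∑ i ∈ Finset.range d, f i)
  | hspecial (q : ℕ) (hq : q ∈ P.L 0) (hqo : Odd q) (d : ℕ) (f : ℕ → c00) (k : ℕ → ℕ)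
      (hf : ∀ i < d, Norming P (.hwt (k i)) (f i)) (hc : HSpecialCode P q d f k) :
      Norming P (.hwt q) ((P.m q : ℝ)⁻¹ • ∑ i ∈ Finset.range d, f i)
  | gspecial (N : ℕ) (f : ℕ → c00) (k : ℕ → ℕ)
      (hf : ∀ i < 2 * N, Norming P (.wt (k i)) (f i)) (hc : GSpecialCode P N f k)
      (ε : ℕ → ℝ) (hε : ∀ i < N, ε i = -1 ∨ ε i = 0 ∨ ε i = 1) :
      Norming P .any (∑ i ∈ Finset.range N, ε i • (f (2 * i) + f (2 * i + 1)))
  | restrict (t : Tag) (E : Set ℕ+) (hE : E.OrdConnected) (f : c00) (hf : Norming P t f) :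
      Norming P t (res E f)
  | convex (d : ℕ) (c : ℕ → ℚ) (f : ℕ → c00) (hc : ∀ i < d, 0 ≤ c i)
      (hc1 : ∑ i ∈ Finset.range d, c i ≤ 1) (hf : ∀ i < d, Norming P .any (f i)) :
      Norming P .any (∑ i ∈ Finset.range d, (c i : ℝ) • f i)
  | forget (t : Tag) (f : c00) (hf : Norming P t f) : Norming P .any f

/-! ### Spaces given by a norming set -/

/-- A subset of `c₀₀` whose functionals define a norm on `c₀₀`. -/
structure NormingSet where
  carrier : Set c00
  unit_mem : ∀ i, unit i ∈ carrier
  coord_le : ∀ f ∈ carrier, ∀ i, |f i| ≤ 1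

/-- The vector space `c₀₀`, to be normed by `‖x‖ = sup {|f(x)| : f ∈ K}`. -/
def C00 (_K : NormingSet) : Type := c00

noncomputable instance (K : NormingSet) : AddCommGroup (C00 K) := inferInstanceAs (AddCommGroup c00)
noncomputable instance (K : NormingSet) : Module ℝ (C00 K) := inferInstanceAs (Module ℝ c00)

/-- The norm with norming set `K`. -/
noncomputable def kNorm (K : NormingSet) (x : c00) : ℝ := sSup ((fun f => |act f x|) '' K.carrier)

theorem act_apply (f x : c00) : act f x = ∑ i ∈ x.support, x i * f i := by
  simp [act, Finsupp.linearCombination_apply, Finsupp.sum]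

theorem act_unit (i : ℕ+) (x : c00) : act (unit i) x = x i := by
  rw [act_apply, Finset.sum_eq_single i]
  · simp [unit]
  · intro j _ hj
    simp [unit, Ne.symm hj]
  · intro h
    simp [Finsupp.notMem_support_iff.mp h]

theorem abs_act_le (K : NormingSet) {f : c00} (hf : f ∈ K.carrier) (x : c00) :
    |act f x| ≤ ∑ i ∈ x.support, |x i| := by
  rw [act_apply]
  refine (Finset.abs_sum_le_sum_abs _ _).trans (Finset.sum_le_sum fun i _ => ?_)
  rw [abs_mul]
  exact mul_le_of_le_one_right (abs_nonneg _) (K.coord_le f hf i)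

theorem bddAbove_act (K : NormingSet) (x : c00) :
    BddAbove ((fun f => |act f x|) '' K.carrier) := by
  refine ⟨∑ i ∈ x.support, |x i|, ?_⟩
  rintro _ ⟨f, hf, rfl⟩
  exact abs_act_le K hf x

theorem abs_act_le_kNorm (K : NormingSet) {f : c00} (hf : f ∈ K.carrier) (x : c00) :
    |act f x| ≤ kNorm K x :=
  le_csSup (bddAbove_act K x) ⟨f, hf, rfl⟩

theorem kNorm_le (K : NormingSet) {x : c00} {C : ℝ} (h : ∀ f ∈ K.carrier, |act f x| ≤ C) :
    kNorm K x ≤ C := by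
  refine csSup_le ⟨_, unit 1, K.unit_mem 1, rfl⟩ ?_
  rintro _ ⟨f, hf, rfl⟩
  exact h f hf

theorem kNorm_nonneg (K : NormingSet) (x : c00) : 0 ≤ kNorm K x :=
  (abs_nonneg _).trans (abs_act_le_kNorm K (K.unit_mem 1) x)

theorem kNorm_smul_le (K : NormingSet) (a : ℝ) (x : c00) : kNorm K (a • x) ≤ |a| * kNorm K x :=
  kNorm_le K fun f hf => by
    rw [map_smul, smul_eq_mul, abs_mul]
    exact mul_le_mul_of_nonneg_left (abs_act_le_kNorm K hf x) (abs_nonneg a)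

noncomputable instance (K : NormingSet) : NormedAddCommGroup (C00 K) :=
  AddGroupNorm.toNormedAddCommGroup
    { toFun := fun x => kNorm K x
      map_zero' := le_antisymm (kNorm_le K fun f _ => by
        have : act f (0 : c00) = 0 := map_zero _
        exact (congrArg _ this).trans_le (by simp)) (kNorm_nonneg K _)
      add_le' := fun x y => kNorm_le K fun f hf => by
        have h : act f ((x : c00) + (y : c00)) = act f x + act f y := map_add _ _ _
        exact (congrArg _ h).trans_le ((abs_add_le _ _).trans
          (add_le_add (abs_act_le_kNorm K hf x) (abs_act_le_kNorm K hf y)))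
      neg' := fun x => by
        have h : ∀ y : c00, kNorm K (-y) = kNorm K y := fun y => by
          simp only [kNorm, map_neg, abs_neg]
        exact h x
      eq_zero_of_map_eq_zero' := fun x hx => by
        refine Finsupp.ext (M := ℝ) fun i => ?_
        have key : ∀ y : c00, kNorm K y = 0 → y i = 0 := fun y hy => by
          have h := abs_act_le_kNorm K (K.unit_mem i) y
          rw [act_unit, hy] at h
          exact abs_nonpos_iff.mp h
        exact key x hx }

theorem norm_C00 (K : NormingSet) (x : C00 K) : ‖x‖ = kNorm K x := rfl

noncomputable instance (K : NormingSet) : NormedSpace ℝ (C00 K) where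
  norm_smul_le a x := kNorm_smul_le K a x

/-- The completion of `c₀₀` under the norm with norming set `K`. -/
abbrev Space (K : NormingSet) : Type := UniformSpace.Completion (C00 K)

/-- The inclusion of `c₀₀` into the completion. -/
noncomputable def incl (K : NormingSet) (x : c00) : Space K :=
  ((show C00 K from x : C00 K) : UniformSpace.Completion (C00 K))

/-! ### Coordinates of functionals in the norming sets -/

theorem eq_zero_or_eq_zero_of_block {f : ℕ → c00} {d a b : ℕ} (hb : Block (pre f d)) (ha : a < d)
    (hbd : b < d) (hab : a ≠ b) (i : ℕ+) : f a i = 0 ∨ f b i = 0 := by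
  have h := hb.2
  rw [pre, List.pairwise_map] at h
  by_contra! hne
  have key : ∀ a b, a < b → b < d → f a i ≠ 0 → f b i ≠ 0 → False := by
    intro a b hab hb ha' hb'
    have h' := (List.pairwise_iff_getElem.mp h) a b (by simp; omega) (by simpa using hb) hab
    simp only [List.getElem_range] at h'
    exact lt_irrefl _ (h' i (Finsupp.mem_support_iff.mpr ha') i (Finsupp.mem_support_iff.mpr hb'))
  rcases lt_or_gt_of_ne hab with h1 | h1
  · exact key a b h1 hbd hne.1 hne.2
  · exact key b a h1 ha hne.2 hne.1

theorem sum_eq_zero_or {ι M : Type*} [AddCommMonoid M] (s : Finset ι) (g : ι → M)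
    (h : ∀ a ∈ s, ∀ b ∈ s, a ≠ b → g a = 0 ∨ g b = 0) :
    ∑ a ∈ s, g a = 0 ∨ ∃ a ∈ s, ∑ a ∈ s, g a = g a := by
  by_cases h0 : ∀ a ∈ s, g a = 0
  · exact Or.inl (Finset.sum_eq_zero h0)
  · push Not at h0
    obtain ⟨a, ha, hne⟩ := h0
    refine Or.inr ⟨a, ha, Finset.sum_eq_single a (fun b hb hba => ?_) (fun h => absurd ha h)⟩
    exact (h b hb a ha hba).resolve_right hne

theorem abs_sum_block_le {f : ℕ → c00} {d : ℕ} (hb : Block (pre f d))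
    (h1 : ∀ i < d, ∀ p, |f i p| ≤ 1) (p : ℕ+) : |(∑ i ∈ Finset.range d, f i) p| ≤ 1 := by
  rw [Finsupp.finsetSum_apply]
  rcases sum_eq_zero_or (Finset.range d) (fun i => f i p) (fun a ha b hbd hab =>
    eq_zero_or_eq_zero_of_block hb (Finset.mem_range.mp ha) (Finset.mem_range.mp hbd) hab p)
    with h | ⟨a, ha, h⟩
  · rw [h]; simp
  · rw [h]; exact h1 a (Finset.mem_range.mp ha) p

theorem abs_avg_le {f : ℕ → c00} {d M : ℕ} (hb : Block (pre f d))
    (h1 : ∀ i < d, ∀ p, |f i p| ≤ 1) (p : ℕ+) :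
    |((M : ℝ)⁻¹ • ∑ i ∈ Finset.range d, f i) p| ≤ 1 := by
  rw [Finsupp.smul_apply, smul_eq_mul, abs_mul, abs_of_nonneg (by positivity)]
  refine mul_le_one₀ ?_ (abs_nonneg _) (abs_sum_block_le hb h1 p)
  rcases Nat.eq_zero_or_pos M with h | h
  · simp [h]
  · exact inv_le_one_of_one_le₀ (by exact_mod_cast h)

theorem abs_convex_le {d : ℕ} {c : ℕ → ℚ} {f : ℕ → c00} (hc : ∀ i < d, 0 ≤ c i)
    (hc1 : ∑ i ∈ Finset.range d, c i ≤ 1) (h1 : ∀ i < d, ∀ p, |f i p| ≤ 1) (p : ℕ+) :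
    |(∑ i ∈ Finset.range d, (c i : ℝ) • f i) p| ≤ 1 := by
  rw [Finsupp.finsetSum_apply]
  have hc1' : ∑ i ∈ Finset.range d, (c i : ℝ) ≤ 1 := by exact_mod_cast hc1
  refine (Finset.abs_sum_le_sum_abs _ _).trans (le_trans (Finset.sum_le_sum fun i hi => ?_) hc1')
  have hi' := Finset.mem_range.mp hi
  have h0 : (0 : ℝ) ≤ c i := by exact_mod_cast hc i hi'
  rw [Finsupp.smul_apply, smul_eq_mul, abs_mul, abs_of_nonneg h0]
  exact mul_le_of_le_one_right h0 (h1 i hi' p)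

theorem res_apply (E : Set ℕ+) (x : c00) (p : ℕ+) [Decidable (p ∈ E)] :
    res E x p = if p ∈ E then x p else 0 := by
  simp [res, Finsupp.filter_apply]

theorem abs_res_le {E : Set ℕ+} {f : c00} (h : ∀ p, |f p| ≤ 1) (p : ℕ+) : |res E f p| ≤ 1 := by
  classical
  rw [res_apply]
  split_ifs
  · exact h p
  · simp

theorem abs_unit_le (i p : ℕ+) : |unit i p| ≤ 1 := by
  classical
  rw [unit, Finsupp.single_apply]
  split_ifs <;> simp

theorem MixedTsirelson.abs_le {m n : ℕ → ℕ} {S : Set ℕ} {f : c00} (h : MixedTsirelson m n S f) :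
    ∀ p, |f p| ≤ 1 := by
  induction h with
  | pos i => exact abs_unit_le i
  | neg i => intro p; rw [Finsupp.neg_apply, abs_neg]; exact abs_unit_le i p
  | avg j hj d hd f hf hb ih => exact abs_avg_le hb ih
  | restrict E hE f hf ih => exact abs_res_le ih
  | convex d c f hc hc1 hf ih => exact abs_convex_le hc hc1 ih

theorem sum_pairs (f : ℕ → c00) (ε : ℕ → ℝ) (N : ℕ) :
    ∑ i ∈ Finset.range N, ε i • (f (2 * i) + f (2 * i + 1)) =
      ∑ i ∈ Finset.range (2 * N), ε (i / 2) • f i := by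
  induction N with
  | zero => simp
  | succ N ih =>
    rw [Finset.sum_range_succ, ih, show 2 * (N + 1) = 2 * N + 1 + 1 by ring,
      Finset.sum_range_succ, Finset.sum_range_succ, smul_add, add_assoc]
    congr 4 <;> omega

theorem Norming.abs_le {P : Params} {t : Tag} {f : c00} (h : Norming P t f) :
    ∀ p, |f p| ≤ 1 := by
  induction h with
  | pos i => exact abs_unit_le i
  | neg f hf ih => intro p; rw [Finsupp.neg_apply, abs_neg]; exact ih p
  | reg s j hj hje d hd f hf hs hb ih => exact abs_avg_le hb ih
  | special s q hq hqo d f k hf hc ih => exact abs_avg_le hc.2.2.1 ih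
  | hreg j hj hje d hd f hf hb ih => exact abs_avg_le hb.1 ih
  | hspecial q hq hqo d f k hf hc ih => exact abs_avg_le hc.2.2.1.1 ih
  | gspecial N f k hf hc ε hε ih =>
    intro p
    rw [sum_pairs, Finsupp.finsetSum_apply]
    rcases sum_eq_zero_or (Finset.range (2 * N)) (fun i => (ε (i / 2) • f i) p)
      (fun a ha b hb hab => by
        rcases eq_zero_or_eq_zero_of_block hc.2.1 (Finset.mem_range.mp ha)
          (Finset.mem_range.mp hb) hab p with h | h
        · left; simp [h]
        · right; simp [h]) with h | ⟨a, ha, h⟩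
    · rw [h]; simp
    · rw [h, Finsupp.smul_apply, smul_eq_mul, abs_mul]
      have ha' := Finset.mem_range.mp ha
      refine mul_le_one₀ ?_ (abs_nonneg _) (ih a ha' p)
      rcases hε (a / 2) (by omega) with h | h | h <;> rw [h] <;> simp
  | restrict t E hE f hf ih => exact abs_res_le ih
  | convex d c f hc hc1 hf ih => exact abs_convex_le hc hc1 ih
  | forget t f hf ih => exact ih

/-! ### The spaces `Y` and `X` -/

/-- The norming set `K_Y` of `Y = T[(𝒜_{n_j}, m_j⁻¹)_j]`, where `j` runs over the even elements of
`L_0`. -/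
def KY (P : Params) : NormingSet where
  carrier := {f | MixedTsirelson P.m P.n (P.L 0 ∩ {j | Even j}) f}
  unit_mem i := MixedTsirelson.pos i
  coord_le _ hf := MixedTsirelson.abs_le hf

/-- The norming set `K` of `X`. -/
def KX (P : Params) : NormingSet where
  carrier := {f | Norming P .any f}
  unit_mem i := Norming.pos i
  coord_le _ hf := Norming.abs_le hf

/-- The mixed Tsirelson space `Y`. -/
abbrev Y (P : Params) : Type := Space (KY P)

/-- The space `X`. -/
abbrev X (P : Params) : Type := Space (KX P)

/-! ### The projections `I_s` -/

theorem Norming.zero (P : Params) : Norming P .any 0 := by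
  have h := Norming.convex (P := P) 0 (fun _ => 0) (fun _ => 0) (by simp) (by simp) (by simp)
  simpa using h

theorem Norming.smul {P : Params} {f : c00} (hf : Norming P .any f) (q : ℚ) (h0 : 0 ≤ q)
    (h1 : q ≤ 1) : Norming P .any ((q : ℝ) • f) := by
  have h := Norming.convex (P := P) 1 (fun _ => q) (fun _ => f) (by simpa using h0)
    (by simpa using h1) (by simpa using hf)
  simpa using h

theorem Norming.inv_smul {P : Params} {f : c00} (hf : Norming P .any f) (M : ℕ) :
    Norming P .any ((M : ℝ)⁻¹ • f) := by
  have h := Norming.smul hf ((M : ℚ)⁻¹) (by positivity) (by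
    rcases Nat.eq_zero_or_pos M with h | h
    · simp [h]
    · exact inv_le_one_of_one_le₀ (by exact_mod_cast h))
  simpa using h

theorem res_eq_zero {P : Params} {t : ℕ+} {f : c00} (hs : t ∉ hsupp P.J f) :
    res (P.J t) f = 0 := by
  classical
  ext p
  rw [res_apply]
  split_ifs with hp
  · by_contra hne
    exact hs ⟨p, Finsupp.mem_support_iff.mpr hne, hp⟩
  · rfl

theorem res_eq_self {E : Set ℕ+} {f : c00} (hs : SuppIn E f) : res E f = f := by
  classical
  ext p
  rw [res_apply]
  split_ifs with hp
  · rfl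
  · by_contra hne
    exact hp (hs p (Finsupp.mem_support_iff.mpr (Ne.symm hne)))

theorem hsupp_subset_of_suppIn {P : Params} {s : ℕ+} {f : c00} (hs : SuppIn (P.J s) f) :
    hsupp P.J f ⊆ {s} := by
  rintro t ⟨i, hi, hit⟩
  by_contra hne
  exact Set.disjoint_left.mp (P.J_disj hne) hit (hs i hi)

theorem res_comm (E F : Set ℕ+) (f : c00) : res E (res F f) = res F (res E f) := by
  classical
  ext p
  simp only [res_apply]
  split_ifs <;> rfl

/-- The restriction of an element of the norming set to `J_s` is in the norming set. -/
theorem Norming.res_J {P : Params} {t : Tag} {f : c00} (h : Norming P t f) (s : ℕ+) :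
    Norming P .any (res (P.J s) f) := by
  have single : ∀ (d : ℕ) (g : ℕ → c00), (∀ i < d, Norming P .any (res (P.J s) (g i))) →
      (∀ a < d, ∀ b < d, a ≠ b → res (P.J s) (g a) = 0 ∨ res (P.J s) (g b) = 0) →
      Norming P .any (res (P.J s) (∑ i ∈ Finset.range d, g i)) := by
    intro d g hg h0
    rw [map_sum]
    rcases sum_eq_zero_or (Finset.range d) (fun i => res (P.J s) (g i)) (fun a ha b hb hab =>
      h0 a (Finset.mem_range.mp ha) b (Finset.mem_range.mp hb) hab) with h | ⟨a, ha, h⟩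
    · rw [h]; exact Norming.zero P
    · rw [h]; exact hg a (Finset.mem_range.mp ha)
  have wt : ∀ (r : ℕ+) (d : ℕ) (M k : ℕ) (g : ℕ → c00), (∀ i < d, SuppIn (P.J r) (g i)) →
      Norming P (.wt k) ((M : ℝ)⁻¹ • ∑ i ∈ Finset.range d, g i) →
      Norming P .any (res (P.J s) ((M : ℝ)⁻¹ • ∑ i ∈ Finset.range d, g i)) := by
    intro r d M k g hg hK
    rw [map_smul, map_sum]
    by_cases hrs : s = r
    · subst hrs
      rw [Finset.sum_congr rfl fun i hi => res_eq_self (hg i (Finset.mem_range.mp hi))]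
      exact Norming.forget _ _ hK
    · rw [Finset.sum_eq_zero fun i hi => res_eq_zero (t := s) fun hmem =>
        hrs (hsupp_subset_of_suppIn (hg i (Finset.mem_range.mp hi)) hmem), smul_zero]
      exact Norming.zero P
  have hblock : ∀ (d : ℕ) (g : ℕ → c00), HBlock P.J (pre g d) →
      ∀ a < d, ∀ b < d, a ≠ b → res (P.J s) (g a) = 0 ∨ res (P.J s) (g b) = 0 := by
    intro d g hg
    have hp := hg.2
    rw [pre, List.pairwise_map] at hp
    have key : ∀ a b, a < b → b < d → res (P.J s) (g a) = 0 ∨ res (P.J s) (g b) = 0 := by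
      intro a b hab hb
      have h' := (List.pairwise_iff_getElem.mp hp) a b (by simp; omega) (by simpa using hb) hab
      simp only [List.getElem_range] at h'
      by_contra! hne
      have ha' : s ∈ hsupp P.J (g a) := by
        by_contra hn; exact hne.1 (res_eq_zero (t := s) hn)
      have hb' : s ∈ hsupp P.J (g b) := by
        by_contra hn; exact hne.2 (res_eq_zero (t := s) hn)
      exact lt_irrefl _ (h' s ha' s hb')
    intro a ha b hb hab
    rcases lt_or_gt_of_ne hab with h1 | h1
    · exact key a b h1 hb
    · exact (key b a h1 ha).symm
  induction h with
  | pos i =>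
    classical
    by_cases hi : i ∈ P.J s
    · rw [res_eq_self]
      · exact Norming.pos i
      · intro p hp
        have : p = i := by
          by_contra hne
          exact (Finsupp.mem_support_iff.mp hp) (by simp [unit, Ne.symm hne])
        exact this ▸ hi
    · rw [res_eq_zero (t := s)]
      · exact Norming.zero P
      · rintro ⟨p, hp, hps⟩
        have : p = i := by
          by_contra hne
          exact (Finsupp.mem_support_iff.mp hp) (by simp [unit, Ne.symm hne])
        exact hi (this ▸ hps)
  | neg f hf ih => rw [map_neg]; exact Norming.neg _ ih
  | reg r j hj hje d hd f hf hs hb ih =>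
    exact wt r d _ _ f hs (Norming.reg r j hj hje d hd f hf hs hb)
  | special r q hq hqo d f k hf hc ih =>
    exact wt r d _ _ f hc.2.2.2.1 (Norming.special r q hq hqo d f k hf hc)
  | hreg j hj hje d hd f hf hb ih =>
    rw [map_smul]; exact Norming.inv_smul (single d f ih (hblock d f hb)) _
  | hspecial q hq hqo d f k hf hc ih =>
    rw [map_smul]; exact Norming.inv_smul (single d f ih (hblock d f hc.2.2.1)) _
  | gspecial N f k hf hc ε hε ih =>
    rw [sum_pairs]
    refine single (2 * N) (fun i => ε (i / 2) • f i) (fun i hi => ?_) ?_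
    · rw [map_smul]
      rcases hε (i / 2) (by omega) with h | h | h <;> rw [h]
      · rw [neg_one_smul]; exact Norming.neg _ (ih i hi)
      · rw [zero_smul]; exact Norming.zero P
      · rw [one_smul]; exact ih i hi
    · have hpos : ∀ a < 2 * N, s ∈ hsupp P.J (f a) →
          (s : ℕ) = if a % 2 = 0 then a / 2 + 1 else N + a / 2 + 1 := by
        intro a ha hmem
        have h2 := hc.2.2.1 (a / 2) (by omega)
        rcases Nat.mod_two_eq_zero_or_one a with h | h
        · rw [if_pos h]
          rw [show 2 * (a / 2) = a by omega] at h2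
          rw [h2.1] at hmem
          rw [Set.mem_singleton_iff.mp hmem]; rfl
        · rw [if_neg (by omega)]
          rw [show 2 * (a / 2) + 1 = a by omega] at h2
          rw [h2.2] at hmem
          rw [Set.mem_singleton_iff.mp hmem]; rfl
      intro a ha b hb hab
      simp only [map_smul]
      by_contra! hne
      have ha' : s ∈ hsupp P.J (f a) := by
        by_contra hn; exact hne.1 (by rw [res_eq_zero (t := s) hn, smul_zero])
      have hb' : s ∈ hsupp P.J (f b) := by
        by_contra hn; exact hne.2 (by rw [res_eq_zero (t := s) hn, smul_zero])
      have e1 := hpos a ha ha'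
      have e2 := hpos b hb hb'
      split_ifs at e1 e2 <;> omega
  | restrict t E hE f hf ih => rw [res_comm]; exact Norming.restrict _ E hE _ ih
  | convex d c f hc hc1 hf ih =>
    rw [map_sum]
    simp only [map_smul]
    exact Norming.convex d c _ hc hc1 ih
  | forget t f hf ih => exact ih

theorem act_res (E : Set ℕ+) (f x : c00) : act f (res E x) = act (res E f) x := by
  classical
  have h : ∀ g y : c00, y.support ⊆ x.support → act g y = ∑ i ∈ x.support, y i * g i := by
    intro g y hy
    rw [act_apply]
    refine Finset.sum_subset hy fun i _ hi => ?_
    rw [Finsupp.notMem_support_iff.mp hi, zero_mul]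
  have hsub : (res E x).support ⊆ x.support := by
    intro i hi
    rw [Finsupp.mem_support_iff, res_apply] at hi
    rw [Finsupp.mem_support_iff]
    intro h0
    exact hi (by simp [h0])
  rw [h f _ hsub, h _ x (Finset.Subset.refl _)]
  refine Finset.sum_congr rfl fun i _ => ?_
  rw [res_apply, res_apply]
  split_ifs <;> simp

/-- The projection `x ↦ x|_{J_s}` on `c₀₀`, as an operator of norm at most one. -/
noncomputable def proj0 (P : Params) (s : ℕ+) : C00 (KX P) →L[ℝ] C00 (KX P) :=
  LinearMap.mkContinuous
    { toFun := fun x => res (P.J s) x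
      map_add' := fun x y => map_add (res (P.J s)) x y
      map_smul' := fun a x => map_smul (res (P.J s)) a x } 1
    (fun x => by
      rw [one_mul]
      refine kNorm_le (KX P) fun f hf => ?_
      have h := act_res (P.J s) f x
      exact (congrArg _ h).trans_le (abs_act_le_kNorm (KX P) (Norming.res_J hf s) x))

/-- The projection `I_s : X → X` onto `X_s`, the continuous extension of `x ↦ x|_{J_s}`. -/
noncomputable def proj (P : Params) (s : ℕ+) : X P →L[ℝ] X P := (proj0 P s).completion

/-! ### Domination, exact pairs and g-special pairs -/

/-- The family `u` `C`-dominates the family `v`: the map `u_i ↦ v_i` extends to a bounded linear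
operator of norm at most `C` on the linear span of `u`. -/
def Dominates {ι E F : Type*} [NormedAddCommGroup E] [NormedSpace ℝ E] [NormedAddCommGroup F]
    [NormedSpace ℝ F] (C : ℝ) (u : ι → E) (v : ι → F) : Prop :=
  ∃ T : Submodule.span ℝ (Set.range u) →L[ℝ] F, ‖T‖ ≤ C ∧
    ∀ i, T ⟨u i, Submodule.subset_span (Set.mem_range_self i)⟩ = v i

/-- `(f, x)` is a `j`-exact pair in the space `X_r`, whose norming set consists of the elements of
`K` supported in `J_r`. A vector whose range is that of some `f ∈ K` is finitely supported, so that
`x` is taken in `c₀₀`. -/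
def ExactPair (P : Params) (r : ℕ+) (j : ℕ) (f x : c00) : Prop :=
  SuppIn (P.J r) x ∧ SuppIn (P.J r) f ∧ Norming P (.wt j) f ∧
    act f x = 1 ∧ kNorm (KX P) x ≤ 3 ∧ rng x = rng f ∧
    ∀ (k : ℕ) (g : c00), SuppIn (P.J r) g → Norming P (.wt k) g → P.m k ≠ P.m j →
      |act g x| ≤ 5 * max (P.m j : ℝ)⁻¹ (P.m k : ℝ)⁻¹

/-- `((x_1, …, x_{2N}), (f_1, …, f_{2N}))` is an `N`-g-special pair. The indices `k_i` record the
weights `w(f_i) = m_{k_i}⁻¹`, which are even. -/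
def GSpecialPair (P : Params) (N : ℕ) (x f : ℕ → c00) : Prop :=
  ∃ k : ℕ → ℕ, GSpecialCode P N f k ∧ (∀ i < 2 * N, Norming P (.wt (k i)) (f i)) ∧
    ∀ i < 2 * N, ∃ r, hsupp P.J (x i) = {r} ∧ hsupp P.J (f i) = {r} ∧
      Even (k i) ∧ ExactPair P r (k i) (f i) (x i)

/-- The unit vectors `e_1, e_2, …` of `ℓ₁`, enumerated from `0`. -/
noncomputable def ell1Basis (s : ℕ) : lp (fun _ : ℕ => ℝ) 1 := lp.single 1 s 1

/-- The unit vectors `e_1, e_2, …` of `Y`, enumerated from `0`. -/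
noncomputable def yBasis (P : Params) (s : ℕ) : Y P := incl (KY P) (unit s.succPNat)

end HorizontalGM

open HorizontalGM

namespace HorizontalGM

/-! Terms are numbered from 0. In a g-special pair, `x (2 * s)` and `f (2 * s)` live over `J_{s+1}`,
`x (2 * s + 1)` and `f (2 * s + 1)` over `J_{N+s+1}`, and `f l (x l) = 1`; since the h-supports
differ, `f k (x l) = 0` for `k ≠ l`.

Comparison with `ℓ₁`: the g-special functional with signs `sign (c s)` takes the value `∑ |c s|` on
`∑ c s • x (2 * s)` (`GPair.sum_abs_le`); the other side is the triangle inequality.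

Lower `Y`-estimate: if `h_1 < h_2 < …` are in `K` with `h_s` supported in `J_s`, then replacing
`e_s` by `h_s` maps `K_Y` into `K` (`HLinear.linearCombination_mem`), because h-block averages with
even index in `L_0` belong to `K`. Substituting the functionals `f (2 * s)` reproduces the `Y`-norm
of the coefficients.

Upper `Y`-estimate (`FarGPair.abs_act_altSum_le`): induction over `K` for the alternating sum of the
`x l` with `l` in an interval. A functional over a single `J_r` sees one `x l`. An even h-average
splits the indices into successive intervals and is absorbed by the same average in `K_Y`. An odd
h-average has, after its first relevant term, only tiny h-weights, as the coding takes large values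
on sequences reaching far out. A g-special functional either starts like `(f_l)`, and then has equal
values on both vectors of a pair, which cancel in the difference, until the two sequences branch,
after which the disjointness of the values of `τ` makes the weights different and the values small;
or it starts differently and is small from the outset. Up to two terms escape, so the differences of
its values sum to at most 9 (`FarGPair.sum_abs_gspecial_le`).

Norm of `∑ a_s I_s`: every `g` in `K` is controlled by two successive families
(`Norming.exists_hlinear`), because the even and the odd terms of a g-special sequence each form
one. By substitution the coefficients `β_s = g (I_s y)` have `Y`-norm at most `2‖y‖`
(`kNorm_vec_act_le`). If `g` and `y` almost norm `∑ a_s I_s`, then suitably scaled `β_s` are the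
required `b_s`: the upper `Y`-estimate bounds the vector of differences, and the projections keep
only `b_s x (2 * s)`, whose `ℓ₁`-behaviour gives at least a multiple of `∑ a_s β_s`. -/

/-! ### Finite sequences with successive supports -/

/-- The support of `f` lies before the support of `g`. -/
def Before (f g : c00) : Prop := ∀ i ∈ f.support, ∀ j ∈ g.support, i < j

theorem pairwise_pre {f : ℕ → c00} {d : ℕ} {R : c00 → c00 → Prop} :
    (pre f d).Pairwise R ↔ ∀ i j, i < j → j < d → R (f i) (f j) := by
  rw [pre, List.pairwise_map, List.pairwise_iff_getElem]
  simp only [List.length_range, List.getElem_range]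
  constructor
  · intro h i j hij hj
    exact h i j (hij.trans hj) hj hij
  · intro h i j _ hj hij
    exact h i j hij hj

theorem forall_mem_pre {f : ℕ → c00} {d : ℕ} {p : c00 → Prop} :
    (∀ g ∈ pre f d, p g) ↔ ∀ i < d, p (f i) := by
  simp [pre]

theorem block_pre_iff {f : ℕ → c00} {d : ℕ} :
    Block (pre f d) ↔ (∀ i < d, f i ≠ 0) ∧ ∀ i j, i < j → j < d → Before (f i) (f j) := by
  rw [Block, pairwise_pre, forall_mem_pre]
  rfl

theorem hblock_pre_iff {J : ℕ+ → Set ℕ+} {f : ℕ → c00} {d : ℕ} :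
    HBlock J (pre f d) ↔ Block (pre f d) ∧
      ∀ i j, i < j → j < d → ∀ s ∈ hsupp J (f i), ∀ t ∈ hsupp J (f j), s < t := by
  rw [HBlock, pairwise_pre]

theorem Block.pre_mono {f : ℕ → c00} {d e : ℕ} (h : Block (pre f d)) (hed : e ≤ d) :
    Block (pre f e) := by
  rw [block_pre_iff] at h ⊢
  exact ⟨fun i hi => h.1 i (hi.trans_le hed), fun i j hij hj => h.2 i j hij (hj.trans_le hed)⟩

theorem HBlock.pre_mono {J : ℕ+ → Set ℕ+} {f : ℕ → c00} {d e : ℕ} (h : HBlock J (pre f d))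
    (hed : e ≤ d) : HBlock J (pre f e) := by
  rw [hblock_pre_iff] at h ⊢
  exact ⟨h.1.pre_mono hed, fun i j hij hj => h.2 i j hij (hj.trans_le hed)⟩

theorem pre_inj {f g : ℕ → c00} {d e : ℕ} (h : pre f d = pre g e) :
    d = e ∧ ∀ i < d, f i = g i := by
  have hl := congrArg List.length h
  simp only [pre, List.length_map, List.length_range] at hl
  subst hl
  refine ⟨rfl, fun i hi => ?_⟩
  have := congrArg (fun l => l[i]?) h
  simpa [pre, hi] using this

/-- The zero terms of a finite sequence can be dropped without changing its sum. -/
theorem exists_subseq_ne_zero {M : Type*} [AddCommMonoid M] (f : ℕ → M) (d : ℕ) :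
    ∃ e ≤ d, ∃ φ : ℕ → ℕ, (∀ i < e, φ i < d) ∧ (∀ i j, i < j → j < e → φ i < φ j) ∧
      (∀ i < e, f (φ i) ≠ 0) ∧ ∑ i ∈ Finset.range e, f (φ i) = ∑ i ∈ Finset.range d, f i := by
  induction d with
  | zero => exact ⟨0, le_rfl, id, by simp, by simp, by simp, by simp⟩
  | succ d ih =>
    obtain ⟨e, hed, φ, h1, h2, h3, h4⟩ := ih
    by_cases h0 : f d = 0
    · refine ⟨e, hed.trans (Nat.le_succ d), φ, fun i hi => (h1 i hi).trans (Nat.lt_succ_self d),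
        h2, h3, ?_⟩
      rw [h4, Finset.sum_range_succ, h0, add_zero]
    · refine ⟨e + 1, by omega, fun i => if i < e then φ i else d, fun i hi => ?_,
        fun i j hij hj => ?_, fun i hi => ?_, ?_⟩
      · dsimp only
        split_ifs with h
        · exact (h1 i h).trans (Nat.lt_succ_self d)
        · exact Nat.lt_succ_self d
      · dsimp only
        have hi : i < e := by omega
        rw [if_pos hi]
        split_ifs with h
        · exact h2 i j hij h
        · exact h1 i hi
      · dsimp only
        split_ifs with h
        · exact h3 i h
        · exact h0
      · rw [Finset.sum_range_succ, Finset.sum_range_succ, ← h4]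
        dsimp only
        rw [if_neg (lt_irrefl e)]
        congr 1
        exact Finset.sum_congr rfl fun i hi => by rw [if_pos (Finset.mem_range.mp hi)]

/-! ### The duality pairing and restrictions -/

theorem act_eq_sum {f x : c00} {s : Finset ℕ+} (hs : x.support ⊆ s) :
    act f x = ∑ i ∈ s, x i * f i := by
  rw [act_apply]
  refine Finset.sum_subset hs fun i _ hi => ?_
  rw [Finsupp.notMem_support_iff.mp hi, zero_mul]

theorem act_comm (f x : c00) : act f x = act x f := by
  classical
  rw [act_eq_sum (Finset.subset_union_left (s₂ := f.support)),
    act_eq_sum (Finset.subset_union_right (s₁ := x.support))]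
  exact Finset.sum_congr rfl fun i _ => mul_comm _ _

theorem act_add_left (f g x : c00) : act (f + g) x = act f x + act g x := by
  rw [act_comm, map_add, act_comm x, act_comm x]

theorem act_neg_left (f x : c00) : act (-f) x = -act f x := by
  rw [act_comm, map_neg, act_comm x]

theorem act_smul_left (c : ℝ) (f x : c00) : act (c • f) x = c * act f x := by
  rw [act_comm, map_smul, act_comm x, smul_eq_mul]

theorem act_zero_left (x : c00) : act 0 x = 0 := by
  rw [act_comm, map_zero]

theorem act_sum_left {ι : Type*} (s : Finset ι) (f : ι → c00) (x : c00) :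
    act (∑ i ∈ s, f i) x = ∑ i ∈ s, act (f i) x := by
  rw [act_comm, map_sum]
  exact Finset.sum_congr rfl fun i _ => act_comm _ _

theorem mem_support_res {E : Set ℕ+} {x : c00} {i : ℕ+} :
    i ∈ (res E x).support ↔ i ∈ E ∧ i ∈ x.support := by
  classical
  rw [Finsupp.mem_support_iff, res_apply, Finsupp.mem_support_iff]
  split_ifs with h <;> simp [h]

theorem res_res (E F : Set ℕ+) (x : c00) : res E (res F x) = res (E ∩ F) x := by
  classical
  ext p
  by_cases hE : p ∈ E <;> by_cases hF : p ∈ F <;> simp [res_apply, hE, hF]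

theorem suppIn_res (E : Set ℕ+) (x : c00) : SuppIn E (res E x) := fun _ hi =>
  (mem_support_res.mp hi).1

theorem SuppIn.res {E : Set ℕ+} {x : c00} (h : SuppIn E x) (F : Set ℕ+) : SuppIn E (res F x) :=
  fun i hi => h i (mem_support_res.mp hi).2

theorem suppIn_zero (E : Set ℕ+) : SuppIn E 0 := by
  intro i hi; simp at hi

theorem SuppIn.neg {E : Set ℕ+} {x : c00} (h : SuppIn E x) : SuppIn E (-x) := by
  intro i hi
  rw [Finsupp.support_neg] at hi
  exact h i hi

theorem SuppIn.smul {E : Set ℕ+} {x : c00} (h : SuppIn E x) (c : ℝ) : SuppIn E (c • x) :=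
  fun i hi => h i (Finsupp.support_smul hi)

theorem SuppIn.sum {ι : Type*} {E : Set ℕ+} {s : Finset ι} {f : ι → c00}
    (h : ∀ a ∈ s, SuppIn E (f a)) : SuppIn E (∑ a ∈ s, f a) := by
  intro i hi
  by_contra hiE
  refine Finsupp.mem_support_iff.mp hi ?_
  rw [Finsupp.finsetSum_apply]
  exact Finset.sum_eq_zero fun a ha => Finsupp.notMem_support_iff.mp fun hia => hiE (h a ha i hia)

theorem suppIn_unit {E : Set ℕ+} {i : ℕ+} (hi : i ∈ E) : SuppIn E (unit i) := by
  classical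
  intro p hp
  have : p = i := by
    by_contra hne
    exact (Finsupp.mem_support_iff.mp hp) (by simp [unit, Ne.symm hne])
  exact this ▸ hi

theorem act_eq_zero {f x : c00} (h : ∀ i ∈ f.support, i ∉ x.support) : act f x = 0 := by
  rw [act_apply]
  refine Finset.sum_eq_zero fun i hi => ?_
  have : f i = 0 := by
    by_contra hne
    exact h i (Finsupp.mem_support_iff.mpr hne) hi
  rw [this, mul_zero]

theorem exists_mem_support_of_act_ne_zero {f x : c00} (h : act f x ≠ 0) :
    ∃ i ∈ f.support, i ∈ x.support := by
  by_contra! hne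
  exact h (act_eq_zero hne)

theorem act_res_of_suppIn_left {E : Set ℕ+} {f : c00} (hf : SuppIn E f) (x : c00) :
    act f (res E x) = act f x := by
  rw [act_res, res_eq_self hf]

theorem kNorm_res_le {P : Params} {E : Set ℕ+} (hE : E.OrdConnected) (x : c00) :
    kNorm (KX P) (res E x) ≤ kNorm (KX P) x :=
  kNorm_le _ fun f hf => by
    rw [act_res]
    exact abs_act_le_kNorm (KX P) (Norming.restrict _ E hE f hf) x

theorem kNorm_sum_le (K : NormingSet) {ι : Type*} (s : Finset ι) (f : ι → c00) :
    kNorm K (∑ i ∈ s, f i) ≤ ∑ i ∈ s, kNorm K (f i) :=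
  kNorm_le K fun g hg => by
    rw [map_sum]
    exact (Finset.abs_sum_le_sum_abs _ _).trans
      (Finset.sum_le_sum fun i _ => abs_act_le_kNorm K hg _)

theorem exists_lt_act {K : NormingSet} {x : c00} {c : ℝ} (h : c < kNorm K x) :
    ∃ f ∈ K.carrier, c < |act f x| := by
  by_contra! hne
  exact absurd (kNorm_le K hne) (not_le.mpr h)

theorem rng_ordConnected (x : c00) : (rng x).OrdConnected := by
  refine ⟨?_⟩
  rintro a ⟨i, hi, j, hj, h1, _⟩ b ⟨i', hi', j', hj', _, h2⟩ c ⟨hac, hcb⟩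
  exact ⟨i, hi, j', hj', h1.trans hac, hcb.trans h2⟩

theorem mem_rng_of_mem_support {x : c00} {i : ℕ+} (hi : i ∈ x.support) : i ∈ rng x :=
  ⟨i, hi, i, hi, le_rfl, le_rfl⟩

theorem Before.rng {f g : c00} (h : Before f g) {a b : ℕ+} (ha : a ∈ rng f) (hb : b ∈ rng g) :
    a < b := by
  obtain ⟨_, _, j, hj, _, h2⟩ := ha
  obtain ⟨i, hi, _, _, h1, _⟩ := hb
  exact h2.trans_lt ((h j hj i hi).trans_le h1)

theorem suppIn_of_hsupp {P : Params} {x : c00} {r : ℕ+} (h : hsupp P.J x ⊆ {r}) :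
    SuppIn (P.J r) x := by
  intro i hi
  have : i ∈ ⋃ s, P.J s := by rw [P.J_union]; trivial
  obtain ⟨s, hs⟩ := Set.mem_iUnion.mp this
  have : s = r := h ⟨i, hi, hs⟩
  exact this ▸ hs

theorem Params.J_eq {P : Params} {s t i : ℕ+} (hs : i ∈ P.J s) (ht : i ∈ P.J t) : s = t := by
  by_contra hne
  exact Set.disjoint_left.mp (P.J_disj hne) hs ht

theorem act_eq_zero_of_suppIn {P : Params} {f x : c00} {s t : ℕ+} (hf : SuppIn (P.J s) f)
    (hx : SuppIn (P.J t) x) (hst : s ≠ t) : act f x = 0 :=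
  act_eq_zero fun i hi hi' => hst (P.J_eq (hf i hi) (hx i hi'))

/-! ### Averages of sequences that may contain zeros -/

/-- Closure under negation is not among the rules for `K_Y`; it propagates from the signed unit
vectors through every rule. -/
theorem MixedTsirelson.neg' {m n : ℕ → ℕ} {S : Set ℕ} {f : c00} (h : MixedTsirelson m n S f) :
    MixedTsirelson m n S (-f) := by
  induction h with
  | pos i => exact .neg i
  | neg i => rw [neg_neg]; exact .pos i
  | avg j hj d hd f hf hb ih =>
    rw [← smul_neg, ← Finset.sum_neg_distrib]
    refine .avg j hj d hd _ ih ?_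
    rw [block_pre_iff] at hb ⊢
    refine ⟨fun i hi => neg_ne_zero.mpr (hb.1 i hi), fun i k hik hk => ?_⟩
    intro a ha b hb'
    rw [Finsupp.support_neg] at ha hb'
    exact hb.2 i k hik hk a ha b hb'
  | restrict E hE f hf ih => rw [← map_neg]; exact .restrict E hE _ ih
  | convex d c f hc hc1 hf ih =>
    rw [← Finset.sum_neg_distrib]
    simp only [← smul_neg]
    exact .convex d c _ hc hc1 ih

/-- Block sequences have non-zero terms, but restriction and substitution create zeros. Dropping
them only shortens the sequence, and the rule allows any length up to `n j`. -/
theorem MixedTsirelson.avg' {m n : ℕ → ℕ} {S : Set ℕ} {j : ℕ} (hj : j ∈ S) {d : ℕ}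
    (hd : d ≤ n j) {f : ℕ → c00} (hf : ∀ i < d, MixedTsirelson m n S (f i))
    (hb : ∀ i k, i < k → k < d → Before (f i) (f k)) :
    MixedTsirelson m n S ((m j : ℝ)⁻¹ • ∑ i ∈ Finset.range d, f i) := by
  obtain ⟨e, hed, φ, h1, h2, h3, h4⟩ := exists_subseq_ne_zero f d
  rw [← h4]
  refine .avg j hj e (hed.trans hd) (fun i => f (φ i)) (fun i hi => hf _ (h1 i hi)) ?_
  rw [block_pre_iff]
  exact ⟨h3, fun i k hik hk => hb _ _ (h2 i k hik hk) (h1 k hk)⟩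

theorem Norming.hreg' {P : Params} {j : ℕ} (hj : j ∈ P.L 0) (hje : Even j) {d : ℕ}
    (hd : d ≤ P.n j) {f : ℕ → c00} (hf : ∀ i < d, Norming P .any (f i))
    (hb : ∀ i k, i < k → k < d → Before (f i) (f k))
    (hh : ∀ i k, i < k → k < d → ∀ s ∈ hsupp P.J (f i), ∀ t ∈ hsupp P.J (f k), s < t) :
    Norming P .any ((P.m j : ℝ)⁻¹ • ∑ i ∈ Finset.range d, f i) := by
  obtain ⟨e, hed, φ, h1, h2, h3, h4⟩ := exists_subseq_ne_zero f d
  rw [← h4]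
  refine .forget (.hwt j) _ (.hreg j hj hje e (hed.trans hd) (fun i => f (φ i))
    (fun i hi => hf _ (h1 i hi)) ?_)
  rw [hblock_pre_iff, block_pre_iff]
  exact ⟨⟨h3, fun i k hik hk => hb _ _ (h2 i k hik hk) (h1 k hk)⟩,
    fun i k hik hk => hh _ _ (h2 i k hik hk) (h1 k hk)⟩

/-! ### The parameters -/

theorem Params.one_le_of_mem_L {P : Params} {s j : ℕ} (h : j ∈ P.L s) : 1 ≤ j := by
  have : j ∈ ⋃ s, P.L s := Set.mem_iUnion.mpr ⟨s, h⟩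
  rwa [P.L_union] at this

theorem Params.two_le_m (P : Params) {j : ℕ} (hj : 1 ≤ j) : 2 ≤ P.m j := by
  induction j, hj using Nat.le_induction with
  | base => exact P.m_one.ge
  | succ j hj ih =>
    exact ih.trans ((Nat.le_self_pow (by omega) _).trans (P.m_succ j hj))

theorem Params.m_lt_succ (P : Params) {j : ℕ} (hj : 1 ≤ j) : P.m j < P.m (j + 1) := by
  have h2 := P.two_le_m hj
  refine lt_of_lt_of_le ?_ (P.m_succ j hj)
  calc P.m j = P.m j ^ 1 := (pow_one _).symm
    _ < P.m j ^ P.m j := Nat.pow_lt_pow_right h2 h2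

theorem Params.m_lt {P : Params} {j k : ℕ} (hj : 1 ≤ j) (hjk : j < k) : P.m j < P.m k := by
  induction k, hjk using Nat.le_induction with
  | base => exact P.m_lt_succ hj
  | succ k hk ih => exact ih.trans (P.m_lt_succ (by omega))

theorem Params.m_ne {P : Params} {j k : ℕ} (hj : 1 ≤ j) (hk : 1 ≤ k) (hjk : j ≠ k) :
    P.m j ≠ P.m k := by
  rcases lt_or_gt_of_ne hjk with h | h
  · exact (P.m_lt hj h).ne
  · exact (P.m_lt hk h).ne'

theorem Params.le_m (P : Params) {j : ℕ} (hj : 1 ≤ j) : j ≤ P.m j := by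
  induction j, hj using Nat.le_induction with
  | base => exact (by norm_num : 1 ≤ 2).trans P.m_one.ge
  | succ j hj ih => exact Nat.succ_le_of_lt (ih.trans_lt (P.m_lt_succ hj))

/-! ### Properties of the functionals in the norming set -/

/-- Puts the sequences inside `K` into the domains of the coding functions, which consist of
rational vectors. -/
theorem Norming.isRational {P : Params} {t : Tag} {f : c00} (h : Norming P t f) :
    IsRational f := by
  classical
  have avg : ∀ (d : ℕ) (M : ℝ) (c : ℕ → ℝ) (g : ℕ → c00), (∃ q : ℚ, M = q) →
      (∀ i < d, ∃ q : ℚ, c i = q) → (∀ i < d, IsRational (g i)) →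
      IsRational (M • ∑ i ∈ Finset.range d, c i • g i) := by
    rintro d M c g ⟨q, rfl⟩ hc hg p
    choose! c' hc' using hc
    choose! g' hg' using hg
    refine ⟨q * ∑ i ∈ Finset.range d, c' i * g' i p, ?_⟩
    rw [Finsupp.smul_apply, Finsupp.finsetSum_apply, smul_eq_mul]
    push_cast
    congr 1
    refine Finset.sum_congr rfl fun i hi => ?_
    rw [Pi.smul_apply, smul_eq_mul, hc' i (Finset.mem_range.mp hi),
      hg' i (Finset.mem_range.mp hi) p]
  have avg1 : ∀ (d M : ℕ) (g : ℕ → c00), (∀ i < d, IsRational (g i)) →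
      IsRational ((M : ℝ)⁻¹ • ∑ i ∈ Finset.range d, g i) := by
    intro d M g hg
    have := avg d (M : ℝ)⁻¹ (fun _ => 1) g ⟨(M : ℚ)⁻¹, by simp⟩ (fun _ _ => ⟨1, by simp⟩) hg
    simpa using this
  induction h with
  | pos i =>
    intro p
    rw [unit, Finsupp.single_apply]
    split_ifs
    · exact ⟨1, by simp⟩
    · exact ⟨0, by simp⟩
  | neg f hf ih =>
    intro p
    obtain ⟨q, hq⟩ := ih p
    exact ⟨-q, by simp [hq]⟩
  | reg s j hj hje d hd f hf hs hb ih => exact avg1 _ _ _ ih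
  | special s q hq hqo d f k hf hc ih => exact avg1 _ _ _ ih
  | hreg j hj hje d hd f hf hb ih => exact avg1 _ _ _ ih
  | hspecial q hq hqo d f k hf hc ih => exact avg1 _ _ _ ih
  | gspecial N f k hf hc ε hε ih =>
    rw [sum_pairs]
    have := avg (2 * N) 1 (fun i => ε (i / 2)) f ⟨1, by simp⟩ (fun i hi => ?_) ih
    · simpa using this
    · rcases hε (i / 2) (by omega) with h | h | h
      · exact ⟨-1, by simp [h]⟩
      · exact ⟨0, by simp [h]⟩
      · exact ⟨1, by simp [h]⟩
  | restrict t E hE f hf ih =>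
    intro p
    rw [res_apply]
    split_ifs
    · exact ih p
    · exact ⟨0, by simp⟩
  | convex d c f hc hc1 hf ih =>
    have := avg d 1 (fun i => (c i : ℝ)) f ⟨1, by simp⟩ (fun i _ => ⟨c i, rfl⟩) ih
    simpa using this
  | forget t f hf ih => exact ih

/-- Terms of an h-block sequence vanish on vectors supported in `J_r`, with at most one
exception. -/
theorem HBlock.act_eq_zero_or {P : Params} {f : ℕ → c00} {d : ℕ} (hb : HBlock P.J (pre f d))
    {r : ℕ+} {x : c00} (hx : SuppIn (P.J r) x) {a b : ℕ} (ha : a < d) (hbd : b < d)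
    (hab : a ≠ b) : act (f a) x = 0 ∨ act (f b) x = 0 := by
  have h := (hblock_pre_iff.mp hb).2
  by_contra! hne
  have mem : ∀ g : c00, act g x ≠ 0 → r ∈ hsupp P.J g := by
    intro g hg
    obtain ⟨i, hi, hix⟩ := exists_mem_support_of_act_ne_zero hg
    exact ⟨i, hi, hx i hix⟩
  rcases lt_or_gt_of_ne hab with h1 | h1
  · exact lt_irrefl _ (h a b h1 hbd r (mem _ hne.1) r (mem _ hne.2))
  · exact lt_irrefl _ (h b a h1 ha r (mem _ hne.2) r (mem _ hne.1))

theorem HBlock.abs_sum_act_le {P : Params} {f : ℕ → c00} {d : ℕ} (hb : HBlock P.J (pre f d))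
    {r : ℕ+} {x : c00} (hx : SuppIn (P.J r) x) {s : Finset ℕ} (hs : ∀ i ∈ s, i < d) {C : ℝ}
    (hC : 0 ≤ C) (h : ∀ i ∈ s, |act (f i) x| ≤ C) : |∑ i ∈ s, act (f i) x| ≤ C := by
  rcases sum_eq_zero_or s (fun i => act (f i) x) (fun a ha b hbs hab =>
    hb.act_eq_zero_or hx (hs a ha) (hs b hbs) hab) with h0 | ⟨a, ha, h0⟩
  · rw [h0, abs_zero]; exact hC
  · rw [h0]; exact h a ha

/-- Functionals of h-weight `m_k⁻¹` have norm at most `m_k⁻¹` on each `X_r`. -/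
theorem Norming.abs_act_le_of_hwt {P : Params} {t : Tag} {f : c00} (h : Norming P t f) :
    ∀ k, t = .hwt k → ∀ (r : ℕ+) (x : c00), SuppIn (P.J r) x →
      |act f x| ≤ (P.m k : ℝ)⁻¹ * kNorm (KX P) x := by
  have avg : ∀ (k d : ℕ) (f : ℕ → c00), (∀ i < d, Norming P .any (f i)) →
      HBlock P.J (pre f d) → ∀ (r : ℕ+) (x : c00), SuppIn (P.J r) x →
      |act ((P.m k : ℝ)⁻¹ • ∑ i ∈ Finset.range d, f i) x| ≤ (P.m k : ℝ)⁻¹ * kNorm (KX P) x := by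
    intro k d f hf hb r x hx
    rw [act_smul_left, abs_mul, abs_of_nonneg (a := (P.m k : ℝ)⁻¹) (by positivity), act_sum_left]
    refine mul_le_mul_of_nonneg_left ?_ (by positivity)
    -- As `x` lives over one `J_r`, at most one term of an h-block sequence sees it, so the `d`
    -- terms do not add up.
    exact hb.abs_sum_act_le hx (fun i hi => Finset.mem_range.mp hi) (kNorm_nonneg _ _)
      fun i hi => abs_act_le_kNorm (KX P) (hf i (Finset.mem_range.mp hi)) x
  induction h with
  | pos i => rintro k ⟨⟩
  | neg f hf ih => rintro k ⟨⟩
  | reg s j hj hje d hd f hf hs hb ih => rintro k ⟨⟩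
  | special s q hq hqo d f k hf hc ih => rintro k ⟨⟩
  | hreg j hj hje d hd f hf hb ih =>
    rintro k ⟨⟩
    exact avg j d f hf hb
  | hspecial q hq hqo d f k hf hc ih =>
    rintro k ⟨⟩
    exact avg q d f (fun i hi => .forget _ _ (hf i hi)) hc.2.2.1
  | gspecial N f k hf hc ε hε ih => rintro k ⟨⟩
  | restrict t E hE f hf ih =>
    rintro k rfl r x hx
    rw [← act_res]
    exact (ih k rfl r _ (hx.res E)).trans
      (mul_le_mul_of_nonneg_left (kNorm_res_le hE x) (by positivity))
  | convex d c f hc hc1 hf ih => rintro k ⟨⟩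
  | forget t f hf ih => rintro k ⟨⟩

/-! ### Domination -/

/-- The operator is defined through chosen coefficients; the inequality applied to a difference of
two coefficient vectors shows that the choice is immaterial, even if `u` is linearly dependent. -/
theorem dominates_of_norm_sum_le {ι E F : Type*} [Fintype ι] [NormedAddCommGroup E]
    [NormedSpace ℝ E] [NormedAddCommGroup F] [NormedSpace ℝ F] {C : ℝ} (hC : 0 ≤ C) {u : ι → E}
    {v : ι → F} (h : ∀ a : ι → ℝ, ‖∑ i, a i • v i‖ ≤ C * ‖∑ i, a i • u i‖) :
    Dominates C u v := by
  classical
  have hmem : ∀ x : Submodule.span ℝ (Set.range u), ∃ a : ι → ℝ, ∑ i, a i • u i = x := fun x =>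
    (Submodule.mem_span_range_iff_exists_fun ℝ).mp x.2
  choose a ha using hmem
  have key : ∀ b c : ι → ℝ, ∑ i, b i • u i = ∑ i, c i • u i →
      ∑ i, b i • v i = ∑ i, c i • v i := by
    intro b c hbc
    have := h (b - c)
    simp only [Pi.sub_apply, sub_smul, Finset.sum_sub_distrib, hbc, sub_self, norm_zero,
      mul_zero] at this
    exact sub_eq_zero.mp (norm_le_zero_iff.mp this)
  let T : Submodule.span ℝ (Set.range u) →ₗ[ℝ] F :=
    { toFun := fun x => ∑ i, a x i • v i
      map_add' := fun x y => by
        rw [← Finset.sum_add_distrib]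
        simp only [← add_smul]
        refine key _ (fun i => a x i + a y i) ?_
        simp only [add_smul, Finset.sum_add_distrib, ha, Submodule.coe_add]
      map_smul' := fun c x => by
        rw [RingHom.id_apply, Finset.smul_sum]
        simp only [smul_smul]
        refine key _ (fun i => c * a x i) ?_
        simp only [mul_smul, ← Finset.smul_sum, ha, Submodule.coe_smul] }
  refine ⟨T.mkContinuous C fun x => ?_, LinearMap.mkContinuous_norm_le _ hC _, fun i => ?_⟩
  · have := h (a x)
    rwa [ha] at this
  · have := key (a ⟨u i, Submodule.subset_span (Set.mem_range_self i)⟩) (Pi.single i 1)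
      (by rw [ha]; simp [Pi.single_apply])
    refine Eq.trans this ?_
    simp [Pi.single_apply]

/-! ### The inclusion of `c₀₀` -/

theorem norm_incl (K : NormingSet) (x : c00) : ‖incl K x‖ = kNorm K x :=
  UniformSpace.Completion.norm_coe (E := C00 K) x

/-- The inclusion of `c₀₀` into the completion as a linear map. -/
noncomputable def inclₗ (K : NormingSet) : c00 →ₗ[ℝ] Space K where
  toFun := incl K
  map_add' x y := UniformSpace.Completion.coe_add (α := C00 K) x y
  map_smul' c x := UniformSpace.Completion.coe_smul (X := C00 K) c x

theorem incl_sum_smul (K : NormingSet) {ι : Type*} (s : Finset ι) (a : ι → ℝ) (x : ι → c00) :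
    ∑ i ∈ s, a i • incl K (x i) = incl K (∑ i ∈ s, a i • x i) := by
  have := map_sum (inclₗ K) (fun i => a i • x i) s
  simp only [map_smul] at this
  exact this.symm

theorem proj_incl (P : Params) (s : ℕ+) (x : c00) :
    proj P s (incl (KX P) x) = incl (KX P) (res (P.J s) x) :=
  ContinuousLinearMap.completion_apply_coe (proj0 P s) (x : C00 (KX P))

/-! ### Averages in `Y` -/

/-- Almost norming functionals for the pieces, cut to the successive intervals `E i`, are averaged
with weight `m_j⁻¹` to one element of `K_Y`. -/
theorem sum_kNorm_res_le {P : Params} {j : ℕ} (hj : j ∈ P.L 0 ∩ {j | Even j}) {d : ℕ}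
    (hd : d ≤ P.n j) {E : ℕ → Set ℕ+} (hE : ∀ i < d, (E i).OrdConnected)
    (hb : ∀ i k, i < k → k < d → ∀ a ∈ E i, ∀ b ∈ E k, a < b) (v : c00) :
    ∑ i ∈ Finset.range d, kNorm (KY P) (res (E i) v) ≤ P.m j * kNorm (KY P) v := by
  refine le_of_forall_pos_le_add fun δ hδ => ?_
  -- Each piece may lose `δ / (d + 1)`; the `+ 1` only covers `d = 0`.
  have hδ' : 0 < δ / (d + 1) := by positivity
  have hex : ∀ i, ∃ g ∈ (KY P).carrier,
      kNorm (KY P) (res (E i) v) - δ / (d + 1) < act g (res (E i) v) := by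
    intro i
    obtain ⟨g, hg, hlt⟩ := exists_lt_act (K := KY P) (x := res (E i) v)
      (c := kNorm (KY P) (res (E i) v) - δ / (d + 1)) (by linarith)
    rcases abs_choice (act g (res (E i) v)) with h | h
    · exact ⟨g, hg, h ▸ hlt⟩
    · exact ⟨-g, MixedTsirelson.neg' hg, by rw [act_neg_left, ← h]; exact hlt⟩
  choose g hg hlt using hex
  have hK : MixedTsirelson P.m P.n (P.L 0 ∩ {j | Even j})
      ((P.m j : ℝ)⁻¹ • ∑ i ∈ Finset.range d, res (E i) (g i)) :=
    .avg' hj hd (fun i hi => .restrict _ (hE i hi) _ (hg i)) fun i k hik hk a ha b hb' =>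
      hb i k hik hk a (mem_support_res.mp ha).1 b (mem_support_res.mp hb').1
  have hm : (0 : ℝ) < P.m j := by
    have := P.two_le_m (P.one_le_of_mem_L hj.1)
    exact_mod_cast (by omega : 0 < P.m j)
  have h1 := (le_abs_self _).trans (abs_act_le_kNorm (KY P) hK v)
  rw [act_smul_left, act_sum_left, inv_mul_le_iff₀ hm] at h1
  have h2 : ∑ i ∈ Finset.range d, (kNorm (KY P) (res (E i) v) - δ / (d + 1)) ≤
      ∑ i ∈ Finset.range d, act (res (E i) (g i)) v :=
    Finset.sum_le_sum fun i _ => by rw [← act_res]; exact (hlt i).le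
  rw [Finset.sum_sub_distrib, Finset.sum_const, Finset.card_range, nsmul_eq_mul] at h2
  have h3 : (d : ℝ) * (δ / (d + 1)) ≤ δ := by
    rw [mul_div_assoc', div_le_iff₀ (by positivity)]
    nlinarith
  linarith

/-! ### Substitution into the functionals of `K_Y` -/

/-- A family `h_1 < h_2 < …` of successive elements of `K` with `h_s ∈ c₀₀(J_s)`. -/
structure HLinear (P : Params) (h : ℕ+ → c00) : Prop where
  mem : ∀ s, Norming P .any (h s)
  supp : ∀ s, SuppIn (P.J s) (h s)
  before : ∀ s t, s < t → Before (h s) (h t)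

theorem HLinear.zero (P : Params) : HLinear P fun _ => 0 :=
  ⟨fun _ => .zero P, fun _ => suppIn_zero _, fun _ _ _ i hi => by simp at hi⟩

theorem HLinear.neg {P : Params} {h : ℕ+ → c00} (hh : HLinear P h) : HLinear P fun s => -h s :=
  ⟨fun s => .neg _ (hh.mem s), fun s => (hh.supp s).neg, fun s t hst i hi j hj => by
    rw [Finsupp.support_neg] at hi hj
    exact hh.before s t hst i hi j hj⟩

theorem HLinear.restrict {P : Params} {h : ℕ+ → c00} (hh : HLinear P h) {E : Set ℕ+}
    (hE : E.OrdConnected) : HLinear P fun s => res E (h s) :=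
  ⟨fun s => .restrict _ E hE _ (hh.mem s), fun s => (hh.supp s).res E, fun s t hst i hi j hj =>
    hh.before s t hst i (mem_support_res.mp hi).2 j (mem_support_res.mp hj).2⟩

open Classical in
theorem HLinear.ite {P : Params} {h : ℕ+ → c00} (hh : HLinear P h) (E : Set ℕ+) :
    HLinear P fun s => if s ∈ E then h s else 0 := by
  refine ⟨fun s => ?_, fun s => ?_, fun s t hst => ?_⟩
  · split_ifs
    · exact hh.mem s
    · exact .zero P
  · split_ifs
    · exact hh.supp s
    · exact suppIn_zero _
  · split_ifs
    · exact hh.before s t hst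
    all_goals (intro i hi j hj; first | (simp at hi; done) | simp at hj)

-- A restriction of `φ` becomes the switching off of members of the substituted family. This is why
-- families with zero members are allowed.
open Classical in
theorem linearCombination_res {M : Type*} [AddCommGroup M] [Module ℝ M] (v : ℕ+ → M)
    (E : Set ℕ+) (φ : c00) : Finsupp.linearCombination ℝ v (res E φ) =
      Finsupp.linearCombination ℝ (fun s => if s ∈ E then v s else 0) φ := by
  rw [Finsupp.linearCombination_apply, Finsupp.linearCombination_apply,
    Finsupp.sum_of_support_subset (res E φ) (s := φ.support)
      (fun i hi => (mem_support_res.mp hi).2) _ (by simp), Finsupp.sum]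
  refine Finset.sum_congr rfl fun s _ => ?_
  rw [res_apply]
  split_ifs <;> simp

theorem act_linearCombination (h : ℕ+ → c00) (φ x : c00) :
    act (Finsupp.linearCombination ℝ h φ) x =
      Finsupp.linearCombination ℝ (fun s => act (h s) x) φ := by
  rw [Finsupp.linearCombination_apply, Finsupp.linearCombination_apply, Finsupp.sum, Finsupp.sum,
    act_sum_left]
  exact Finset.sum_congr rfl fun s _ => act_smul_left _ _ _

theorem exists_of_mem_support_linearCombination {h : ℕ+ → c00} {φ : c00} {p : ℕ+}
    (hp : p ∈ (Finsupp.linearCombination ℝ h φ).support) :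
    ∃ s ∈ φ.support, p ∈ (h s).support := by
  by_contra! hne
  refine Finsupp.mem_support_iff.mp hp ?_
  rw [Finsupp.linearCombination_apply, Finsupp.sum, Finsupp.finsetSum_apply]
  refine Finset.sum_eq_zero fun s hs => ?_
  rw [Finsupp.smul_apply, Finsupp.notMem_support_iff.mp (hne s hs), smul_zero]

/-- Substituting a family `h_1 < h_2 < …` with `h_s ∈ K ∩ c₀₀(J_s)` for the unit vectors maps
`K_Y` into `K`. -/
theorem HLinear.linearCombination_mem {P : Params} {φ : c00}
    (hφ : MixedTsirelson P.m P.n (P.L 0 ∩ {j | Even j}) φ) :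
    ∀ {h : ℕ+ → c00}, HLinear P h → Norming P .any (Finsupp.linearCombination ℝ h φ) := by
  induction hφ with
  | pos i => intro h hh; simpa [unit] using hh.mem i
  | neg i => intro h hh; simpa [unit] using Norming.neg _ (hh.mem i)
  | avg j hj d hd f hf hb ih =>
    intro h hh
    have hb' := (block_pre_iff.mp hb).2
    rw [map_smul, map_sum]
    -- Since `h_s` lives over `J_s` and the family is successive, a block sequence of `φ`'s turns
    -- into a sequence successive both in supports and in h-supports.
    refine .hreg' hj.1 hj.2 hd (fun i hi => ih i hi hh) ?_ ?_
    · intro i k hik hk a ha b hb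
      obtain ⟨s, hs, hsa⟩ := exists_of_mem_support_linearCombination ha
      obtain ⟨t, ht, htb⟩ := exists_of_mem_support_linearCombination hb
      exact hh.before s t (hb' i k hik hk s hs t ht) a hsa b htb
    · rintro i k hik hk s ⟨a, ha, has⟩ t ⟨b, hb, hbt⟩
      obtain ⟨s', hs', hsa⟩ := exists_of_mem_support_linearCombination ha
      obtain ⟨t', ht', htb⟩ := exists_of_mem_support_linearCombination hb
      rw [P.J_eq has (hh.supp _ a hsa), P.J_eq hbt (hh.supp _ b htb)]
      exact hb' i k hik hk s' hs' t' ht'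
  | restrict E hE f hf ih =>
    intro h hh
    rw [linearCombination_res]
    exact ih (hh.ite E)
  | convex d c f hc hc1 hf ih =>
    intro h hh
    rw [map_sum]
    simp only [map_smul]
    exact .convex d c _ hc hc1 fun i hi => ih i hi hh

/-! ### The action of the norming set on combinations of the projections -/

/-- Only the member at `r` can be non-zero, so successiveness is vacuous. -/
theorem HLinear.single {P : Params} {f : c00} (hf : Norming P .any f) {r : ℕ+}
    (hs : SuppIn (P.J r) f) : HLinear P fun s => res (P.J s) f := by
  have h0 : ∀ s, s ≠ r → res (P.J s) f = 0 := fun s hsr =>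
    res_eq_zero (t := s) fun hmem => hsr (hsupp_subset_of_suppIn hs hmem)
  refine ⟨fun s => hf.res_J s, fun s => suppIn_res _ _, fun s t hst i hi j hj => ?_⟩
  by_cases h : s = r
  · rw [h0 t (by rintro rfl; exact hst.ne h)] at hj
    simp at hj
  · rw [h0 s h] at hi
    simp at hi

theorem linearCombination_sum_smul (c : ℝ) (d : ℕ) (v : ℕ → ℕ+ → ℝ) (φ : c00) :
    Finsupp.linearCombination ℝ (fun s => c * ∑ i ∈ Finset.range d, v i s) φ =
      c * ∑ i ∈ Finset.range d, Finsupp.linearCombination ℝ (v i) φ := by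
  simp only [Finsupp.linearCombination_apply, Finsupp.sum, smul_eq_mul]
  rw [Finset.sum_comm, Finset.mul_sum]
  refine Finset.sum_congr rfl fun s _ => ?_
  rw [← Finset.mul_sum]
  ring

open Classical in
/-- The family obtained by averaging over an h-block sequence. -/
theorem HLinear.avg {P : Params} (M : ℕ) {d : ℕ} {f : ℕ → c00} (hb : HBlock P.J (pre f d))
    {h : ℕ → ℕ+ → c00} (hh : ∀ i, HLinear P (h i)) :
    HLinear P fun s => (M : ℝ)⁻¹ • ∑ i ∈ Finset.range d,
      if s ∈ hsupp P.J (f i) then res (rng (f i)) (h i s) else 0 := by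
  have hb1 := (hblock_pre_iff.mp hb).2
  have hb2 := (block_pre_iff.mp hb.1).2
  have hi : ∀ i, HLinear P fun s =>
      if s ∈ hsupp P.J (f i) then res (rng (f i)) (h i s) else 0 := fun i =>
    ((hh i).restrict (rng_ordConnected (f i))).ite _
  have hex : ∀ s p, p ∈ ((M : ℝ)⁻¹ • ∑ i ∈ Finset.range d,
      if s ∈ hsupp P.J (f i) then res (rng (f i)) (h i s) else 0).support →
      ∃ i < d, s ∈ hsupp P.J (f i) ∧ p ∈ rng (f i) ∧ p ∈ (h i s).support := by
    intro s p hp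
    by_contra! hne
    refine Finsupp.mem_support_iff.mp hp ?_
    rw [Finsupp.smul_apply, Finsupp.finsetSum_apply, Finset.sum_eq_zero, smul_zero]
    intro i hi
    split_ifs with hs
    · by_contra hp'
      have := mem_support_res.mp (Finsupp.mem_support_iff.mpr hp')
      exact hne i (Finset.mem_range.mp hi) hs this.1 this.2
    · rfl
  refine ⟨fun s => ?_, fun s => (SuppIn.sum fun i _ => (hi i).supp s).smul _, ?_⟩
  · refine Norming.inv_smul ?_ M
    -- The h-supports of the `f i` are disjoint, so at each `s` at most one summand survives and the
    -- sum is itself in `K`.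
    have hone : ∀ a ∈ Finset.range d, ∀ b ∈ Finset.range d, a ≠ b →
        (if s ∈ hsupp P.J (f a) then res (rng (f a)) (h a s) else 0) = 0 ∨
          (if s ∈ hsupp P.J (f b) then res (rng (f b)) (h b s) else 0) = 0 := by
      intro a ha b hbd hab
      rw [Finset.mem_range] at ha hbd
      split_ifs with h1 h2
      · exfalso
        rcases lt_or_gt_of_ne hab with h | h
        · exact lt_irrefl _ (hb1 a b h hbd s h1 s h2)
        · exact lt_irrefl _ (hb1 b a h ha s h2 s h1)
      · exact .inr rfl
      · exact .inl rfl
      · exact .inl rfl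
    rcases sum_eq_zero_or (Finset.range d) _ hone with h0 | ⟨i, _, h0⟩
    · rw [h0]; exact .zero P
    · rw [h0]; exact (hi i).mem s
  · intro s t hst p hp q hq
    obtain ⟨i, hid, hsi, hpi, hps⟩ := hex s p hp
    obtain ⟨k, hkd, htk, hqk, hqt⟩ := hex t q hq
    -- Members coming from different terms are separated by the cut to the ranges, members from the
    -- same term by the family `h i`; the third order contradicts `s < t`.
    rcases lt_trichotomy i k with h' | h' | h'
    · exact (hb2 i k h' hkd).rng hpi hqk
    · subst h'
      exact (hh i).before s t hst p hps q hqt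
    · exact absurd (hb1 k i h' hid t htk s hsi) hst.not_gt

theorem act_res_J_eq_zero {P : Params} {f x : c00} {s : ℕ+} (h : s ∉ hsupp P.J f) :
    act f (res (P.J s) x) = 0 := by
  rw [act_res, res_eq_zero h, act_zero_left]

/-- The families obtained for the individual `f i` are glued along the disjoint h-supports; the
factor `M⁻¹` goes into the members, since `K` is closed under it. -/
theorem HBlock.exists_hlinear {P : Params} (M : ℕ) {d : ℕ} {f : ℕ → c00}
    (hb : HBlock P.J (pre f d)) (ih : ∀ i < d, ∀ φ x : c00, ∃ h₁ h₂, HLinear P h₁ ∧ HLinear P h₂ ∧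
      Finsupp.linearCombination ℝ (fun s => act (f i) (res (P.J s) x)) φ ≤
        Finsupp.linearCombination ℝ (fun s => act (h₁ s) x) φ +
          Finsupp.linearCombination ℝ (fun s => act (h₂ s) x) φ) (φ x : c00) :
    ∃ h₁ h₂, HLinear P h₁ ∧ HLinear P h₂ ∧
      Finsupp.linearCombination ℝ
          (fun s => act ((M : ℝ)⁻¹ • ∑ i ∈ Finset.range d, f i) (res (P.J s) x)) φ ≤
        Finsupp.linearCombination ℝ (fun s => act (h₁ s) x) φ +
          Finsupp.linearCombination ℝ (fun s => act (h₂ s) x) φ := by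
  classical
  have ih' : ∀ i, ∃ h₁ h₂, HLinear P h₁ ∧ HLinear P h₂ ∧ (i < d →
      Finsupp.linearCombination ℝ (fun s => act (f i) (res (P.J s) (res (rng (f i)) x)))
          (res (hsupp P.J (f i)) φ) ≤
        Finsupp.linearCombination ℝ (fun s => act (h₁ s) (res (rng (f i)) x))
            (res (hsupp P.J (f i)) φ) +
          Finsupp.linearCombination ℝ (fun s => act (h₂ s) (res (rng (f i)) x))
            (res (hsupp P.J (f i)) φ)) := by
    intro i
    by_cases hi : i < d
    · obtain ⟨h₁, h₂, k₁, k₂, h⟩ := ih i hi (res (hsupp P.J (f i)) φ) (res (rng (f i)) x)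
      exact ⟨h₁, h₂, k₁, k₂, fun _ => h⟩
    · exact ⟨_, _, .zero P, .zero P, fun h => absurd h hi⟩
  choose h₁ h₂ k₁ k₂ hle using ih'
  have hl : ∀ i, (fun s => if s ∈ hsupp P.J (f i) then
      act (f i) (res (P.J s) (res (rng (f i)) x)) else 0) = fun s => act (f i) (res (P.J s) x) := by
    intro i
    funext s
    split_ifs with hs
    · rw [res_comm, act_res_of_suppIn_left fun p hp => mem_rng_of_mem_support hp]
    · rw [act_res_J_eq_zero hs]
  have hr : ∀ h : ℕ → ℕ+ → c00, Finsupp.linearCombination ℝ (fun s => act ((M : ℝ)⁻¹ •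
      ∑ i ∈ Finset.range d, if s ∈ hsupp P.J (f i) then res (rng (f i)) (h i s) else 0) x) φ =
      (M : ℝ)⁻¹ * ∑ i ∈ Finset.range d, Finsupp.linearCombination ℝ
        (fun s => act (h i s) (res (rng (f i)) x)) (res (hsupp P.J (f i)) φ) := by
    intro h
    simp only [linearCombination_res]
    rw [← linearCombination_sum_smul]
    congr 2
    funext s
    rw [act_smul_left, act_sum_left]
    congr 1
    refine Finset.sum_congr rfl fun i _ => ?_
    split_ifs
    · rw [act_res]
    · rw [act_zero_left]
  refine ⟨_, _, .avg M hb k₁, .avg M hb k₂, ?_⟩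
  rw [hr, hr, ← mul_add, ← Finset.sum_add_distrib]
  have : (fun s => act ((M : ℝ)⁻¹ • ∑ i ∈ Finset.range d, f i) (res (P.J s) x)) =
      fun s => (M : ℝ)⁻¹ * ∑ i ∈ Finset.range d, act (f i) (res (P.J s) x) := by
    funext s
    rw [act_smul_left, act_sum_left]
  rw [this, linearCombination_sum_smul]
  refine mul_le_mul_of_nonneg_left (Finset.sum_le_sum fun i hi => ?_) (by positivity)
  have := hle i (Finset.mem_range.mp hi)
  rwa [linearCombination_res (fun s => act (f i) (res (P.J s) (res (rng (f i)) x))), hl] at this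

/-! ### The h-supports of g-special sequences -/

/-- The h-support of the term with index `l` of an `N`-g-special sequence. -/
def hidx (N l : ℕ) : ℕ+ := if l % 2 = 0 then (l / 2).succPNat else (N + l / 2).succPNat

theorem hidx_even (N i : ℕ) : hidx N (2 * i) = i.succPNat := by
  rw [hidx, if_pos (by omega)]
  congr 1
  omega

theorem hidx_odd (N i : ℕ) : hidx N (2 * i + 1) = (N + i).succPNat := by
  rw [hidx, if_neg (by omega)]
  congr 2
  omega

theorem succPNat_ne {a b : ℕ} (h : a ≠ b) : a.succPNat ≠ b.succPNat := fun h' =>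
  h (Nat.succPNat_injective h')

theorem hidx_inj {N k l : ℕ} (hk : k < 2 * N) (hl : l < 2 * N) (h : hidx N k = hidx N l) :
    k = l := by
  unfold hidx at h
  split_ifs at h <;> have := Nat.succPNat_injective h <;> omega

theorem GSpecialCode.hsupp_eq {P : Params} {N : ℕ} {f : ℕ → c00} {k : ℕ → ℕ}
    (hc : GSpecialCode P N f k) {l : ℕ} (hl : l < 2 * N) : hsupp P.J (f l) = {hidx N l} := by
  have h := hc.2.2.1 (l / 2) (by omega)
  rcases Nat.mod_two_eq_zero_or_one l with h2 | h2
  · rw [show 2 * (l / 2) = l by omega] at h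
    rw [h.1, hidx, if_pos h2]
  · rw [show 2 * (l / 2) + 1 = l by omega] at h
    rw [h.2, hidx, if_neg (by omega)]

theorem GSpecialCode.suppIn {P : Params} {N : ℕ} {f : ℕ → c00} {k : ℕ → ℕ}
    (hc : GSpecialCode P N f k) {l : ℕ} (hl : l < 2 * N) : SuppIn (P.J (hidx N l)) (f l) :=
  suppIn_of_hsupp (hc.hsupp_eq hl).subset

theorem GSpecialCode.res_J {P : Params} {N : ℕ} {f : ℕ → c00} {k : ℕ → ℕ}
    (hc : GSpecialCode P N f k) {l : ℕ} (hl : l < 2 * N) (s : ℕ+) :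
    res (P.J s) (f l) = if s = hidx N l then f l else 0 := by
  split_ifs with h
  · rw [h, res_eq_self (hc.suppIn hl)]
  · refine res_eq_zero (t := s) ?_
    rwa [hc.hsupp_eq hl]

theorem GSpecialCode.before {P : Params} {N : ℕ} {f : ℕ → c00} {k : ℕ → ℕ}
    (hc : GSpecialCode P N f k) {i j : ℕ} (hij : i < j) (hj : j < 2 * N) : Before (f i) (f j) :=
  (block_pre_iff.mp hc.2.1).2 i j hij hj

theorem Norming.sign_smul {P : Params} {f : c00} (hf : Norming P .any f) {ε : ℝ}
    (hε : ε = -1 ∨ ε = 0 ∨ ε = 1) : Norming P .any (ε • f) := by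
  rcases hε with rfl | rfl | rfl
  · rw [neg_one_smul]; exact .neg _ hf
  · rw [zero_smul]; exact .zero P
  · rwa [one_smul]

theorem Before.smul {f g : c00} (h : Before f g) (a b : ℝ) : Before (a • f) (b • g) :=
  fun i hi j hj => h i (Finsupp.support_smul hi) j (Finsupp.support_smul hj)

theorem before_zero_left (f : c00) : Before 0 f := fun i hi => by simp at hi

theorem before_zero_right (f : c00) : Before f 0 := fun i _ j hj => by simp at hj

theorem natPred_lt_natPred {s t : ℕ+} (h : s < t) : s.natPred < t.natPred := by
  simpa using h

/-- The supports run `f 0 < f 1 < f 2` while the h-supports run `1, N + 1, 2`, so the whole sequence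
need not be successive in the sense of `HLinear`. The terms of one parity are, which is the source
of the factor 2 in `kNorm_vec_act_le`. -/
theorem GSpecialCode.hlinear_even {P : Params} {N : ℕ} {f : ℕ → c00} {k : ℕ → ℕ}
    (hc : GSpecialCode P N f k) (hf : ∀ i < 2 * N, Norming P .any (f i)) {ε : ℕ → ℝ}
    (hε : ∀ i < N, ε i = -1 ∨ ε i = 0 ∨ ε i = 1) :
    HLinear P fun s => if s.natPred < N then ε s.natPred • f (2 * s.natPred) else 0 := by
  refine ⟨fun s => ?_, fun s => ?_, fun s t hst => ?_⟩
  · split_ifs with h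
    · exact (hf _ (by omega)).sign_smul (hε _ h)
    · exact .zero P
  · split_ifs with h
    · have := hc.suppIn (l := 2 * s.natPred) (by omega)
      rw [hidx_even, PNat.succPNat_natPred] at this
      exact this.smul _
    · exact suppIn_zero _
  · have := natPred_lt_natPred hst
    split_ifs with h1 h2
    · exact (hc.before (by omega) (by omega)).smul _ _
    · exact before_zero_right _
    · exact before_zero_left _
    · exact before_zero_left _

theorem GSpecialCode.hlinear_odd {P : Params} {N : ℕ} {f : ℕ → c00} {k : ℕ → ℕ}
    (hc : GSpecialCode P N f k) (hf : ∀ i < 2 * N, Norming P .any (f i)) {ε : ℕ → ℝ}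
    (hε : ∀ i < N, ε i = -1 ∨ ε i = 0 ∨ ε i = 1) :
    HLinear P fun s => if N ≤ s.natPred ∧ s.natPred - N < N then
      ε (s.natPred - N) • f (2 * (s.natPred - N) + 1) else 0 := by
  refine ⟨fun s => ?_, fun s => ?_, fun s t hst => ?_⟩
  · split_ifs with h
    · exact (hf _ (by omega)).sign_smul (hε _ h.2)
    · exact .zero P
  · split_ifs with h
    · have := hc.suppIn (l := 2 * (s.natPred - N) + 1) (by omega)
      rw [hidx_odd, Nat.add_sub_cancel' h.1, PNat.succPNat_natPred] at this
      exact this.smul _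
    · exact suppIn_zero _
  · have := natPred_lt_natPred hst
    split_ifs with h1 h2
    · exact (hc.before (by omega) (by omega)).smul _ _
    · exact before_zero_right _
    · exact before_zero_left _
    · exact before_zero_left _

theorem GSpecialCode.res_J_sum {P : Params} {N : ℕ} {f : ℕ → c00} {k : ℕ → ℕ}
    (hc : GSpecialCode P N f k) (ε : ℕ → ℝ) (s : ℕ+) :
    res (P.J s) (∑ i ∈ Finset.range N, ε i • (f (2 * i) + f (2 * i + 1))) =
      (if s.natPred < N then ε s.natPred • f (2 * s.natPred) else 0) +
        if N ≤ s.natPred ∧ s.natPred - N < N then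
          ε (s.natPred - N) • f (2 * (s.natPred - N) + 1) else 0 := by
  have h1 : ∀ i ∈ Finset.range N, res (P.J s) (ε i • (f (2 * i) + f (2 * i + 1))) =
      (if i = s.natPred then ε i • f (2 * i) else 0) +
        if N + i = s.natPred then ε i • f (2 * i + 1) else 0 := by
    intro i hi
    rw [Finset.mem_range] at hi
    rw [map_smul, map_add, hc.res_J (by omega), hc.res_J (by omega), hidx_even, hidx_odd, smul_add]
    have e : ∀ a : ℕ, s = a.succPNat ↔ a = s.natPred := fun a =>
      ⟨fun h => by rw [h, Nat.natPred_succPNat], fun h => by rw [h, PNat.succPNat_natPred]⟩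
    simp only [e, smul_ite, smul_zero]
  rw [map_sum, Finset.sum_congr rfl h1, Finset.sum_add_distrib]
  congr 1
  · rw [Finset.sum_ite_eq']
    simp only [Finset.mem_range]
  · split_ifs with h
    · rw [Finset.sum_eq_single (s.natPred - N), if_pos (Nat.add_sub_cancel' h.1)]
      · intro i _ hne
        rw [if_neg (by omega)]
      · intro h'
        exact absurd (Finset.mem_range.mpr h.2) h'
    · refine Finset.sum_eq_zero fun i hi => ?_
      rw [Finset.mem_range] at hi
      rw [if_neg (by omega)]

/-! ### Norming by successive families -/

theorem Norming.exists_hlinear_of_suppIn {P : Params} {f : c00} (hf : Norming P .any f) {r : ℕ+}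
    (hs : SuppIn (P.J r) f) (φ x : c00) : ∃ h₁ h₂, HLinear P h₁ ∧ HLinear P h₂ ∧
      Finsupp.linearCombination ℝ (fun s => act f (res (P.J s) x)) φ ≤
        Finsupp.linearCombination ℝ (fun s => act (h₁ s) x) φ +
          Finsupp.linearCombination ℝ (fun s => act (h₂ s) x) φ := by
  refine ⟨_, _, .single hf hs, .zero P, ?_⟩
  simp only [act_res, act_zero_left]
  refine le_of_eq ?_
  rw [left_eq_add]
  simp [Finsupp.linearCombination_apply]

/-- On combinations of the projections, every functional in the norming set is dominated by the
sum of two families of successive functionals. -/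
theorem Norming.exists_hlinear {P : Params} {t : Tag} {f : c00} (h : Norming P t f) :
    ∀ φ x : c00, ∃ h₁ h₂, HLinear P h₁ ∧ HLinear P h₂ ∧
      Finsupp.linearCombination ℝ (fun s => act f (res (P.J s) x)) φ ≤
        Finsupp.linearCombination ℝ (fun s => act (h₁ s) x) φ +
          Finsupp.linearCombination ℝ (fun s => act (h₂ s) x) φ := by
  induction h with
  | pos i =>
    have : i ∈ ⋃ s, P.J s := by rw [P.J_union]; trivial
    obtain ⟨r, hr⟩ := Set.mem_iUnion.mp this
    exact (Norming.pos i).exists_hlinear_of_suppIn (suppIn_unit hr)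
  | neg f hf ih =>
    intro φ x
    -- The inequality is one-sided, so the sign is moved to `φ`; here the quantification over all
    -- `φ` is needed.
    obtain ⟨h₁, h₂, k₁, k₂, hle⟩ := ih (-φ) x
    refine ⟨_, _, k₁.neg, k₂.neg, ?_⟩
    have e : ∀ v : ℕ+ → ℝ, Finsupp.linearCombination ℝ (fun s => -v s) φ =
        Finsupp.linearCombination ℝ v (-φ) := by
      intro v
      rw [map_neg]
      simp [Finsupp.linearCombination_apply, Finsupp.sum]
    simp only [act_neg_left]
    rwa [e, e, e]
  | reg s j hj hje d hd f hf hs hb ih =>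
    exact (Norming.forget _ _ (.reg s j hj hje d hd f hf hs hb)).exists_hlinear_of_suppIn
      ((SuppIn.sum fun i hi => hs i (Finset.mem_range.mp hi)).smul _)
  | special s q hq hqo d f k hf hc ih =>
    exact (Norming.forget _ _ (.special s q hq hqo d f k hf hc)).exists_hlinear_of_suppIn
      ((SuppIn.sum fun i hi => hc.2.2.2.1 i (Finset.mem_range.mp hi)).smul _)
  | hreg j hj hje d hd f hf hb ih => exact hb.exists_hlinear _ ih
  | hspecial q hq hqo d f k hf hc ih => exact hc.2.2.1.exists_hlinear _ ih
  | gspecial N f k hf hc ε hε ih =>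
    intro φ x
    refine ⟨_, _, hc.hlinear_even (fun i hi => .forget _ _ (hf i hi)) hε,
      hc.hlinear_odd (fun i hi => .forget _ _ (hf i hi)) hε, le_of_eq ?_⟩
    simp only [act_res, hc.res_J_sum, act_add_left]
    simp only [Finsupp.linearCombination_apply, Finsupp.sum, smul_add, Finset.sum_add_distrib]
  | restrict t E hE f hf ih =>
    intro φ x
    obtain ⟨h₁, h₂, k₁, k₂, hle⟩ := ih φ (res E x)
    refine ⟨_, _, k₁.restrict hE, k₂.restrict hE, ?_⟩
    simp only [← act_res]
    simpa only [res_comm E] using hle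
  | convex d c f hc hc1 hf ih =>
    intro φ x
    have e : Finsupp.linearCombination ℝ
        (fun s => act (∑ i ∈ Finset.range d, (c i : ℝ) • f i) (res (P.J s) x)) φ =
        ∑ i ∈ Finset.range d, (c i : ℝ) *
          Finsupp.linearCombination ℝ (fun s => act (f i) (res (P.J s) x)) φ := by
      simp only [act_sum_left, act_smul_left, Finsupp.linearCombination_apply, Finsupp.sum,
        smul_eq_mul, Finset.mul_sum]
      rw [Finset.sum_comm]
      exact Finset.sum_congr rfl fun i _ => Finset.sum_congr rfl fun s _ => by ring
    rw [e]
    set y : ℕ → ℝ := fun i => Finsupp.linearCombination ℝ (fun s => act (f i) (res (P.J s) x)) φ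
    have hc' : ∀ i ∈ Finset.range d, (0 : ℝ) ≤ c i := fun i hi => by
      exact_mod_cast hc i (Finset.mem_range.mp hi)
    -- A subconvex combination of the values is at most the larger of 0 and their maximum. The
    -- families of a maximal term are used, and these depend on `φ` and `x`; zero families serve
    -- when no value is positive.
    by_cases hy : ∀ i ∈ Finset.range d, y i ≤ 0
    · refine ⟨_, _, .zero P, .zero P, ?_⟩
      simp only [act_zero_left]
      have : Finsupp.linearCombination ℝ (fun _ : ℕ+ => (0 : ℝ)) φ = 0 := by
        simp [Finsupp.linearCombination_apply]
      rw [this, add_zero]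
      exact Finset.sum_nonpos fun i hi => mul_nonpos_of_nonneg_of_nonpos (hc' i hi) (hy i hi)
    · push Not at hy
      obtain ⟨i₀, hi₀, hpos⟩ := hy
      obtain ⟨i, hi, hmax⟩ := Finset.exists_max_image (Finset.range d) y ⟨i₀, hi₀⟩
      obtain ⟨h₁, h₂, k₁, k₂, hle⟩ := ih i (Finset.mem_range.mp hi) φ x
      refine ⟨h₁, h₂, k₁, k₂, le_trans ?_ hle⟩
      have hyi : 0 ≤ y i := hpos.le.trans (hmax i₀ hi₀)
      have hc1' : ∑ i ∈ Finset.range d, (c i : ℝ) ≤ 1 := by exact_mod_cast hc1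
      calc ∑ k ∈ Finset.range d, (c k : ℝ) * y k
          ≤ ∑ k ∈ Finset.range d, (c k : ℝ) * y i :=
            Finset.sum_le_sum fun k hk => mul_le_mul_of_nonneg_left (hmax k hk) (hc' k hk)
        _ = (∑ k ∈ Finset.range d, (c k : ℝ)) * y i := (Finset.sum_mul _ _ _).symm
        _ ≤ y i := mul_le_of_le_one_left hyi hc1'
  | forget t f hf ih => exact ih

/-! ### Finite sums of unit vectors -/

/-- The vector `∑_{s < N} a_s e_{s+1}`. -/
noncomputable def vec (N : ℕ) (a : ℕ → ℝ) : c00 :=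
  ∑ s ∈ Finset.range N, a s • unit s.succPNat

theorem vec_apply (N : ℕ) (a : ℕ → ℝ) (p : ℕ+) :
    vec N a p = if p.natPred < N then a p.natPred else 0 := by
  classical
  have e : ∀ s : ℕ, s.succPNat = p ↔ s = p.natPred := fun s =>
    ⟨fun h => by rw [← h, Nat.natPred_succPNat], fun h => by rw [h, PNat.succPNat_natPred]⟩
  rw [vec, Finsupp.finsetSum_apply]
  simp only [Finsupp.smul_apply, unit, Finsupp.single_apply, e, smul_eq_mul, mul_ite, mul_one,
    mul_zero]
  rw [Finset.sum_ite_eq']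
  simp only [Finset.mem_range]

/-- The coefficients `f(I_s x)` define a vector of `Y` of norm at most `2‖x‖`. -/
theorem kNorm_vec_act_le {P : Params} {f : c00} (hf : Norming P .any f) (x : c00) (R : ℕ) :
    kNorm (KY P) (vec R fun s => act f (res (P.J s.succPNat) x)) ≤ 2 * kNorm (KX P) x := by
  have key : ∀ ψ ∈ (KY P).carrier,
      act ψ (vec R fun s => act f (res (P.J s.succPNat) x)) ≤ 2 * kNorm (KX P) x := by
    classical
    intro ψ hψ
    have hE : {s : ℕ+ | s.natPred < R}.OrdConnected :=
      ⟨fun a _ b hb c hc => lt_of_le_of_lt (PNat.natPred_le_natPred.mpr hc.2) hb⟩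
    -- Substituting either family into the truncated `ψ` gives an element of `K`, so each of the two
    -- terms is at most `‖x‖`.
    obtain ⟨h₁, h₂, k₁, k₂, hle⟩ := hf.exists_hlinear (res {s : ℕ+ | s.natPred < R} ψ) x
    have hψ' : MixedTsirelson P.m P.n (P.L 0 ∩ {j | Even j}) (res {s : ℕ+ | s.natPred < R} ψ) :=
      .restrict _ hE _ hψ
    have e : act ψ (vec R fun s => act f (res (P.J s.succPNat) x)) = Finsupp.linearCombination ℝ
        (fun s => act f (res (P.J s) x)) (res {s : ℕ+ | s.natPred < R} ψ) := by
      rw [linearCombination_res, act_comm, act]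
      congr 2
      funext s
      rw [vec_apply]
      rw [PNat.succPNat_natPred]
      by_cases hs : s.natPred < R
      · rw [if_pos hs, if_pos (show s ∈ {s : ℕ+ | s.natPred < R} from hs)]
      · rw [if_neg hs, if_neg (show s ∉ {s : ℕ+ | s.natPred < R} from hs)]
    rw [e]
    refine hle.trans ?_
    rw [← act_linearCombination, ← act_linearCombination]
    have b₁ := (le_abs_self _).trans
      (abs_act_le_kNorm (KX P) (HLinear.linearCombination_mem hψ' k₁) x)
    have b₂ := (le_abs_self _).trans
      (abs_act_le_kNorm (KX P) (HLinear.linearCombination_mem hψ' k₂) x)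
    linarith
  refine kNorm_le _ fun ψ hψ => abs_le'.mpr ⟨key ψ hψ, ?_⟩
  rw [← act_neg_left]
  exact key _ (MixedTsirelson.neg' hψ)

/-! ### g-special pairs: lower estimates -/

/-- The data of an `N`-g-special pair, with the weights and the h-supports made explicit. -/
structure GPair (P : Params) (N : ℕ) (x f : ℕ → c00) (κ : ℕ → ℕ) : Prop where
  code : GSpecialCode P N f κ
  wt : ∀ l < 2 * N, Norming P (.wt (κ l)) (f l)
  exact : ∀ l < 2 * N, ExactPair P (hidx N l) (κ l) (f l) (x l)

theorem GSpecialPair.exists_gPair {P : Params} {N : ℕ} {x f : ℕ → c00}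
    (h : GSpecialPair P N x f) : ∃ κ, GPair P N x f κ := by
  obtain ⟨κ, hc, hw, hx⟩ := h
  refine ⟨κ, hc, hw, fun l hl => ?_⟩
  obtain ⟨r, _, hfr, _, he⟩ := hx l hl
  rw [hc.hsupp_eq hl, Set.singleton_eq_singleton_iff] at hfr
  rwa [hfr]

namespace GPair

variable {P : Params} {N : ℕ} {x f : ℕ → c00} {κ : ℕ → ℕ}

theorem mem (h : GPair P N x f κ) {l : ℕ} (hl : l < 2 * N) : Norming P .any (f l) :=
  .forget _ _ (h.wt l hl)

theorem suppIn (h : GPair P N x f κ) {l : ℕ} (hl : l < 2 * N) : SuppIn (P.J (hidx N l)) (x l) :=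
  (h.exact l hl).1

theorem act_self (h : GPair P N x f κ) {l : ℕ} (hl : l < 2 * N) : act (f l) (x l) = 1 :=
  (h.exact l hl).2.2.2.1

theorem kNorm_le_three (h : GPair P N x f κ) {l : ℕ} (hl : l < 2 * N) :
    kNorm (KX P) (x l) ≤ 3 := (h.exact l hl).2.2.2.2.1

theorem rng_eq (h : GPair P N x f κ) {l : ℕ} (hl : l < 2 * N) : rng (x l) = rng (f l) :=
  (h.exact l hl).2.2.2.2.2.1

theorem act_ne (h : GPair P N x f κ) {k l : ℕ} (hk : k < 2 * N) (hl : l < 2 * N) (hkl : k ≠ l) :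
    act (f k) (x l) = 0 :=
  act_eq_zero_of_suppIn (h.code.suppIn hk) (h.suppIn hl) fun he => hkl (hidx_inj hk hl he)

/-- Tested by the g-special functional built from `f` itself, with signs `sign (c s)`; its odd terms
vanish on these vectors. -/
theorem sum_abs_le (h : GPair P N x f κ) (c : ℕ → ℝ) :
    ∑ s ∈ Finset.range N, |c s| ≤ kNorm (KX P) (∑ s ∈ Finset.range N, c s • x (2 * s)) := by
  have hG := Norming.gspecial N f κ h.wt h.code (fun i => SignType.sign (c i)) (fun i _ => by
    rcases lt_trichotomy (c i) 0 with h | h | h <;> simp [h])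
  refine le_trans (le_of_eq ?_) ((le_abs_self _).trans (abs_act_le_kNorm (KX P) hG _))
  rw [map_sum]
  refine Finset.sum_congr rfl fun s hs => ?_
  rw [Finset.mem_range] at hs
  rw [map_smul, act_sum_left, Finset.sum_eq_single s]
  · rw [act_smul_left, act_add_left, h.act_self (by omega), h.act_ne (by omega) (by omega)
      (by omega), add_zero, mul_one, smul_eq_mul, mul_comm, sign_mul_self]
  · intro i hi his
    rw [Finset.mem_range] at hi
    rw [act_smul_left, act_add_left, h.act_ne (by omega) (by omega) (by omega),
      h.act_ne (by omega) (by omega) (by omega), add_zero, mul_zero]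
  · intro hs'
    exact absurd (Finset.mem_range.mpr hs) hs'

theorem kNorm_sum_le_sum_abs (h : GPair P N x f κ) (c : ℕ → ℝ) :
    kNorm (KX P) (∑ s ∈ Finset.range N, c s • x (2 * s)) ≤
      3 * ∑ s ∈ Finset.range N, |c s| := by
  rw [Finset.mul_sum]
  refine (kNorm_sum_le _ _ _).trans (Finset.sum_le_sum fun s hs => ?_)
  rw [Finset.mem_range] at hs
  refine (kNorm_smul_le _ _ _).trans ?_
  rw [mul_comm]
  exact mul_le_mul_of_nonneg_right (h.kNorm_le_three (by omega)) (abs_nonneg _)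

/-- For `φ ∈ K_Y`, the `f (2 * s)` substituted for the unit vectors give an element of `K` that sees
only the first vector of each pair and returns `φ` of the coefficients. -/
theorem kNorm_vec_le (h : GPair P N x f κ) (a : ℕ → ℝ) : kNorm (KY P) (vec N a) ≤
    kNorm (KX P) (∑ s ∈ Finset.range N, a s • (x (2 * s) - x (2 * s + 1))) := by
  refine kNorm_le _ fun φ hφ => ?_
  have hl := h.code.hlinear_even (fun i hi => h.mem hi) (ε := fun _ => 1)
    (fun _ _ => .inr (.inr rfl))
  refine le_trans (le_of_eq ?_)
    (abs_act_le_kNorm (KX P) (HLinear.linearCombination_mem hφ hl) _)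
  congr 1
  rw [act_linearCombination, act_comm, act]
  congr 2
  funext p
  rw [vec_apply]
  split_ifs with hp
  · rw [one_smul, map_sum, Finset.sum_eq_single p.natPred]
    · rw [map_smul, map_sub, h.act_self (by omega), h.act_ne (by omega) (by omega) (by omega)]
      simp
    · intro s hs hsp
      rw [Finset.mem_range] at hs
      rw [map_smul, map_sub, h.act_ne (by omega) (by omega) (by omega),
        h.act_ne (by omega) (by omega) (by omega)]
      simp
    · intro hp'
      exact absurd (Finset.mem_range.mpr hp) hp'
  · rw [act_zero_left]

end GPair

/-! ### Coding functions on sequences with far supports -/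

theorem exists_support_le (l : List c00) : ∃ B : ℕ, ∀ g ∈ l, ∀ i ∈ g.support, (i : ℕ) ≤ B := by
  induction l with
  | nil => exact ⟨0, by simp⟩
  | cons g l ih =>
    obtain ⟨B, hB⟩ := ih
    refine ⟨max B (g.support.sup fun i => (i : ℕ)), fun g' hg' i hi => ?_⟩
    rcases List.mem_cons.mp hg' with rfl | h
    · exact le_max_of_le_right (Finset.le_sup (f := fun i : ℕ+ => (i : ℕ)) hi)
    · exact le_max_of_le_left (hB g' h i hi)

/-- A coding function with disjoint values takes values beyond `K` on the sequences whose supports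
reach far enough. -/
theorem exists_forall_lt_of_pairwise_disjoint {D : Set (List c00)} {T : List c00 → Set ℕ}
    (hT : D.Pairwise fun l l' => Disjoint (T l) (T l')) (K : ℕ) :
    ∃ M : ℕ, ∀ l ∈ D, (∃ g ∈ l, ∃ i ∈ g.support, M < (i : ℕ)) → ∀ k ∈ T l, K < k := by
  classical
  -- By disjointness `k` is assigned to at most one sequence, whose supports are bounded; the bounds
  -- for `k ≤ K` yield `M`.
  have hex : ∀ k, ∃ B : ℕ, ∀ l ∈ D, k ∈ T l → ∀ g ∈ l, ∀ i ∈ g.support, (i : ℕ) ≤ B := by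
    intro k
    by_cases h : ∃ l ∈ D, k ∈ T l
    · obtain ⟨l, hl, hk⟩ := h
      obtain ⟨B, hB⟩ := exists_support_le l
      refine ⟨B, fun l' hl' hk' => ?_⟩
      by_cases he : l' = l
      · exact he ▸ hB
      · exact absurd hk (Set.disjoint_left.mp (hT hl' hl he) hk')
    · exact ⟨0, fun l hl hk => absurd ⟨l, hl, hk⟩ h⟩
  choose B hB using hex
  refine ⟨(Finset.range (K + 1)).sup B, ?_⟩
  rintro l hl ⟨g, hg, i, hi, hlt⟩ k hk
  by_contra! hle
  have h1 := hB k l hl hk g hg i hi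
  have h2 : B k ≤ (Finset.range (K + 1)).sup B :=
    Finset.le_sup (Finset.mem_range.mpr (Nat.lt_succ_of_le hle))
  omega

/-- Both coding functions `σ`, `τ` take only values greater than `K` on sequences whose supports
reach beyond `M`. -/
structure FarCoding (P : Params) (K M : ℕ) : Prop where
  tau : ∀ l ∈ tauDom P.J, (∃ g ∈ l, ∃ i ∈ g.support, M < (i : ℕ)) → ∀ k ∈ P.tau l, K < k
  hsigma : ∀ l ∈ hsigmaDom P.J, (∃ g ∈ l, ∃ i ∈ g.support, M < (i : ℕ)) →
    ∀ k ∈ P.hsigma l, K < k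

theorem exists_farCoding (P : Params) (K : ℕ) : ∃ M, FarCoding P K M := by
  obtain ⟨M₁, h₁⟩ := exists_forall_lt_of_pairwise_disjoint P.tau_disj K
  obtain ⟨M₂, h₂⟩ := exists_forall_lt_of_pairwise_disjoint P.hsigma_disj K
  refine ⟨max M₁ M₂, fun l hl => ?_, fun l hl => ?_⟩
  · rintro ⟨g, hg, i, hi, h⟩
    exact h₁ l hl ⟨g, hg, i, hi, (le_max_left _ _).trans_lt h⟩
  · rintro ⟨g, hg, i, hi, h⟩
    exact h₂ l hl ⟨g, hg, i, hi, (le_max_right _ _).trans_lt h⟩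

theorem pre_ne_nil {f : ℕ → c00} {d : ℕ} (hd : 1 ≤ d) : pre f d ≠ [] := by
  intro h
  have := congrArg List.length h
  simp [pre] at this
  omega

theorem mem_pre {f : ℕ → c00} {d i : ℕ} (hi : i < d) : f i ∈ pre f d := by
  rw [pre, List.mem_map]
  exact ⟨i, List.mem_range.mpr hi, rfl⟩

theorem GSpecialCode.pre_mem_tauDom {P : Params} {N : ℕ} {f : ℕ → c00} {κ : ℕ → ℕ}
    (hc : GSpecialCode P N f κ) (hf : ∀ i < 2 * N, Norming P (.wt (κ i)) (f i)) {l : ℕ}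
    (h1 : 1 ≤ l) (hl : l < 2 * N) : pre f l ∈ tauDom P.J :=
  ⟨pre_ne_nil h1, hc.2.1.pre_mono hl.le, forall_mem_pre.mpr fun i hi =>
    ⟨(hf i (hi.trans hl)).isRational, _, hc.hsupp_eq (hi.trans hl)⟩⟩

theorem GSpecialCode.mem_tau {P : Params} {N : ℕ} {f : ℕ → c00} {κ : ℕ → ℕ}
    (hc : GSpecialCode P N f κ) {l : ℕ} (h1 : 1 ≤ l) (hl : l < 2 * N) :
    κ l ∈ P.tau (pre f l) := by
  have := hc.2.2.2.2 (l - 1) (by omega)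
  rwa [Nat.sub_add_cancel h1] at this

theorem GSpecialCode.lt_weight {P : Params} {N K M : ℕ} {f : ℕ → c00} {κ : ℕ → ℕ}
    (hfar : FarCoding P K M) (hc : GSpecialCode P N f κ)
    (hf : ∀ i < 2 * N, Norming P (.wt (κ i)) (f i)) {k l : ℕ} (hkl : k < l) (hl : l < 2 * N)
    (hk : ∃ i ∈ (f k).support, M < (i : ℕ)) : K < κ l :=
  hfar.tau _ (hc.pre_mem_tauDom hf (by omega) hl) ⟨f k, mem_pre hkl, hk⟩ _
    (hc.mem_tau (by omega) hl)

/-- The weight index of a term remembers the whole preceding sequence, because `τ` has disjoint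
values at distinct sequences. -/
theorem GSpecialCode.weight_ne {P : Params} {N N' : ℕ} {f f' : ℕ → c00} {κ κ' : ℕ → ℕ}
    (hc : GSpecialCode P N f κ) (hf : ∀ i < 2 * N, Norming P (.wt (κ i)) (f i))
    (hc' : GSpecialCode P N' f' κ') (hf' : ∀ i < 2 * N', Norming P (.wt (κ' i)) (f' i))
    {k l : ℕ} (hk1 : 1 ≤ k) (hk : k < 2 * N') (hl1 : 1 ≤ l) (hl : l < 2 * N)
    (hne : pre f' k ≠ pre f l) : κ' k ≠ κ l := by
  intro he
  have hd := P.tau_disj (hc'.pre_mem_tauDom hf' hk1 hk) (hc.pre_mem_tauDom hf hl1 hl) hne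
  exact Set.disjoint_left.mp hd (hc'.mem_tau hk1 hk) (he ▸ hc.mem_tau hl1 hl)

theorem inv_m_le {P : Params} {N k : ℕ} (hN : 1 ≤ N) (hk : 10 * N < k) :
    (P.m k : ℝ)⁻¹ ≤ (10 * N : ℝ)⁻¹ := by
  have h1 : 10 * N ≤ P.m k := hk.le.trans (P.le_m (by omega))
  refine inv_anti₀ (by positivity) ?_
  exact_mod_cast h1

/-! ### Far g-special pairs -/

/-- A g-special pair beyond `M`, where `M` is so large that the weights chosen by the coding
functions are small compared with `N⁻¹`. -/
structure FarGPair (P : Params) (N M : ℕ) (x f : ℕ → c00) (κ : ℕ → ℕ) : Prop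
    extends GPair P N x f κ where
  far : FarCoding P (10 * N) M
  lt_supp : ∀ i ∈ (x 0).support, M < (i : ℕ)

namespace FarGPair

variable {P : Params} {N M : ℕ} {x f : ℕ → c00} {κ : ℕ → ℕ}

theorem one_le (h : FarGPair P N M x f κ) : 1 ≤ N := h.code.1

theorem ne_zero (h : FarGPair P N M x f κ) {l : ℕ} (hl : l < 2 * N) : x l ≠ 0 := by
  intro h0
  have := h.act_self hl
  rw [h0, map_zero] at this
  exact zero_ne_one this

theorem before (h : FarGPair P N M x f κ) {k l : ℕ} (hkl : k < l) (hl : l < 2 * N) :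
    Before (x k) (x l) := fun i hi j hj => by
  have h1 := mem_rng_of_mem_support hi
  have h2 := mem_rng_of_mem_support hj
  rw [h.rng_eq (hkl.trans hl)] at h1
  rw [h.rng_eq hl] at h2
  exact (h.code.before hkl hl).rng h1 h2

theorem lt_of_mem_support (h : FarGPair P N M x f κ) {l : ℕ} (hl : l < 2 * N) {i : ℕ+}
    (hi : i ∈ (x l).support) : M < (i : ℕ) := by
  rcases Nat.eq_zero_or_pos l with rfl | h0
  · exact h.lt_supp i hi
  · obtain ⟨j, hj⟩ := Finsupp.support_nonempty_iff.mpr (h.ne_zero (h0.trans hl))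
    exact (h.lt_supp j hj).trans (PNat.coe_lt_coe _ _ |>.mpr (h.before h0 hl j hj i hi))

theorem exists_lt_mem_support (h : FarGPair P N M x f κ) {l : ℕ} (hl : l < 2 * N) {g : c00}
    {E : Set ℕ+} (hg : act g (res E (x l)) ≠ 0) : ∃ i ∈ g.support, M < (i : ℕ) := by
  obtain ⟨i, hi, hix⟩ := exists_mem_support_of_act_ne_zero hg
  exact ⟨i, hi, h.lt_of_mem_support hl (mem_support_res.mp hix).2⟩

theorem exists_lt_mem_support_zero (h : FarGPair P N M x f κ) :
    ∃ i ∈ (f 0).support, M < (i : ℕ) := by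
  have h0 : 0 < 2 * N := by have := h.one_le; omega
  refine h.exists_lt_mem_support (E := Set.univ) h0 ?_
  rw [res_eq_self (E := Set.univ) (f := x 0) fun _ _ => trivial, h.act_self h0]
  exact one_ne_zero

theorem lt_weight (h : FarGPair P N M x f κ) {l : ℕ} (h1 : 1 ≤ l) (hl : l < 2 * N) :
    10 * N < κ l :=
  h.code.lt_weight h.far h.wt h1 hl h.exists_lt_mem_support_zero

theorem abs_act_le_three (h : FarGPair P N M x f κ) {l : ℕ} (hl : l < 2 * N) {g : c00}
    (hg : Norming P .any g) {E : Set ℕ+} (hE : E.OrdConnected) : |act g (res E (x l))| ≤ 3 :=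
  (abs_act_le_kNorm (KX P) hg _).trans ((kNorm_res_le hE _).trans (h.kNorm_le_three hl))

/-- Exactness gives `5 * max`, and indices beyond `10 * N` give weights at most `1 / (10 N)`. The
bound `1 / (2 N)` is chosen because there are `2 * N` vectors. The vector `x 0` is excluded: its
weight is not produced by `τ`. -/
theorem abs_act_le_of_ne (h : FarGPair P N M x f κ) {l k : ℕ} (h1 : 1 ≤ l) (hl : l < 2 * N)
    {g : c00} (hg : Norming P (.wt k) g) (hs : SuppIn (P.J (hidx N l)) g) {E : Set ℕ+}
    (hE : E.OrdConnected) (hk : 10 * N < k) (hne : k ≠ κ l) :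
    |act g (res E (x l))| ≤ (2 * N : ℝ)⁻¹ := by
  have hκ := h.lt_weight h1 hl
  have hN := h.one_le
  rw [act_res]
  refine ((h.exact l hl).2.2.2.2.2.2 k (res E g) (hs.res E) (.restrict _ E hE _ hg)
    (Params.m_ne (by omega) (by omega) hne)).trans ?_
  have h3 : max (P.m (κ l) : ℝ)⁻¹ (P.m k : ℝ)⁻¹ ≤ (10 * N : ℝ)⁻¹ :=
    max_le (inv_m_le hN hκ) (inv_m_le hN hk)
  calc 5 * max (P.m (κ l) : ℝ)⁻¹ (P.m k : ℝ)⁻¹ ≤ 5 * (10 * N : ℝ)⁻¹ := by gcongr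
    _ = (2 * N : ℝ)⁻¹ := by
      have : (N : ℝ) ≠ 0 := by positivity
      field_simp
      norm_num

/-! ### g-special functionals on g-special pairs -/

/-- The terms of a g-special sequence have distinct singleton h-supports, so at most one of them
meets the `J`-class of `x l`. -/
theorem act_gspecial (h : FarGPair P N M x f κ) {N' : ℕ} {f' : ℕ → c00} {κ' : ℕ → ℕ}
    (hc' : GSpecialCode P N' f' κ') (ε : ℕ → ℝ) (E : Set ℕ+) {l : ℕ} (hl : l < 2 * N) :
    act (∑ i ∈ Finset.range N', ε i • (f' (2 * i) + f' (2 * i + 1))) (res E (x l)) = 0 ∨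
      ∃ k < 2 * N', hidx N' k = hidx N l ∧
        act (∑ i ∈ Finset.range N', ε i • (f' (2 * i) + f' (2 * i + 1))) (res E (x l)) =
          ε (k / 2) * act (f' k) (res E (x l)) ∧ act (f' k) (res E (x l)) ≠ 0 := by
  rw [sum_pairs, act_sum_left]
  simp only [act_smul_left]
  have hidx_eq : ∀ k < 2 * N', act (f' k) (res E (x l)) ≠ 0 → hidx N' k = hidx N l := by
    intro k hk hne
    by_contra hk'
    exact hne (act_eq_zero_of_suppIn (hc'.suppIn hk) ((h.suppIn hl).res E) hk')
  by_cases h0 : ∀ k < 2 * N', act (f' k) (res E (x l)) = 0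
  · left
    exact Finset.sum_eq_zero fun k hk => by rw [h0 k (Finset.mem_range.mp hk), mul_zero]
  · push Not at h0
    obtain ⟨k, hk, hne⟩ := h0
    refine .inr ⟨k, hk, hidx_eq k hk hne, ?_, hne⟩
    refine Finset.sum_eq_single k (fun b hb hbk => ?_) fun hk' =>
      absurd (Finset.mem_range.mpr hk) hk'
    rw [Finset.mem_range] at hb
    by_cases hb0 : act (f' b) (res E (x l)) = 0
    · rw [hb0, mul_zero]
    · exact absurd (hidx_inj hb hk ((hidx_eq b hb hb0).trans (hidx_eq k hk hne).symm)) hbk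

theorem abs_mul_le_of_sign {e t C : ℝ} (he : e = -1 ∨ e = 0 ∨ e = 1) (ht : |t| ≤ C) :
    |e * t| ≤ C := by
  have hC := (abs_nonneg t).trans ht
  rcases he with rfl | rfl | rfl
  · rwa [neg_one_mul, abs_neg]
  · rwa [zero_mul, abs_zero]
  · rwa [one_mul]

/-- A g-special functional that starts differently is small on all but two terms. -/
theorem gspecial_of_ne (h : FarGPair P N M x f κ) {N' : ℕ} {f' : ℕ → c00} {κ' : ℕ → ℕ}
    (hf' : ∀ i < 2 * N', Norming P (.wt (κ' i)) (f' i)) (hc' : GSpecialCode P N' f' κ')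
    {ε : ℕ → ℝ} (hε : ∀ i < N', ε i = -1 ∨ ε i = 0 ∨ ε i = 1) {E : Set ℕ+}
    (hE : E.OrdConnected) (hne : N' = N → f' 0 ≠ f 0) :
    ∃ u v : ℕ, ∀ l < 2 * N, l ≠ u → l ≠ v →
      |act (∑ i ∈ Finset.range N', ε i • (f' (2 * i) + f' (2 * i + 1))) (res E (x l))| ≤
        (2 * N : ℝ)⁻¹ := by
  classical
  have hδ : (0 : ℝ) ≤ (2 * N : ℝ)⁻¹ := by positivity
  -- Equal prefixes would force `f' 0 = f 0`, hence `N' ≠ N`. For even `k ≥ 2` the second terms then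
  -- disagree in h-support, `N' + 1` against `N + 1`; for odd `k` the h-supports of the terms at `k`
  -- and `l` already disagree.
  have hpre : ∀ k l, 1 ≤ l → k < 2 * N' → l < 2 * N → hidx N' k = hidx N l →
      pre f' k ≠ pre f l := by
    intro k l h1 hk hl hkl he
    obtain ⟨rfl, hff⟩ := pre_inj he
    have hNN : N' ≠ N := fun hN => hne hN (hff 0 h1)
    rcases Nat.even_or_odd' k with ⟨c, rfl | rfl⟩
    · have e1 := hc'.hsupp_eq (l := 1) (by omega)
      rw [hff 1 (by omega), h.code.hsupp_eq (l := 1) (by omega),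
        Set.singleton_eq_singleton_iff] at e1
      have := hidx_odd N 0
      have := hidx_odd N' 0
      simp_all
    · rw [hidx_odd, hidx_odd] at hkl
      have := Nat.succPNat_injective hkl
      omega
  by_cases hex : ∃ k, k < 2 * N' ∧ ∃ i ∈ (f' k).support, M < (i : ℕ)
  -- Terms of `f'` before the first one reaching beyond `M` vanish on the pair; later ones have
  -- small weights, since their prefix reaches beyond `M`. The exceptions are the vector over the
  -- `J`-class of that first term, and `x 0`.
  · obtain ⟨hk₁, hi₁⟩ := Nat.find_spec hex
    have hmin : ∀ k, k < 2 * N' → (∃ i ∈ (f' k).support, M < (i : ℕ)) → Nat.find hex ≤ k :=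
      fun k hk hi => Nat.find_min' hex ⟨hk, hi⟩
    set k₁ := Nat.find hex
    have hu : ∃ u, ∀ l < 2 * N, hidx N' k₁ = hidx N l → l = u := by
      by_cases hex₁ : ∃ l < 2 * N, hidx N' k₁ = hidx N l
      · obtain ⟨u, hu, he⟩ := hex₁
        exact ⟨u, fun l hl hle => hidx_inj hl hu (hle.symm.trans he)⟩
      · exact ⟨0, fun l hl hle => absurd ⟨l, hl, hle⟩ hex₁⟩
    obtain ⟨u, hu⟩ := hu
    refine ⟨u, 0, fun l hl hlu hl0 => ?_⟩
    rcases h.act_gspecial hc' ε E hl with h0 | ⟨k, hk, hkl, he, hn⟩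
    · rw [h0, abs_zero]; exact hδ
    · rw [he]
      refine abs_mul_le_of_sign (hε _ (by omega)) ?_
      have hk₁k : k₁ < k := by
        refine lt_of_le_of_ne (hmin k hk (h.exists_lt_mem_support hl hn)) ?_
        intro hkk
        exact hlu (hu l hl (hkk ▸ hkl))
      exact h.abs_act_le_of_ne (by omega) hl (hf' k hk) (hkl ▸ hc'.suppIn hk) hE
        (hc'.lt_weight h.far hf' hk₁k hk hi₁) (h.code.weight_ne h.wt hc' hf' (by omega) hk
          (by omega) hl (hpre k l (by omega) hk hl hkl))
  · refine ⟨0, 0, fun l hl _ _ => ?_⟩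
    rcases h.act_gspecial hc' ε E hl with h0 | ⟨k, hk, _, _, hn⟩
    · rw [h0, abs_zero]; exact hδ
    · exact absurd ⟨k, hk, h.exists_lt_mem_support hl hn⟩ hex

/-- The values of a g-special functional on the terms of a g-special pair. -/
theorem gspecial_of_eq (h : FarGPair P N M x f κ) {f' : ℕ → c00} {κ' : ℕ → ℕ}
    (hf' : ∀ i < 2 * N, Norming P (.wt (κ' i)) (f' i)) (hc' : GSpecialCode P N f' κ')
    {ε : ℕ → ℝ} (hε : ∀ i < N, ε i = -1 ∨ ε i = 0 ∨ ε i = 1) {E : Set ℕ+}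
    (hE : E.OrdConnected) (heq : f' 0 = f 0) {p q : ℕ} (hq : q ≤ 2 * N) {c : ℕ → ℝ}
    (hc : ∀ l, c l = if p ≤ l ∧ l < q then
      act (∑ i ∈ Finset.range N, ε i • (f' (2 * i) + f' (2 * i + 1))) (res E (x l)) else 0) :
    ∃ u v : ℕ, (∀ l < u, c l = 0) ∧ (∀ l, u < l → l < v → c l = ε (l / 2)) ∧
      ∀ l < 2 * N, v < l → |c l| ≤ (2 * N : ℝ)⁻¹ := by
  classical
  have hδ : (0 : ℝ) ≤ (2 * N : ℝ)⁻¹ := by positivity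
  let Z : Finset ℕ := (Finset.Ico p q).filter fun l => res E (x l) ≠ 0
  have hcZ : ∀ l, l ∉ Z → c l = 0 := by
    intro l hl
    rw [hc]
    split_ifs with hpq
    · have : res E (x l) = 0 := by
        by_contra h0
        exact hl (Finset.mem_filter.mpr ⟨Finset.mem_Ico.mpr hpq, h0⟩)
      rw [this, map_zero]
    · rfl
  by_cases hZ : Z.Nonempty
  swap
  · rw [Finset.not_nonempty_iff_eq_empty] at hZ
    have h0 : ∀ l, c l = 0 := fun l => hcZ l (by simp [hZ])
    exact ⟨0, 0, by simp, by simp, fun l _ _ => by rw [h0, abs_zero]; exact hδ⟩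
  -- The place where the two sequences branch. If they agree everywhere, `2 * N` serves; a first
  -- disagreement may also lie beyond the relevant indices.
  have hi₀ : ∃ i₀, 1 ≤ i₀ ∧ (∀ i < i₀, f' i = f i) ∧ (i₀ < 2 * N → f' i₀ ≠ f i₀) := by
    by_cases hex : ∃ i, f' i ≠ f i
    · refine ⟨Nat.find hex, ?_, fun i hi => not_not.mp (Nat.find_min hex hi),
        fun _ => Nat.find_spec hex⟩
      rw [Nat.one_le_iff_ne_zero]
      intro h0
      have := Nat.find_spec hex
      rw [h0] at this
      exact this heq
    · push Not at hex
      exact ⟨2 * N, by have := h.one_le; omega, fun i _ => hex i, fun h => absurd h (lt_irrefl _)⟩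
  obtain ⟨i₀, h1, hlt, hge⟩ := hi₀
  obtain ⟨hu1, hu2⟩ := Finset.mem_filter.mp (Z.min'_mem hZ)
  obtain ⟨hw1, hw2⟩ := Finset.mem_filter.mp (Z.max'_mem hZ)
  set u := Z.min' hZ
  set w := Z.max' hZ
  rw [Finset.mem_Ico] at hu1 hw1
  have hval : ∀ l < 2 * N, act (∑ i ∈ Finset.range N, ε i • (f' (2 * i) + f' (2 * i + 1)))
      (res E (x l)) = ε (l / 2) * act (f' l) (res E (x l)) := by
    intro l hl
    rw [sum_pairs, act_sum_left, Finset.sum_eq_single l]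
    · rw [act_smul_left]
    · intro k hk hkl
      rw [Finset.mem_range] at hk
      rw [act_smul_left, act_eq_zero_of_suppIn (hc'.suppIn hk) ((h.suppIn hl).res E)
        (fun he => hkl (hidx_inj hk hl he)), mul_zero]
    · intro hl'
      exact absurd (Finset.mem_range.mpr hl) hl'
  -- Strictly between the first and the last vector met by `E`, the interval `E` contains the whole
  -- support, so before the branching the value is exactly the sign. Beyond `i₀` the prefixes differ
  -- and hence so do the weights.
  refine ⟨u, min w i₀, fun l hl => hcZ l fun hlZ => (Z.min'_le l hlZ).not_gt hl,
    fun l hul hl => ?_, fun l hl hvl => ?_⟩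
  · obtain ⟨hlw, hli⟩ := lt_min_iff.mp hl
    rw [hc, if_pos (by omega), hval l (by omega), hlt l hli, res_eq_self, h.act_self (by omega),
      mul_one]
    obtain ⟨a, ha⟩ := Finsupp.support_nonempty_iff.mpr hu2
    obtain ⟨b, hb⟩ := Finsupp.support_nonempty_iff.mpr hw2
    rw [mem_support_res] at ha hb
    exact fun i hi => hE.out ha.1 hb.1 ⟨(h.before hul (by omega) a ha.2 i hi).le,
      (h.before hlw (by omega) i hi b hb.2).le⟩
  · by_cases hlZ : l ∈ Z
    swap
    · rw [hcZ l hlZ, abs_zero]; exact hδ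
    have hil : i₀ < l := by
      have := Z.le_max' l hlZ
      rcases min_lt_iff.mp hvl with h' | h'
      · exact absurd h' this.not_gt
      · exact h'
    rw [hc]
    split_ifs
    · rw [hval l hl]
      refine abs_mul_le_of_sign (hε _ (by omega)) ?_
      refine h.abs_act_le_of_ne (by omega) hl (hf' l hl) (hc'.suppIn hl) hE ?_
        (h.code.weight_ne h.wt hc' hf' (by omega) hl (by omega) hl fun he => ?_)
      · refine hc'.lt_weight h.far hf' (k := 0) (by omega) hl ?_
        rw [heq]
        exact h.exists_lt_mem_support_zero
      · exact hge (hil.trans hl) ((pre_inj he).2 i₀ hil)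
    · rw [abs_zero]; exact hδ

/-! ### Differences of the values on the two vectors of a pair -/

/-- A pair containing exactly one exceptional index costs at most `3 + 1 = 4`; a pair containing
both costs at most `6`, within the allowance `8`. -/
theorem sum_abs_sub_le {N : ℕ} {δ : ℝ} {c : ℕ → ℝ} (h3 : ∀ l < 2 * N, |c l| ≤ 3) {u v : ℕ}
    (h1 : ∀ l < 2 * N, l ≠ u → l ≠ v → |c l| ≤ 1)
    (h0 : ∀ s < N, s ≠ u / 2 → s ≠ v / 2 → |c (2 * s) - c (2 * s + 1)| ≤ 2 * δ) (hδ : 0 ≤ δ) :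
    ∑ s ∈ Finset.range N, |c (2 * s) - c (2 * s + 1)| ≤ N * (2 * δ) + 8 := by
  have hle : ∀ s ∈ Finset.range N, |c (2 * s) - c (2 * s + 1)| ≤
      2 * δ + ((if s = u / 2 then 4 else 0) + if s = v / 2 then 4 else 0) := by
    intro s hs
    rw [Finset.mem_range] at hs
    have e3 := h3 (2 * s) (by omega)
    have o3 := h3 (2 * s + 1) (by omega)
    have htri := abs_sub (c (2 * s)) (c (2 * s + 1))
    by_cases hu : s = u / 2 <;> by_cases hv : s = v / 2
    · rw [if_pos hu, if_pos hv]; linarith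
    · rw [if_pos hu, if_neg hv]
      rcases Nat.mod_two_eq_zero_or_one u with h | h
      · have := h1 (2 * s + 1) (by omega) (by omega) (by omega); linarith
      · have := h1 (2 * s) (by omega) (by omega) (by omega); linarith
    · rw [if_neg hu, if_pos hv]
      rcases Nat.mod_two_eq_zero_or_one v with h | h
      · have := h1 (2 * s + 1) (by omega) (by omega) (by omega); linarith
      · have := h1 (2 * s) (by omega) (by omega) (by omega); linarith
    · rw [if_neg hu, if_neg hv]
      have := h0 s hs hu hv
      linarith
  refine (Finset.sum_le_sum hle).trans ?_
  rw [Finset.sum_add_distrib, Finset.sum_add_distrib, Finset.sum_const, Finset.card_range,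
    nsmul_eq_mul, Finset.sum_ite_eq', Finset.sum_ite_eq']
  split_ifs <;> linarith

/-- With `δ = 1 / (2 N)` the regular pairs contribute at most `2 δ N = 1` and the exceptional ones
at most 8. Before the branching both vectors of a pair receive the same sign, so the difference
vanishes. -/
theorem sum_abs_gspecial_le (h : FarGPair P N M x f κ) {N' : ℕ} {f' : ℕ → c00} {κ' : ℕ → ℕ}
    (hf' : ∀ i < 2 * N', Norming P (.wt (κ' i)) (f' i)) (hc' : GSpecialCode P N' f' κ')
    {ε : ℕ → ℝ} (hε : ∀ i < N', ε i = -1 ∨ ε i = 0 ∨ ε i = 1) {E : Set ℕ+}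
    (hE : E.OrdConnected) {p q : ℕ} (hq : q ≤ 2 * N) {c : ℕ → ℝ}
    (hc : ∀ l, c l = if p ≤ l ∧ l < q then
      act (∑ i ∈ Finset.range N', ε i • (f' (2 * i) + f' (2 * i + 1))) (res E (x l)) else 0) :
    ∑ s ∈ Finset.range N, |c (2 * s) - c (2 * s + 1)| ≤ 9 := by
  have hN : (1 : ℝ) ≤ N := by exact_mod_cast h.one_le
  have hδ : (0 : ℝ) ≤ (2 * N : ℝ)⁻¹ := by positivity
  have hδ1 : (2 * N : ℝ)⁻¹ ≤ 1 := inv_le_one_of_one_le₀ (by linarith)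
  have hsum : (N : ℝ) * (2 * (2 * N : ℝ)⁻¹) + 8 = 9 := by
    have : (N : ℝ) ≠ 0 := by positivity
    field_simp
    norm_num
  have h3 : ∀ l < 2 * N, |c l| ≤ 3 := by
    intro l hl
    rw [hc]
    split_ifs
    · exact h.abs_act_le_three hl (.gspecial N' f' κ' hf' hc' ε hε) hE
    · rw [abs_zero]; norm_num
  rw [← hsum]
  by_cases hcase : N' = N ∧ f' 0 = f 0
  · obtain ⟨rfl, heq⟩ := hcase
    obtain ⟨u, v, hu, huv, hv⟩ := h.gspecial_of_eq hf' hc' hε hE heq hq hc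
    have hε1 : ∀ i < N', |ε i| ≤ 1 := fun i hi => by
      rcases hε i hi with h | h | h <;> rw [h] <;> simp
    refine sum_abs_sub_le h3 (u := u) (v := v) (fun l hl hlu hlv => ?_) (fun s hs hsu hsv => ?_) hδ
    · rcases lt_or_gt_of_ne hlu with h' | h'
      · rw [hu l h', abs_zero]; exact zero_le_one
      · rcases lt_or_gt_of_ne hlv with h'' | h''
        · rw [huv l h' h'']; exact hε1 _ (by omega)
        · exact (hv l hl h'').trans hδ1
    · by_cases h1 : 2 * s < u
      · rw [hu _ h1, hu (2 * s + 1) (by omega), sub_zero, abs_zero]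
        positivity
      · by_cases h2 : v < 2 * s
        · have e1 := hv _ (by omega) h2
          have e2 := hv (2 * s + 1) (by omega) (by omega)
          exact (abs_sub _ _).trans (by linarith)
        · rw [huv (2 * s) (by omega) (by omega), huv (2 * s + 1) (by omega) (by omega),
            show (2 * s + 1) / 2 = 2 * s / 2 by omega, sub_self, abs_zero]
          positivity
  · obtain ⟨u, v, huv⟩ := h.gspecial_of_ne hf' hc' hε hE fun hN heq => hcase ⟨hN, heq⟩
    have huv' : ∀ l < 2 * N, l ≠ u → l ≠ v → |c l| ≤ (2 * N : ℝ)⁻¹ := by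
      intro l hl h1 h2
      rw [hc]
      split_ifs
      · exact huv l hl h1 h2
      · rw [abs_zero]; exact hδ
    refine sum_abs_sub_le h3 (fun l hl h1 h2 => (huv' l hl h1 h2).trans hδ1)
      (fun s hs h1 h2 => ?_) hδ
    have e1 := huv' (2 * s) (by omega) (by omega) (by omega)
    have e2 := huv' (2 * s + 1) (by omega) (by omega) (by omega)
    exact (abs_sub _ _).trans (by linarith)

end FarGPair

/-! ### Upper estimates -/

/-- The positions `t` whose even (`e = 0`) or odd (`e = 1`) index `2 (t - 1) + e` is in
`[p, q)`. -/
def positions (e p q : ℕ) : Set ℕ+ := {t | p ≤ 2 * t.natPred + e ∧ 2 * t.natPred + e < q}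

theorem positions_ordConnected (e p q : ℕ) : (positions e p q).OrdConnected := by
  refine ⟨fun s hs t ht u hu => ?_⟩
  have h1 := PNat.natPred_le_natPred.mpr hu.1
  have h2 := PNat.natPred_le_natPred.mpr hu.2
  have h3 := hs.1
  have h4 := ht.2
  exact ⟨by omega, by omega⟩

theorem kNorm_KY_res_le {P : Params} {E : Set ℕ+} (hE : E.OrdConnected) (v : c00) :
    kNorm (KY P) (res E v) ≤ kNorm (KY P) v :=
  kNorm_le _ fun φ hφ => by
    rw [act_res]
    exact abs_act_le_kNorm (KY P) (MixedTsirelson.restrict E hE φ hφ) v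

/-- The bound, in terms of `Y`, for the part of the alternating sum with indices in `[p, q)`. -/
noncomputable def altBound (P : Params) (N : ℕ) (a : ℕ → ℝ) (p q : ℕ) : ℝ :=
  kNorm (KY P) (res (positions 0 p q) (vec N a)) + kNorm (KY P) (res (positions 1 p q) (vec N a))

theorem altBound_nonneg (P : Params) (N : ℕ) (a : ℕ → ℝ) (p q : ℕ) : 0 ≤ altBound P N a p q :=
  add_nonneg (kNorm_nonneg _ _) (kNorm_nonneg _ _)

theorem altBound_le (P : Params) (N : ℕ) (a : ℕ → ℝ) (p q : ℕ) :
    altBound P N a p q ≤ 2 * kNorm (KY P) (vec N a) := by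
  rw [two_mul]
  exact add_le_add (kNorm_KY_res_le (positions_ordConnected _ _ _) _)
    (kNorm_KY_res_le (positions_ordConnected _ _ _) _)

theorem abs_le_kNorm_positions (P : Params) {N : ℕ} (a : ℕ → ℝ) {e p q s : ℕ} (hs : s < N)
    (hp : p ≤ 2 * s + e) (hq : 2 * s + e < q) :
    |a s| ≤ kNorm (KY P) (res (positions e p q) (vec N a)) := by
  classical
  have hmem : s.succPNat ∈ positions e p q := by
    rw [positions, Set.mem_ofPred_eq, Nat.natPred_succPNat]
    exact ⟨hp, hq⟩
  have h := abs_act_le_kNorm (KY P) ((KY P).unit_mem s.succPNat)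
    (res (positions e p q) (vec N a))
  rwa [act_unit, res_apply, if_pos hmem, vec_apply, Nat.natPred_succPNat, if_pos hs] at h

theorem abs_le_altBound (P : Params) {N : ℕ} (a : ℕ → ℝ) {p q l : ℕ} (hq : q ≤ 2 * N)
    (hpl : p ≤ l) (hlq : l < q) : |a (l / 2)| ≤ altBound P N a p q := by
  rcases Nat.mod_two_eq_zero_or_one l with h | h
  · exact (abs_le_kNorm_positions P a (e := 0) (s := l / 2) (by omega) (by omega)
      (by omega)).trans (le_add_of_nonneg_right (kNorm_nonneg _ _))
  · exact (abs_le_kNorm_positions P a (e := 1) (s := l / 2) (by omega) (by omega)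
      (by omega)).trans (le_add_of_nonneg_left (kNorm_nonneg _ _))

/-- Successive index intervals may cut a pair, and then both contain its position. For a fixed
parity the position sets are successive, so `sum_kNorm_res_le` applies; this is why `altBound` is a
sum over two parities. -/
theorem sum_altBound_le {P : Params} {j : ℕ} (hj : j ∈ P.L 0 ∩ {j | Even j}) {d : ℕ}
    (hd : d ≤ P.n j) (N : ℕ) (a : ℕ → ℝ) {p q : ℕ} {p' q' : ℕ → ℕ}
    (hsub : ∀ i < d, ∀ l, p' i ≤ l → l < q' i → p ≤ l ∧ l < q)
    (hlt : ∀ i k, i < k → k < d → ∀ l, p' i ≤ l → l < q' i → ∀ l', p' k ≤ l' → l' < q' k →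
      l < l') :
    ∑ i ∈ Finset.range d, altBound P N a (p' i) (q' i) ≤ P.m j * altBound P N a p q := by
  have key : ∀ e, ∑ i ∈ Finset.range d,
      kNorm (KY P) (res (positions e (p' i) (q' i)) (vec N a)) ≤
        P.m j * kNorm (KY P) (res (positions e p q) (vec N a)) := by
    intro e
    refine le_trans (le_of_eq ?_) (sum_kNorm_res_le hj hd
      (E := fun i => positions e (p' i) (q' i)) (fun i _ => positions_ordConnected _ _ _)
      (fun i k hik hk s hs t ht => ?_) _)
    · refine Finset.sum_congr rfl fun i hi => ?_
      rw [res_res, Set.inter_eq_left.mpr]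
      exact fun t ht => hsub i (Finset.mem_range.mp hi) _ ht.1 ht.2
    · have := hlt i k hik hk _ hs.1 hs.2 _ ht.1 ht.2
      exact PNat.natPred_lt_natPred.mp (by omega)
  simp only [altBound]
  rw [Finset.sum_add_distrib, mul_add]
  exact add_le_add (key 0) (key 1)

/-- The alternating sum of the vectors `x_l`, `p ≤ l < q`. -/
noncomputable def altSum (a : ℕ → ℝ) (x : ℕ → c00) (p q : ℕ) : c00 :=
  ∑ l ∈ Finset.Ico p q, ((-1) ^ l * a (l / 2)) • x l

theorem act_res_altSum (a : ℕ → ℝ) (x : ℕ → c00) (p q : ℕ) (g : c00) (E : Set ℕ+) :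
    act g (res E (altSum a x p q)) =
      ∑ l ∈ Finset.Ico p q, (-1) ^ l * a (l / 2) * act g (res E (x l)) := by
  rw [altSum, map_sum, map_sum]
  refine Finset.sum_congr rfl fun l _ => ?_
  rw [map_smul, map_smul, smul_eq_mul]

theorem sum_range_two_mul {M : Type*} [AddCommMonoid M] (N : ℕ) (g : ℕ → M) :
    ∑ l ∈ Finset.range (2 * N), g l = ∑ s ∈ Finset.range N, (g (2 * s) + g (2 * s + 1)) := by
  induction N with
  | zero => simp
  | succ N ih =>
    rw [Finset.sum_range_succ, ← ih, show 2 * (N + 1) = 2 * N + 1 + 1 by ring,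
      Finset.sum_range_succ, Finset.sum_range_succ, add_assoc]

theorem altSum_zero (a : ℕ → ℝ) (x : ℕ → c00) (N : ℕ) : altSum a x 0 (2 * N) =
    ∑ s ∈ Finset.range N, a s • (x (2 * s) - x (2 * s + 1)) := by
  rw [altSum, Nat.Ico_zero_eq_range, sum_range_two_mul]
  refine Finset.sum_congr rfl fun s _ => ?_
  rw [show (2 * s + 1) / 2 = s by omega, show 2 * s / 2 = s by omega, pow_succ, pow_mul]
  simp [sub_eq_add_neg]

/-- The smallest interval of indices containing those in `[p, q)` where `c` does not vanish. -/
theorem exists_Ico_ne_zero (c : ℕ → ℝ) (p q : ℕ) : ∃ p' q', q' ≤ q ∧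
    (∀ l, p' ≤ l → l < q' → ∃ l₁ l₂, p ≤ l₁ ∧ l₁ ≤ l ∧ l ≤ l₂ ∧ l₂ < q ∧ c l₁ ≠ 0 ∧ c l₂ ≠ 0) ∧
    ∀ l, p ≤ l → l < q → c l ≠ 0 → p' ≤ l ∧ l < q' := by
  classical
  let Z : Finset ℕ := (Finset.Ico p q).filter fun l => c l ≠ 0
  have hmem : ∀ l, l ∈ Z ↔ (p ≤ l ∧ l < q) ∧ c l ≠ 0 := fun l => by
    rw [Finset.mem_filter, Finset.mem_Ico]
  by_cases hZ : Z.Nonempty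
  · have h1 := (hmem _).mp (Z.min'_mem hZ)
    have h2 := (hmem _).mp (Z.max'_mem hZ)
    refine ⟨Z.min' hZ, Z.max' hZ + 1, h2.1.2, fun l hl hl' => ?_, fun l hp hq hl => ?_⟩
    · exact ⟨_, _, h1.1.1, hl, Nat.lt_succ_iff.mp hl', h2.1.2, h1.2, h2.2⟩
    · have hlZ := (hmem l).mpr ⟨⟨hp, hq⟩, hl⟩
      exact ⟨Z.min'_le l hlZ, Nat.lt_succ_of_le (Z.le_max' l hlZ)⟩
  · refine ⟨0, 0, Nat.zero_le _, fun l _ hl => absurd hl (Nat.not_lt_zero l),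
      fun l hp hq hl => absurd ⟨l, (hmem l).mpr ⟨⟨hp, hq⟩, hl⟩⟩ hZ⟩

/-! ### Induction over the norming set of `X` for alternating sums -/

namespace FarGPair

variable {P : Params} {N M : ℕ} {x f : ℕ → c00} {κ : ℕ → ℕ}

theorem abs_act_altSum_le_of_suppIn (h : FarGPair P N M x f κ) (a : ℕ → ℝ) {g : c00}
    (hg : Norming P .any g) {r : ℕ+} (hs : SuppIn (P.J r) g) {E : Set ℕ+} (hE : E.OrdConnected)
    {p q : ℕ} (hq : q ≤ 2 * N) :
    |act g (res E (altSum a x p q))| ≤ 9 * altBound P N a p q := by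
  have hB := altBound_nonneg P N a p q
  rw [act_res_altSum]
  have hzero : ∀ l ∈ Finset.Ico p q, ∀ l' ∈ Finset.Ico p q, l ≠ l' →
      (-1) ^ l * a (l / 2) * act g (res E (x l)) = 0 ∨
        (-1) ^ l' * a (l' / 2) * act g (res E (x l')) = 0 := by
    intro l hl l' hl' hne
    rw [Finset.mem_Ico] at hl hl'
    by_contra! hne'
    have hr : ∀ l < 2 * N, act g (res E (x l)) ≠ 0 → r = hidx N l := fun l hl hn => by
      by_contra hr
      exact hn (act_eq_zero_of_suppIn hs ((h.suppIn hl).res E) hr)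
    have e1 := hr l (by omega) (right_ne_zero_of_mul hne'.1)
    have e2 := hr l' (by omega) (right_ne_zero_of_mul hne'.2)
    exact hne (hidx_inj (by omega) (by omega) (e1.symm.trans e2))
  rcases sum_eq_zero_or (Finset.Ico p q) _ hzero with h0 | ⟨l, hl, h0⟩
  · rw [h0, abs_zero]
    positivity
  · rw [Finset.mem_Ico] at hl
    rw [h0, abs_mul, abs_mul, abs_pow, abs_neg, abs_one, one_pow, one_mul]
    have h1 := abs_le_altBound P a hq hl.1 hl.2
    have h3 := h.abs_act_le_three (hl.2.trans_le hq) hg hE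
    calc |a (l / 2)| * |act g (res E (x l))| ≤ altBound P N a p q * 3 := by gcongr
      _ ≤ 9 * altBound P N a p q := by linarith

/-- Two terms of an h-block sequence cannot meet the same `J`-class, which excludes `l = l'`; the
order of the supports excludes `l' < l`. -/
theorem lt_of_hblock (h : FarGPair P N M x f κ) {g : ℕ → c00} {d : ℕ} (hb : HBlock P.J (pre g d))
    {i k : ℕ} (hik : i < k) (hk : k < d) {E : Set ℕ+} {l l' : ℕ} (hl : l < 2 * N)
    (hl' : l' < 2 * N) (hne : act (g i) (res E (x l)) ≠ 0)
    (hne' : act (g k) (res E (x l')) ≠ 0) : l < l' := by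
  rcases lt_trichotomy l l' with hlt | rfl | hlt
  · exact hlt
  · rcases hb.act_eq_zero_or ((h.suppIn hl).res E) (hik.trans hk) hk hik.ne with h0 | h0
    · exact absurd h0 hne
    · exact absurd h0 hne'
  · obtain ⟨u, hu, hux⟩ := exists_mem_support_of_act_ne_zero hne
    obtain ⟨v, hv, hvx⟩ := exists_mem_support_of_act_ne_zero hne'
    have h1 := (block_pre_iff.mp hb.1).2 i k hik hk u hu v hv
    have h2 := h.before hlt hl v (mem_support_res.mp hvx).2 u (mem_support_res.mp hux).2
    exact absurd h1 h2.not_gt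

/-- Each `g i` sees only the indices in the smallest interval carrying its non-zero values. These
intervals are successive, and summing their bounds costs exactly the `m_j` that the average gains.
-/
theorem abs_act_altSum_le_of_hreg (h : FarGPair P N M x f κ) (a : ℕ → ℝ) {j : ℕ}
    (hj : j ∈ P.L 0) (hje : Even j) {d : ℕ} (hd : d ≤ P.n j) {g : ℕ → c00}
    (hb : HBlock P.J (pre g d)) {E : Set ℕ+}
    (ih : ∀ i < d, ∀ p q, q ≤ 2 * N →
      |act (g i) (res E (altSum a x p q))| ≤ 9 * altBound P N a p q)
    {p q : ℕ} (hq : q ≤ 2 * N) :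
    |act ((P.m j : ℝ)⁻¹ • ∑ i ∈ Finset.range d, g i) (res E (altSum a x p q))| ≤
      9 * altBound P N a p q := by
  have hex := fun i => exists_Ico_ne_zero (fun l => act (g i) (res E (x l))) p q
  choose p' q' hq' hne hmem using hex
  have hsub : ∀ i l, p' i ≤ l → l < q' i → p ≤ l ∧ l < q := fun i l h1 h2 => by
    obtain ⟨l₁, l₂, a1, a2, a3, a4, -⟩ := hne i l h1 h2
    exact ⟨a1.trans a2, a3.trans_lt a4⟩
  have hact : ∀ i, act (g i) (res E (altSum a x p q)) =
      act (g i) (res E (altSum a x (p' i) (q' i))) := by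
    intro i
    rw [act_res_altSum, act_res_altSum]
    symm
    refine Finset.sum_subset (fun l hl => ?_) fun l hl hl' => ?_
    · rw [Finset.mem_Ico] at hl ⊢
      exact hsub i l hl.1 hl.2
    · rw [Finset.mem_Ico] at hl hl'
      have : act (g i) (res E (x l)) = 0 := by
        by_contra hn
        exact hl' (hmem i l hl.1 hl.2 hn)
      rw [this, mul_zero]
  have hm : (0 : ℝ) < P.m j := by
    have := P.two_le_m (P.one_le_of_mem_L hj)
    exact_mod_cast (by omega : 0 < P.m j)
  have hsum := sum_altBound_le ⟨hj, hje⟩ hd N a (p := p) (q := q) (p' := p') (q' := q')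
    (fun i _ => hsub i) (fun i k hik hk l hl1 hl2 l' hl'1 hl'2 => by
      obtain ⟨_, l₂, _, _, a3, a4, _, a6⟩ := hne i l hl1 hl2
      obtain ⟨l₁, _, b1, b2, b3, b4, b5, _⟩ := hne k l' hl'1 hl'2
      have := h.lt_of_hblock hb hik hk (by omega) (by omega) a6 b5
      omega)
  rw [act_smul_left, act_sum_left, abs_mul, abs_of_pos (inv_pos.mpr hm), inv_mul_le_iff₀ hm]
  calc |∑ i ∈ Finset.range d, act (g i) (res E (altSum a x p q))|
      ≤ ∑ i ∈ Finset.range d, |act (g i) (res E (altSum a x p q))| :=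
        Finset.abs_sum_le_sum_abs _ _
    _ ≤ ∑ i ∈ Finset.range d, 9 * altBound P N a (p' i) (q' i) :=
        Finset.sum_le_sum fun i hi => by
          rw [hact]
          exact ih i (Finset.mem_range.mp hi) _ _ ((hq' i).trans hq)
    _ = 9 * ∑ i ∈ Finset.range d, altBound P N a (p' i) (q' i) := (Finset.mul_sum _ _ _).symm
    _ ≤ 9 * (P.m j * altBound P N a p q) := by gcongr
    _ = P.m j * (9 * altBound P N a p q) := by ring

/-- After exchanging the sums, each `x l` is seen by at most one `g i`, and there are at most `2 *
N` vectors. -/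
theorem abs_sum_act_altSum_le (h : FarGPair P N M x f κ) (a : ℕ → ℝ) {d : ℕ} {g : ℕ → c00}
    (hb : HBlock P.J (pre g d)) {E : Set ℕ+} {s : Finset ℕ} (hs : ∀ i ∈ s, i < d) {p q : ℕ}
    (hq : q ≤ 2 * N)
    (hle : ∀ i ∈ s, ∀ l < 2 * N, |act (g i) (res E (x l))| ≤ (2 * N : ℝ)⁻¹) :
    |∑ i ∈ s, act (g i) (res E (altSum a x p q))| ≤ altBound P N a p q := by
  have hB := altBound_nonneg P N a p q
  have hN : (0 : ℝ) < 2 * N := by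
    have := h.one_le
    positivity
  simp only [act_res_altSum]
  rw [Finset.sum_comm]
  simp only [← Finset.mul_sum]
  have hterm : ∀ l ∈ Finset.Ico p q,
      |(-1) ^ l * a (l / 2) * ∑ i ∈ s, act (g i) (res E (x l))| ≤
        altBound P N a p q * (2 * N : ℝ)⁻¹ := by
    intro l hl
    rw [Finset.mem_Ico] at hl
    rw [abs_mul, abs_mul, abs_pow, abs_neg, abs_one, one_pow, one_mul]
    exact mul_le_mul (abs_le_altBound P a hq hl.1 hl.2)
      (hb.abs_sum_act_le ((h.suppIn (by omega)).res E) hs (by positivity)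
        fun i hi => hle i hi l (by omega)) (abs_nonneg _) hB
  refine (Finset.abs_sum_le_sum_abs _ _).trans ((Finset.sum_le_sum hterm).trans ?_)
  rw [Finset.sum_const, Nat.card_Ico, nsmul_eq_mul]
  have hc : ((q - p : ℕ) : ℝ) ≤ 2 * N := by exact_mod_cast (Nat.sub_le q p).trans hq
  calc ((q - p : ℕ) : ℝ) * (altBound P N a p q * (2 * N : ℝ)⁻¹)
      ≤ 2 * N * (altBound P N a p q * (2 * N : ℝ)⁻¹) := by gcongr
    _ = altBound P N a p q := by rw [mul_left_comm, mul_inv_cancel₀ hN.ne', mul_one]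

/-- Odd averages are not available in `K_Y`. The first term meeting the vectors is left to
induction; it reaches beyond `M`, so all later h-weights have index beyond `10 * N` and these terms
together contribute at most one `altBound`. -/
theorem abs_act_altSum_le_of_hspecial (h : FarGPair P N M x f κ) (a : ℕ → ℝ) {w : ℕ}
    (hw : w ∈ P.L 0) {d : ℕ} {g : ℕ → c00} {k : ℕ → ℕ}
    (hg : ∀ i < d, Norming P (.hwt (k i)) (g i)) (hc : HSpecialCode P w d g k) {E : Set ℕ+}
    (hE : E.OrdConnected) {p q : ℕ} (hq : q ≤ 2 * N)
    (ih : ∀ i < d, |act (g i) (res E (altSum a x p q))| ≤ 9 * altBound P N a p q) :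
    |act ((P.m w : ℝ)⁻¹ • ∑ i ∈ Finset.range d, g i) (res E (altSum a x p q))| ≤
      9 * altBound P N a p q := by
  classical
  have hB := altBound_nonneg P N a p q
  have hb := hc.2.2.1
  have hm : (2 : ℝ) ≤ P.m w := by exact_mod_cast P.two_le_m (P.one_le_of_mem_L hw)
  rw [act_smul_left, act_sum_left, abs_mul, abs_of_pos (by positivity),
    inv_mul_le_iff₀ (by positivity)]
  -- `9 + 1 = 10`, and division by `m_w ≥ 2` brings this below 9.
  suffices hle : |∑ i ∈ Finset.range d, act (g i) (res E (altSum a x p q))| ≤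
      10 * altBound P N a p q by nlinarith
  by_cases hex : ∃ i, i < d ∧ ∃ l, p ≤ l ∧ l < q ∧ act (g i) (res E (x l)) ≠ 0
  swap
  · rw [Finset.sum_eq_zero, abs_zero]
    · positivity
    · intro i hi
      rw [act_res_altSum]
      refine Finset.sum_eq_zero fun l hl => ?_
      rw [Finset.mem_Ico] at hl
      have : act (g i) (res E (x l)) = 0 := by
        by_contra hn
        exact hex ⟨i, Finset.mem_range.mp hi, l, hl.1, hl.2, hn⟩
      rw [this, mul_zero]
  obtain ⟨hi₁, l₁, hpl, hlq, hne⟩ := Nat.find_spec hex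
  have hmin : ∀ i < Nat.find hex, i < d → act (g i) (res E (altSum a x p q)) = 0 := by
    intro i hi hid
    rw [act_res_altSum]
    refine Finset.sum_eq_zero fun l hl => ?_
    rw [Finset.mem_Ico] at hl
    have : act (g i) (res E (x l)) = 0 := by
      by_contra hn
      exact Nat.find_min hex hi ⟨hid, l, hl.1, hl.2, hn⟩
    rw [this, mul_zero]
  set i₁ := Nat.find hex
  have hfar := h.exists_lt_mem_support (by omega) hne
  have hsplit : ∑ i ∈ Finset.range d, act (g i) (res E (altSum a x p q)) =
      act (g i₁) (res E (altSum a x p q)) +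
        ∑ i ∈ Finset.Ico (i₁ + 1) d, act (g i) (res E (altSum a x p q)) := by
    rw [← Finset.sum_range_add_sum_Ico _ hi₁.le, Finset.sum_eq_zero fun i hi => ?_, zero_add,
      Finset.sum_eq_sum_Ico_succ_bot hi₁]
    rw [Finset.mem_range] at hi
    exact hmin i hi (hi.trans hi₁)
  have htail := h.abs_sum_act_altSum_le a hb (E := E) (s := Finset.Ico (i₁ + 1) d) (p := p)
    (fun i hi => (Finset.mem_Ico.mp hi).2) hq fun i hi l hl => by
      rw [Finset.mem_Ico] at hi
      have hk : 10 * N < k i := by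
        have hki := hc.2.2.2.2 (i - 1) (by omega)
        rw [Nat.sub_add_cancel (by omega)] at hki
        refine h.far.hsigma _ ⟨pre_ne_nil (by omega), hb.pre_mono hi.2.le,
          forall_mem_pre.mpr fun i' hi' => (hg i' (hi'.trans hi.2)).isRational⟩
          ⟨g i₁, mem_pre (by omega), hfar⟩ _ hki
      refine ((hg i hi.2).abs_act_le_of_hwt _ rfl _ _ ((h.suppIn hl).res E)).trans ?_
      have h3 := (kNorm_res_le hE _).trans (h.kNorm_le_three hl)
      have hN : (0 : ℝ) < N := by exact_mod_cast h.one_le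
      calc (P.m (k i) : ℝ)⁻¹ * kNorm (KX P) (res E (x l)) ≤ (10 * N : ℝ)⁻¹ * 3 :=
            mul_le_mul (inv_m_le h.one_le hk) h3 (kNorm_nonneg _ _) (by positivity)
        _ ≤ (10 * N : ℝ)⁻¹ * 5 := by gcongr; norm_num
        _ = (2 * N : ℝ)⁻¹ := by field_simp; norm_num
  rw [hsplit]
  have := abs_add_le (act (g i₁) (res E (altSum a x p q)))
    (∑ i ∈ Finset.Ico (i₁ + 1) d, act (g i) (res E (altSum a x p q)))
  have := ih i₁ hi₁
  linarith

/-- Grouped by pairs, the value is `∑ a s * (c (2 * s) - c (2 * s + 1))`; each relevant `|a s|` is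
bounded by `altBound` and the differences sum to at most 9. -/
theorem abs_act_altSum_le_of_gspecial (h : FarGPair P N M x f κ) (a : ℕ → ℝ) {N' : ℕ}
    {f' : ℕ → c00} {κ' : ℕ → ℕ} (hf' : ∀ i < 2 * N', Norming P (.wt (κ' i)) (f' i))
    (hc' : GSpecialCode P N' f' κ') {ε : ℕ → ℝ}
    (hε : ∀ i < N', ε i = -1 ∨ ε i = 0 ∨ ε i = 1) {E : Set ℕ+} (hE : E.OrdConnected) {p q : ℕ}
    (hq : q ≤ 2 * N) :
    |act (∑ i ∈ Finset.range N', ε i • (f' (2 * i) + f' (2 * i + 1)))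
      (res E (altSum a x p q))| ≤ 9 * altBound P N a p q := by
  set G := ∑ i ∈ Finset.range N', ε i • (f' (2 * i) + f' (2 * i + 1)) with hG
  let c : ℕ → ℝ := fun l => if p ≤ l ∧ l < q then act G (res E (x l)) else 0
  have hc : ∑ s ∈ Finset.range N, |c (2 * s) - c (2 * s + 1)| ≤ 9 :=
    h.sum_abs_gspecial_le hf' hc' hε hE hq (fun _ => rfl)
  have hB := altBound_nonneg P N a p q
  have hval : act G (res E (altSum a x p q)) =
      ∑ s ∈ Finset.range N, a s * (c (2 * s) - c (2 * s + 1)) := by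
    rw [act_res_altSum]
    calc ∑ l ∈ Finset.Ico p q, (-1) ^ l * a (l / 2) * act G (res E (x l))
        = ∑ l ∈ Finset.range (2 * N), (-1) ^ l * a (l / 2) * c l := by
          refine Finset.sum_subset_zero_on_sdiff (fun l hl => ?_) (fun l hl => ?_)
            fun l hl => ?_
          · rw [Finset.mem_Ico] at hl
            rw [Finset.mem_range]
            omega
          · rw [Finset.mem_sdiff, Finset.mem_Ico] at hl
            simp only [c, if_neg hl.2, mul_zero]
          · simp only [c, if_pos (Finset.mem_Ico.mp hl)]
      _ = ∑ s ∈ Finset.range N, a s * (c (2 * s) - c (2 * s + 1)) := by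
          rw [sum_range_two_mul]
          refine Finset.sum_congr rfl fun s _ => ?_
          rw [show (2 * s + 1) / 2 = s by omega, show 2 * s / 2 = s by omega, pow_succ, pow_mul]
          norm_num
          ring
  rw [hval]
  calc |∑ s ∈ Finset.range N, a s * (c (2 * s) - c (2 * s + 1))|
      ≤ ∑ s ∈ Finset.range N, |a s * (c (2 * s) - c (2 * s + 1))| :=
        Finset.abs_sum_le_sum_abs _ _
    _ ≤ ∑ s ∈ Finset.range N, altBound P N a p q * |c (2 * s) - c (2 * s + 1)| := by
        refine Finset.sum_le_sum fun s _ => ?_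
        rw [abs_mul]
        by_cases h1 : p ≤ 2 * s ∧ 2 * s < q
        · have := abs_le_altBound P a hq h1.1 h1.2
          rw [show 2 * s / 2 = s by omega] at this
          gcongr
        · by_cases h2 : p ≤ 2 * s + 1 ∧ 2 * s + 1 < q
          · have := abs_le_altBound P a hq h2.1 h2.2
            rw [show (2 * s + 1) / 2 = s by omega] at this
            gcongr
          · simp only [c, if_neg h1, if_neg h2, sub_zero, abs_zero, mul_zero, le_refl]
    _ = altBound P N a p q * ∑ s ∈ Finset.range N, |c (2 * s) - c (2 * s + 1)| :=
        (Finset.mul_sum _ _ _).symm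
    _ ≤ altBound P N a p q * 9 := by gcongr
    _ = 9 * altBound P N a p q := mul_comm _ _

/-- The interval `E` is carried along for the restriction rule, the index interval for even
h-averages. -/
theorem abs_act_altSum_le (h : FarGPair P N M x f κ) (a : ℕ → ℝ) {t : Tag} {g : c00}
    (hg : Norming P t g) : ∀ E : Set ℕ+, E.OrdConnected → ∀ p q, q ≤ 2 * N →
      |act g (res E (altSum a x p q))| ≤ 9 * altBound P N a p q := by
  induction hg with
  | pos i =>
    intro E hE p q hq
    obtain ⟨s, hs⟩ := Set.mem_iUnion.mp ((P.J_union ▸ trivial : i ∈ ⋃ s, P.J s))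
    exact h.abs_act_altSum_le_of_suppIn a (.pos i) (suppIn_unit hs) hE hq
  | neg g hg ih =>
    intro E hE p q hq
    rw [act_neg_left, abs_neg]
    exact ih E hE p q hq
  | reg s j hj hje d hd g hg hs hb ih =>
    intro E hE p q hq
    exact h.abs_act_altSum_le_of_suppIn a (.forget _ _ (.reg s j hj hje d hd g hg hs hb))
      ((SuppIn.sum fun i hi => hs i (Finset.mem_range.mp hi)).smul _) hE hq
  | special s w hw hwo d g k hg hc ih =>
    intro E hE p q hq
    exact h.abs_act_altSum_le_of_suppIn a (.forget _ _ (.special s w hw hwo d g k hg hc))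
      ((SuppIn.sum fun i hi => hc.2.2.2.1 i (Finset.mem_range.mp hi)).smul _) hE hq
  | hreg j hj hje d hd g hg hb ih =>
    intro E hE p q hq
    exact h.abs_act_altSum_le_of_hreg a hj hje hd hb (fun i hi p q hq => ih i hi E hE p q hq) hq
  | hspecial w hw hwo d g k hg hc ih =>
    intro E hE p q hq
    exact h.abs_act_altSum_le_of_hspecial a hw hg hc hE hq fun i hi => ih i hi E hE p q hq
  | gspecial N' f' κ' hf' hc' ε hε ih =>
    intro E hE p q hq
    exact h.abs_act_altSum_le_of_gspecial a hf' hc' hε hE hq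
  | restrict t E' hE' g hg ih =>
    intro E hE p q hq
    rw [← act_res, res_res]
    exact ih _ (hE'.inter hE) p q hq
  | convex d c g hc hc1 hg ih =>
    intro E hE p q hq
    have hc' : ∀ i < d, (0 : ℝ) ≤ c i := fun i hi => by exact_mod_cast hc i hi
    have hc1' : ∑ i ∈ Finset.range d, (c i : ℝ) ≤ 1 := by exact_mod_cast hc1
    rw [act_sum_left]
    calc |∑ i ∈ Finset.range d, act ((c i : ℝ) • g i) (res E (altSum a x p q))|
        ≤ ∑ i ∈ Finset.range d, |act ((c i : ℝ) • g i) (res E (altSum a x p q))| :=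
          Finset.abs_sum_le_sum_abs _ _
      _ ≤ ∑ i ∈ Finset.range d, c i * (9 * altBound P N a p q) := by
          refine Finset.sum_le_sum fun i hi => ?_
          rw [Finset.mem_range] at hi
          rw [act_smul_left, abs_mul, abs_of_nonneg (hc' i hi)]
          exact mul_le_mul_of_nonneg_left (ih i hi E hE p q hq) (hc' i hi)
      _ = (∑ i ∈ Finset.range d, (c i : ℝ)) * (9 * altBound P N a p q) :=
          (Finset.sum_mul _ _ _).symm
      _ ≤ 9 * altBound P N a p q :=
          mul_le_of_le_one_left (mul_nonneg (by norm_num) (altBound_nonneg _ _ _ _ _)) hc1'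
  | forget t g hg ih => exact ih

theorem kNorm_sum_le (h : FarGPair P N M x f κ) (a : ℕ → ℝ) :
    kNorm (KX P) (∑ s ∈ Finset.range N, a s • (x (2 * s) - x (2 * s + 1))) ≤
      18 * kNorm (KY P) (vec N a) := by
  rw [← altSum_zero]
  refine kNorm_le _ fun g hg => ?_
  have h1 := h.abs_act_altSum_le a hg Set.univ Set.ordConnected_univ 0 (2 * N) le_rfl
  rw [res_eq_self (E := Set.univ) (f := altSum a x 0 (2 * N)) fun _ _ => trivial] at h1
  have := altBound_le P N a 0 (2 * N)
  linarith

end FarGPair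

/-! ### Domination of finite sequences -/

theorem dominates_fin {E F : Type*} [NormedAddCommGroup E] [NormedSpace ℝ E]
    [NormedAddCommGroup F] [NormedSpace ℝ F] {N : ℕ} {C : ℝ} (hC : 0 ≤ C) {u : ℕ → E} {v : ℕ → F}
    (h : ∀ a : ℕ → ℝ, ‖∑ s ∈ Finset.range N, a s • v s‖ ≤
      C * ‖∑ s ∈ Finset.range N, a s • u s‖) :
    Dominates C (fun s : Fin N => u s) (fun s : Fin N => v s) := by
  refine dominates_of_norm_sum_le hC fun a => ?_
  have hu := h fun s => if hs : s < N then a ⟨s, hs⟩ else 0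
  rw [← Fin.sum_univ_eq_sum_range
      (fun s => (if hs : s < N then a ⟨s, hs⟩ else 0) • v s) N,
    ← Fin.sum_univ_eq_sum_range
      (fun s => (if hs : s < N then a ⟨s, hs⟩ else 0) • u s) N] at hu
  simpa only [Fin.is_lt, dite_true, Fin.eta] using hu

theorem norm_sum_ell1Basis (N : ℕ) (a : ℕ → ℝ) :
    ‖∑ s ∈ Finset.range N, a s • ell1Basis s‖ = ∑ s ∈ Finset.range N, |a s| := by
  have h := lp.norm_sum_single (E := fun _ : ℕ => ℝ) (p := 1) (by norm_num) a (Finset.range N)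
  simp only [ENNReal.toReal_one, Real.rpow_one, Real.norm_eq_abs] at h
  rw [← h]
  congr 1
  refine Finset.sum_congr rfl fun s _ => ?_
  rw [ell1Basis, ← lp.single_smul, smul_eq_mul, mul_one]

theorem norm_sum_yBasis (P : Params) (N : ℕ) (a : ℕ → ℝ) :
    ‖∑ s ∈ Finset.range N, a s • yBasis P s‖ = kNorm (KY P) (vec N a) := by
  simp only [yBasis]
  rw [incl_sum_smul, norm_incl, vec]

theorem GPair.dominates_ell1 {P : Params} {N : ℕ} {x f : ℕ → c00} {κ : ℕ → ℕ}
    (h : GPair P N x f κ) :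
    Dominates 1 (fun s : Fin N => incl (KX P) (x (2 * s))) (fun s : Fin N => ell1Basis s) := by
  refine dominates_fin (u := fun s => incl (KX P) (x (2 * s))) zero_le_one fun a => ?_
  rw [norm_sum_ell1Basis, incl_sum_smul, norm_incl, one_mul]
  exact h.sum_abs_le a

theorem GPair.dominates_of_ell1 {P : Params} {N : ℕ} {x f : ℕ → c00} {κ : ℕ → ℕ}
    (h : GPair P N x f κ) :
    Dominates 3 (fun s : Fin N => ell1Basis s) (fun s : Fin N => incl (KX P) (x (2 * s))) := by
  refine dominates_fin (v := fun s => incl (KX P) (x (2 * s))) (by norm_num) fun a => ?_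
  rw [norm_sum_ell1Basis, incl_sum_smul, norm_incl]
  exact h.kNorm_sum_le_sum_abs a

theorem GPair.dominates_yBasis {P : Params} {N : ℕ} {x f : ℕ → c00} {κ : ℕ → ℕ}
    (h : GPair P N x f κ) :
    Dominates 1 (fun s : Fin N => incl (KX P) (x (2 * s) - x (2 * s + 1)))
      (fun s : Fin N => yBasis P s) := by
  refine dominates_fin (u := fun s => incl (KX P) (x (2 * s) - x (2 * s + 1))) zero_le_one
    fun a => ?_
  rw [norm_sum_yBasis, incl_sum_smul, norm_incl, one_mul]
  exact h.kNorm_vec_le a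

theorem FarGPair.dominates_of_yBasis {P : Params} {N M : ℕ} {x f : ℕ → c00} {κ : ℕ → ℕ}
    (h : FarGPair P N M x f κ) :
    Dominates 20 (fun s : Fin N => yBasis P s)
      (fun s : Fin N => incl (KX P) (x (2 * s) - x (2 * s + 1))) := by
  refine dominates_fin (v := fun s => incl (KX P) (x (2 * s) - x (2 * s + 1))) (by norm_num)
    fun a => ?_
  rw [norm_sum_yBasis, incl_sum_smul, norm_incl]
  have := h.kNorm_sum_le a
  have := kNorm_nonneg (KY P) (vec N a)
  linarith

/-! ### Combinations of the projections -/

theorem exists_lt_norm_incl {K : NormingSet} {F : Type*} [NormedAddCommGroup F]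
    [NormedSpace ℝ F] (T : Space K →L[ℝ] F) {C : ℝ} (hC : 0 ≤ C) (hT : C < ‖T‖) :
    ∃ y : c00, C * kNorm K y < ‖T (incl K y)‖ := by
  by_contra! hle
  refine absurd (T.opNorm_le_bound hC fun z => ?_) (not_le.mpr hT)
  induction z using UniformSpace.Completion.induction_on with
  | hp => exact isClosed_le (T.continuous.norm) (continuous_const.mul continuous_norm)
  | ih y =>
    exact (hle y).trans_eq (congrArg _ (norm_incl K y).symm)

theorem sum_smul_proj_incl (P : Params) (R : ℕ) (a : ℕ → ℝ) (y : c00) :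
    (∑ s ∈ Finset.range R, a s • proj P s.succPNat) (incl (KX P) y) =
      incl (KX P) (∑ s ∈ Finset.range R, a s • res (P.J s.succPNat) y) := by
  rw [sum_apply, ← incl_sum_smul]
  refine Finset.sum_congr rfl fun s _ => ?_
  rw [smul_apply, proj_incl]

theorem GPair.res_J_of_ne {P : Params} {N : ℕ} {x f : ℕ → c00} {κ : ℕ → ℕ}
    (h : GPair P N x f κ) {l : ℕ} (hl : l < 2 * N) {t : ℕ+} (ht : t ≠ hidx N l) :
    res (P.J t) (x l) = 0 :=
  res_eq_zero fun hmem => ht (hsupp_subset_of_suppIn (h.suppIn hl) hmem)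

/-- As `R ≤ N`, the second vectors lie over `J_{N+s+1}`, outside the first `R` classes, and
disappear. -/
theorem GPair.res_J_sum {P : Params} {N : ℕ} {x f : ℕ → c00} {κ : ℕ → ℕ}
    (h : GPair P N x f κ) {R : ℕ} (hR : R ≤ N) (b : ℕ → ℝ) {t : ℕ} (ht : t < R) :
    res (P.J t.succPNat) (∑ s ∈ Finset.range R, b s • (x (2 * s) - x (2 * s + 1))) =
      b t • x (2 * t) := by
  rw [map_sum, Finset.sum_eq_single t]
  · have h1 := h.suppIn (l := 2 * t) (by omega)
    rw [hidx_even] at h1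
    rw [map_smul, map_sub, res_eq_self h1, h.res_J_of_ne (l := 2 * t + 1) (by omega), sub_zero]
    rw [hidx_odd]
    exact succPNat_ne (by omega)
  · intro s hs hst
    rw [Finset.mem_range] at hs
    rw [map_smul, map_sub, h.res_J_of_ne (l := 2 * s) (by omega),
      h.res_J_of_ne (l := 2 * s + 1) (by omega), sub_zero, smul_zero]
    · rw [hidx_odd]
      exact succPNat_ne (by omega)
    · rw [hidx_even]
      exact succPNat_ne (Ne.symm hst)
  · intro ht'
    exact absurd (Finset.mem_range.mpr ht) ht'

theorem sum_range_eq_of_le {M : Type*} [AddCommMonoid M] {R N : ℕ} (hR : R ≤ N) {g : ℕ → M}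
    (hg : ∀ s, R ≤ s → g s = 0) : ∑ s ∈ Finset.range R, g s = ∑ s ∈ Finset.range N, g s :=
  Finset.sum_subset (Finset.range_subset_range.mpr hR) fun s _ hs =>
    hg s (not_lt.mp fun h => hs (Finset.mem_range.mpr h))

theorem FarGPair.exists_norm_sum_proj_le {P : Params} {N M : ℕ} {x f : ℕ → c00} {κ : ℕ → ℕ}
    (h : FarGPair P N M x f κ) {R : ℕ} (hR : R ≤ N) (a : ℕ → ℝ) : ∃ b : ℕ → ℝ,
      ‖incl (KX P) (∑ s ∈ Finset.range R, b s • (x (2 * s) - x (2 * s + 1)))‖ ≤ 1 ∧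
      ‖∑ s ∈ Finset.range R, a s • proj P s.succPNat‖ ≤
        40 * ‖(∑ s ∈ Finset.range R, a s • proj P s.succPNat)
          (incl (KX P) (∑ s ∈ Finset.range R, b s • (x (2 * s) - x (2 * s + 1))))‖ := by
  set T := ∑ s ∈ Finset.range R, a s • proj P s.succPNat with hT
  rcases (norm_nonneg T).eq_or_lt with h0 | h0
  · refine ⟨0, ?_, ?_⟩
    · have hz : incl (KX P) 0 = 0 := map_zero (inclₗ (KX P))
      simp [hz]
    · rw [← h0]
      positivity
  -- The norm need not be attained; the slack `9 / 10` is what turns 36 into 40.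
  obtain ⟨y, hy⟩ := exists_lt_norm_incl T (C := 9 / 10 * ‖T‖) (by positivity) (by linarith)
  have hy0 : 0 < kNorm (KX P) y := by
    refine (kNorm_nonneg _ y).lt_of_ne fun hy0 => ?_
    have := T.le_opNorm (incl (KX P) y)
    rw [norm_incl, ← hy0, mul_zero] at this
    rw [← hy0, mul_zero] at hy
    linarith
  rw [hT, sum_smul_proj_incl, norm_incl] at hy
  obtain ⟨g, hg, hlt⟩ := exists_lt_act hy
  rw [← hT] at hlt
  set β : ℕ → ℝ := fun s => act g (res (P.J s.succPNat) y) with hβ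
  have hvec : kNorm (KY P) (vec R β) ≤ 2 * kNorm (KX P) y := kNorm_vec_act_le hg y R
  -- 36 is 18 from the upper `Y`-estimate times 2 from `kNorm_vec_act_le`, so the resulting vector
  -- has norm at most 1.
  set D := (36 * kNorm (KX P) y)⁻¹ with hD
  have hD0 : 0 < D := by positivity
  have hDy : D * kNorm (KX P) y = 1 / 36 := by
    rw [hD]
    field_simp
  -- Extended by zero, so that the estimates for all `N` pairs apply to the first `R`.
  let b : ℕ → ℝ := fun s => if s < R then D * β s else 0
  have hb0 : ∀ s, R ≤ s → b s = 0 := fun s hs => if_neg (not_lt.mpr hs)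
  have hbvec : vec N b = D • vec R β := by
    rw [vec, ← sum_range_eq_of_le hR fun s hs => by rw [hb0 s hs, zero_smul], vec,
      Finset.smul_sum]
    refine Finset.sum_congr rfl fun s hs => ?_
    rw [show b s = D * β s from if_pos (Finset.mem_range.mp hs), mul_smul]
  have hsum : ∑ s ∈ Finset.range R, b s • (x (2 * s) - x (2 * s + 1)) =
      ∑ s ∈ Finset.range N, b s • (x (2 * s) - x (2 * s + 1)) :=
    sum_range_eq_of_le hR fun s hs => by rw [hb0 s hs, zero_smul]
  refine ⟨b, ?_, ?_⟩
  · rw [norm_incl, hsum]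
    refine (h.kNorm_sum_le b).trans ?_
    have h1 := kNorm_smul_le (KY P) D (vec R β)
    rw [abs_of_pos hD0] at h1
    rw [hbvec]
    have h2 := mul_le_mul_of_nonneg_left hvec hD0.le
    linarith
  · rw [hT, sum_smul_proj_incl, norm_incl]
    have e1 : ∑ t ∈ Finset.range R, a t • res (P.J t.succPNat)
        (∑ s ∈ Finset.range R, b s • (x (2 * s) - x (2 * s + 1))) =
          ∑ s ∈ Finset.range N, (a s * b s) • x (2 * s) := by
      rw [← sum_range_eq_of_le hR fun s hs => by rw [hb0 s hs, mul_zero, zero_smul]]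
      refine Finset.sum_congr rfl fun t ht => ?_
      rw [h.res_J_sum hR b (Finset.mem_range.mp ht), smul_smul]
    rw [e1]
    have e2 := h.sum_abs_le fun s => a s * b s
    rw [← sum_range_eq_of_le hR fun s hs => by rw [hb0 s hs, mul_zero, abs_zero]] at e2
    have e3 : act g (∑ s ∈ Finset.range R, a s • res (P.J s.succPNat) y) =
        ∑ s ∈ Finset.range R, a s * β s := by
      rw [map_sum]
      exact Finset.sum_congr rfl fun s _ => by rw [map_smul, smul_eq_mul]
    have e4 : ∑ s ∈ Finset.range R, a s * b s = D * ∑ s ∈ Finset.range R, a s * β s := by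
      rw [Finset.mul_sum]
      refine Finset.sum_congr rfl fun s hs => ?_
      rw [show b s = D * β s from if_pos (Finset.mem_range.mp hs)]
      ring
    have e5 := Finset.abs_sum_le_sum_abs (fun s => a s * b s) (Finset.range R)
    rw [e4, abs_mul, abs_of_pos hD0] at e5
    rw [e3] at hlt
    have e6 := mul_lt_mul_of_pos_left hlt hD0
    have e7 : D * (9 / 10 * ‖T‖ * kNorm (KX P) y) = ‖T‖ / 40 := by
      calc D * (9 / 10 * ‖T‖ * kNorm (KX P) y) = 9 / 10 * ‖T‖ * (D * kNorm (KX P) y) := by ring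
        _ = ‖T‖ / 40 := by rw [hDy]; ring
    rw [← hT]
    linarith

end HorizontalGM

theorem mainTheorem10 (P : Params) :
    -- the odd vectors and the basis of `ℓ₁`
    (∀ (N : ℕ) (x f : ℕ → c00), GSpecialPair P N x f →
      Dominates 1 (fun s : Fin N => incl (KX P) (x (2 * s))) (fun s : Fin N => ell1Basis s) ∧
      Dominates 3 (fun s : Fin N => ell1Basis s) (fun s : Fin N => incl (KX P) (x (2 * s)))) ∧
    -- the numbers `M_N`
    ∃ M : ℕ → ℕ, ∀ (N : ℕ) (x f : ℕ → c00), GSpecialPair P N x f →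
      (∀ i ∈ (x 0).support, M N < (i : ℕ)) →
      -- the differences and the basis of `Y`
      (Dominates 1 (fun s : Fin N => incl (KX P) (x (2 * s) - x (2 * s + 1)))
          (fun s : Fin N => yBasis P s) ∧
        Dominates 20 (fun s : Fin N => yBasis P s)
          (fun s : Fin N => incl (KX P) (x (2 * s) - x (2 * s + 1)))) ∧
      -- norming the combinations of the projections
      ∀ (R : ℕ), R ≤ N → ∀ a : ℕ → ℝ, ∃ b : ℕ → ℝ,
        ‖incl (KX P) (∑ s ∈ Finset.range R, b s • (x (2 * s) - x (2 * s + 1)))‖ ≤ 1 ∧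
        ‖∑ s ∈ Finset.range R, a s • proj P s.succPNat‖ ≤
          40 * ‖(∑ s ∈ Finset.range R, a s • proj P s.succPNat)
            (incl (KX P) (∑ s ∈ Finset.range R, b s • (x (2 * s) - x (2 * s + 1))))‖ := by
  refine ⟨fun N x f hx => ?_, ?_⟩
  · obtain ⟨κ, h⟩ := hx.exists_gPair
    exact ⟨h.dominates_ell1, h.dominates_of_ell1⟩
  -- The threshold `10 * N` turns the constant 5 of exact pairs into `1 / (2 N)`.
  · choose M hM using fun N : ℕ => exists_farCoding P (10 * N)
    refine ⟨M, fun N x f hx hsupp => ?_⟩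
    obtain ⟨κ, h⟩ := hx.exists_gPair
    have h' : FarGPair P N (M N) x f κ := ⟨h, hM N, hsupp⟩
    exact ⟨⟨h.dominates_yBasis, h'.dominates_of_yBasis⟩,
      fun R hR a => h'.exists_norm_sum_proj_le hR a⟩
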